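/- Let $(\Omega,\mathcal F,\mathbb P,(\mathcal F_t)_{t\ge 0})$ be a filtered probability space and $W$ an $\mathcal F_t$-Brownian motion. Fix $T>0$ and $a\in L^\infty(0,T)$, and let $(z(t))_{t\ge 0}$ be an $\mathcal F_t$-adapted, jointly measurable real process. For $u\in L^1(0,T)$ let $\xi_u$ be the (unique) solution on $[0,T]$ of the Itô equation $$d\xi_u(t)=\big[a(t)\,\xi_u(t)+z(t)-u(t)\big]\,dt+\xi_u(t)\,dW(t),\qquad \xi_u(0)=0,$$ among the adapted, jointly measurable, a.s. continuous processes with $\xi_u(t)\in L^2(\Omega)$ for all $t\in[0,T]$ and $\int_0^T\mathbb E[|\xi_u(t)|^2]\,dt<\infty$. Let $F:[0,T]\times\mathbb R\to\mathbb R$ be such that $t\mapsto F(t,x)$ is measurable for each $x$, and put $$J[u]=\mathbb E\Big[\int_0^T F(t,\xi_u(t))\,dt\Big],\qquad u\in L^1(0,T).$$ Assume: (H1) there is $p\ge 2$ with $z(t)\in L^p(\Omega)$ for every $t\in[0,T]$ and $\int_0^T\mathbb E[|z(t)|^p]^{2/p}\,dt<\infty$; (H2) $F(t,x)\ge 0$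 for all $t\in[0,T]$, $x\in\mathbb R$; (H3) for each $t\in[0,T]$ the function $F(t,\cdot)$ is twice continuously differentiable, and $\partial_xF$, $\partial_x^2F$ are continuous on $[0,T]\times\mathbb R$; (H4) there are $\alpha\in(0,p)$ and a non-negative $L\in L^1(0,T)$ with $|F(t,x)|+|\partial_xF(t,x)|+|\partial_x^2F(t,x)|\le L(t)(1+|x|^\alpha)$ for all $t\in[0,T]$, $x\in\mathbb R$; (H5) $F(t,\cdot)$ is convex for every $t\in[0,T]$. Let $\delta>0$ and let $\Psi:[0,\infty)\to[0,\infty)$ be a Young function, i.e. $\Psi(t)=\int_0^t\psi(s)\,ds$ with $\psi:[0,\infty)\to[0,\infty)$ right-continuous, non-decreasing, $\psi(0)=0$, $\psi(s)>0$ for $s>0$ and $\psi(s)\to\infty$ as $s\to\infty$. Suppose that $\Psi$ satisfies the $\Delta_2$-condition: there is $k>0$ with $\Psi(2t)\le k\,\Psi(t)$ for all $t\ge 0$. Define $$J_{\delta,\Psi}[u]=J[u]+\delta\int_0^T\Psi(|u(t)|)\,dt\in[0,\infty],\qquad u\in L^1(0,T).$$ Then there is $\bar u_{\delta,\Psi}\in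 L^1(0,T)$ with $J_{\delta,\Psi}[\bar u_{\delta,\Psi}]=\min_{u\in L^1(0,T)}J_{\delta,\Psi}[u]<\infty$. Moreover, if $F(t,\cdot)$ is strictly convex for every $t\in[0,T]$ (H5+), or if $\Psi$ is strictly convex, then the minimizer is unique in $L^1(0,T)$. -/

import Mathlib

open MeasureTheory ProbabilityTheory Filter Set
open scoped NNReal ENNReal Topology

noncomputable section

namespace DriftControl

variable {Ω : Type*} {mΩ : MeasurableSpace Ω}

/-- `W` is a Brownian motion with respect to the filtration `ℱ`: a standard real Brownian motion
(with almost surely continuous paths) that is adapted and whose increment over `(s, t]` is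
independent of `ℱ s`. -/
structure IsFiltrationBrownian (P : Measure Ω) (ℱ : Filtration ℝ≥0 mΩ)
    (W : ℝ≥0 → Ω → ℝ) : Prop where
  isBrownian : IsBrownianReal W P
  adapted : Adapted ℱ W
  indep_increment : ∀ s t : ℝ≥0, s ≤ t →
    Indep (MeasurableSpace.comap (fun ω => W t ω - W s ω) inferInstance) (ℱ s) P

/-- The space of `ℱ`-adapted (jointly measurable) processes `z` with `z(t) ∈ L^p(Ω)` for all
`t ∈ [0,T]` and `∫₀ᵀ E[|z(t)|^p]^(2/p) dt < ∞`. -/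
structure MemProcessSpace (P : Measure Ω) (ℱ : Filtration ℝ≥0 mΩ) (T p : ℝ)
    (z : ℝ≥0 → Ω → ℝ) : Prop where
  adapted : Adapted ℱ z
  measurable : Measurable (Function.uncurry z)
  memLp : ∀ t : ℝ≥0, (t : ℝ) ≤ T → MemLp (z t) (ENNReal.ofReal p) P
  lintegral_lt_top :
    ∫⁻ t in Icc (0 : ℝ) T, (∫⁻ ω, ‖z t.toNNReal ω‖ₑ ^ p ∂P) ^ (2 / p) < ∞

/-- Bounded simple (elementary) adapted processes `∑ i < n, coeff i · 1_(time i, time (i+1)]`. -/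
structure SimpleProcess (ℱ : Filtration ℝ≥0 mΩ) where
  n : ℕ
  time : ℕ → ℝ≥0
  monotone_time : Monotone time
  coeff : ℕ → Ω → ℝ
  measurable_coeff : ∀ i, Measurable[ℱ (time i)] (coeff i)
  bounded_coeff : ∃ C : ℝ, ∀ i ω, |coeff i ω| ≤ C

namespace SimpleProcess

variable {ℱ : Filtration ℝ≥0 mΩ}

/-- The process itself. -/
def eval (H : SimpleProcess ℱ) (t : ℝ≥0) (ω : Ω) : ℝ :=
  ∑ i ∈ Finset.range H.n,
    (Ioc (H.time i) (H.time (i + 1))).indicator (fun _ => H.coeff i ω) t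

/-- The elementary stochastic integral `∫₀ᵗ H dW`. -/
def integral (H : SimpleProcess ℱ) (W : ℝ≥0 → Ω → ℝ) (t : ℝ≥0) (ω : Ω) : ℝ :=
  ∑ i ∈ Finset.range H.n,
    H.coeff i ω * (W (min (H.time (i + 1)) t) ω - W (min (H.time i) t) ω)

end SimpleProcess

/-- `I` is (a version of) the Itô integral `∫₀ᵗ X dW`: there are bounded simple processes that
converge to `X` in `L²((0,t] × Ω)` and whose elementary integrals converge to `I` in `L²(Ω)`. -/
def IsItoIntegral (P : Measure Ω) (ℱ : Filtration ℝ≥0 mΩ) (W X : ℝ≥0 → Ω → ℝ) (t : ℝ≥0)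
    (I : Ω → ℝ) : Prop :=
  AEStronglyMeasurable I P ∧
  ∃ H : ℕ → SimpleProcess ℱ,
    Tendsto (fun n => eLpNorm
      (fun q : ℝ × Ω => (H n).eval q.1.toNNReal q.2 - X q.1.toNNReal q.2) 2
      ((volume.restrict (Ioc (0 : ℝ) t)).prod P)) atTop (𝓝 0) ∧
    Tendsto (fun n => eLpNorm (fun ω => (H n).integral W t ω - I ω) 2 P) atTop (𝓝 0)

/-- `X` is a (strong, square integrable) solution on `[0,T]` of
`dX(t) = [a(t) X(t) + y(t)] dt + X(t) dW(t)`, `X(0) = X₀`. -/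
structure IsSolution (P : Measure Ω) (ℱ : Filtration ℝ≥0 mΩ) (W : ℝ≥0 → Ω → ℝ) (T : ℝ)
    (a : ℝ → ℝ) (X₀ : Ω → ℝ) (y X : ℝ≥0 → Ω → ℝ) : Prop where
  mem : MemProcessSpace P ℱ T 2 X
  continuousOn : ∀ᵐ ω ∂P, ContinuousOn (fun t : ℝ≥0 => X t ω) {t | (t : ℝ) ≤ T}
  initial : X 0 =ᵐ[P] X₀
  drift_integrable : ∀ᵐ ω ∂P,
    IntegrableOn (fun s : ℝ => a s * X s.toNNReal ω + y s.toNNReal ω) (Ioc 0 T)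
  integral_eq : ∀ t : ℝ≥0, (t : ℝ) ≤ T → IsItoIntegral P ℱ W X t
    (fun ω => X t ω - X₀ ω - ∫ s in (0 : ℝ)..t, (a s * X s.toNNReal ω + y s.toNNReal ω))

open Classical in
/-- The solution map `y ↦ S_{X₀} y` of the linear equation; the value `0` is only a convention
for those data for which no solution exists. -/
def solutionMap (P : Measure Ω) (ℱ : Filtration ℝ≥0 mΩ) (W : ℝ≥0 → Ω → ℝ) (T : ℝ)
    (a : ℝ → ℝ) (X₀ : Ω → ℝ) (y : ℝ≥0 → Ω → ℝ) : ℝ≥0 → Ω → ℝ :=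
  if h : ∃ X, IsSolution P ℱ W T a X₀ y X then h.choose else 0

/-- The space `L¹(0,T)`. -/
abbrev L1 (T : ℝ) : Type := Lp ℝ 1 (volume.restrict (Ioo (0 : ℝ) T))

/-- The gap process `ξ_u = S₀(z - u)` for a deterministic `u ∈ L¹(0,T)`. -/
def gap (P : Measure Ω) (ℱ : Filtration ℝ≥0 mΩ) (W : ℝ≥0 → Ω → ℝ) (T : ℝ)
    (a : ℝ → ℝ) (z : ℝ≥0 → Ω → ℝ) (u : L1 T) : ℝ≥0 → Ω → ℝ :=
  solutionMap P ℱ W T a 0 (fun t ω => z t ω - u (t : ℝ))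

/-- The cost functional `J[u] = E ∫₀ᵀ F(t, ξ_u(t)) dt` for a nonnegative `F`. -/
def cost (P : Measure Ω) (ℱ : Filtration ℝ≥0 mΩ) (W : ℝ≥0 → Ω → ℝ) (T : ℝ)
    (a : ℝ → ℝ) (z : ℝ≥0 → Ω → ℝ) (F : ℝ → ℝ → ℝ) (u : L1 T) : ℝ≥0∞ :=
  ∫⁻ ω, (∫⁻ t in Ioo (0 : ℝ) T,
    ENNReal.ofReal (F t (gap P ℱ W T a z u t.toNNReal ω))) ∂P

/-- `Ψ`, considered on `[0,∞)`, is a Young function. -/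
def IsYoungFunction (Ψ : ℝ → ℝ) : Prop :=
  ∃ ψ : ℝ → ℝ,
    (∀ t, 0 ≤ t → Ψ t = ∫ s in (0 : ℝ)..t, ψ s) ∧
    ψ 0 = 0 ∧
    (∀ s, 0 < s → 0 < ψ s) ∧
    (∀ s, 0 ≤ s → ContinuousWithinAt ψ (Ici s) s) ∧
    MonotoneOn ψ (Ici 0) ∧
    Tendsto ψ atTop atTop

/-- The `Δ₂` condition. -/
def SatisfiesDelta2 (Ψ : ℝ → ℝ) : Prop :=
  ∃ k : ℝ, 0 < k ∧ ∀ t, 0 ≤ t → Ψ (2 * t) ≤ k * Ψ t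

/-- The penalty `∫₀ᵀ Ψ(|u(t)|) dt ∈ [0,∞]`. -/
def penalty (T : ℝ) (Ψ : ℝ → ℝ) (u : L1 T) : ℝ≥0∞ :=
  ∫⁻ t in Ioo (0 : ℝ) T, ENNReal.ofReal (Ψ |u t|)

/-- The penalized functional `J_{δ,Ψ} = J + δ ∫₀ᵀ Ψ(|u|)`. -/
def penalizedCost (P : Measure Ω) (ℱ : Filtration ℝ≥0 mΩ) (W : ℝ≥0 → Ω → ℝ) (T : ℝ)
    (a : ℝ → ℝ) (z : ℝ≥0 → Ω → ℝ) (F : ℝ → ℝ → ℝ) (δ : ℝ) (Ψ : ℝ → ℝ) (u : L1 T) : ℝ≥0∞ :=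
  cost P ℱ W T a z F u + ENNReal.ofReal δ * penalty T Ψ u

end DriftControl

end

/-!
The gap process depends affinely and continuously on the control, path by path, and this reduces the
theorem to a statement about convex functionals on `L¹`.

**The state.** By variation of constants the equation with source `y` and zero initial value has the
explicit solution `X_t = ∫₀ᵗ Γ(t,s) y_s ds` with
`Γ(t,s) = exp (∫ₛᵗ a + W_t - W_s - (t - s) / 2)` (`explicitState`). There is no Itô calculus at hand,
so that `X` solves the equation is checked against the definition of the stochastic integral. The
product rule along each path (`explicitState_eq`) turns `a X` into a part of the source, so only
`a = 0` matters. There the Euler scheme on a uniform grid has the remainder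
`X_{t_i} (exp (ΔW - Δ/2) - 1 - ΔW)`, an orthogonal sequence whose squared norms are of order `Δ²`,
plus `∫ (Γ - 1) y`, which is small by Minkowski's inequality; truncating the coefficients produces
bounded simple processes (`IsExplicit.isItoIntegral`). The filtration is not assumed complete:
`exists_measurable_ae_eq_integral` and `exists_adapted_measurable_modification` provide an adapted,
jointly measurable version of `X` (`exists_isSolution`). Conversely the Itô isometry for simple
processes on different grids shows that the stochastic integral of the definition is a contraction,
and Gronwall's lemma gives uniqueness (`IsSolution.ae_eq`). Hence for almost all `(ω, t)`
the gap process is `∫₀ᵗ Γ(t,s) z_s ds - ∫₀ᵗ Γ(t,s) u(s) ds` (`ae_gap_eq_sub`): it is affine in `u`,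
continuous for the `L¹` norm, and by Lebesgue's differentiation theorem it determines `u`. The
`L^p` bound for `Γ(t,s) y_s`, which uses the independence of `y_s` and `W_t - W_s`, makes the cost of
`u = 0` finite.

**The minimisation.** By Fatou's lemma and convexity the penalised cost is lower semicontinuous
and midpoint convex on `L¹`. A minimising sequence need not converge and the Dunford-Pettis theorem
is avoided as follows (`exists_minimizer_of_superlinear`): on the sublevel sets `{G ≤ inf G + 1/(n+1)}`
choose almost minimal elements `v_n` of the auxiliary functional `∫ √(1 + u²)`. As the sublevel sets
are closed under midpoints, the defect of convexity of `√(1 + u²)` between `v_n` and `v_k` tends to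
zero in the mean. This defect controls `|v_n - v_k|` on bounded sets, and the superlinear penalty
controls the rest, so `v_n` is an `L¹`-Cauchy sequence whose limit is a minimiser. Uniqueness is
strict midpoint convexity of the cost (with the injectivity of `u ↦ ξ_u`) or of the penalty.
-/

set_option linter.unusedSectionVars false

noncomputable section

namespace DriftControl

/-! ### Convex minimisation in `L¹` under a superlinear penalty -/

/-- The defect of midpoint convexity of `x ↦ √(1 + x²)`. -/
def sqrtGap (x y : ℝ) : ℝ :=
  (√(1 + x ^ 2) + √(1 + y ^ 2)) / 2 - √(1 + ((x + y) / 2) ^ 2)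

lemma continuous_sqrtGap : Continuous fun q : ℝ × ℝ => sqrtGap q.1 q.2 := by
  unfold sqrtGap; fun_prop

lemma sqrtGap_pos {x y : ℝ} (h : x ≠ y) : 0 < sqrtGap x y := by
  unfold sqrtGap
  rw [sub_pos, Real.sqrt_lt' (by positivity)]
  have hx := Real.sq_sqrt (show (0 : ℝ) ≤ 1 + x ^ 2 by positivity)
  have hy := Real.sq_sqrt (show (0 : ℝ) ≤ 1 + y ^ 2 by positivity)
  have h1 : 1 + x * y < √(1 + x ^ 2) * √(1 + y ^ 2) := by
    rw [← Real.sqrt_mul (by positivity)]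
    apply Real.lt_sqrt_of_sq_lt
    have := pow_pos (abs_pos.2 (sub_ne_zero.2 h)) 2
    rw [sq_abs] at this
    nlinarith
  nlinarith

lemma sqrtGap_nonneg (x y : ℝ) : 0 ≤ sqrtGap x y := by
  by_cases h : x = y
  · subst h; simp [sqrtGap]
  · exact (sqrtGap_pos h).le

/-- Strict convexity of `√(1 + x²)` controls the distance on bounded sets, and a superlinear
function controls it outside. -/
lemma exists_abs_sub_le_sqrtGap {Ψ : ℝ → ℝ} (hΨ0 : ∀ r, 0 ≤ r → 0 ≤ Ψ r)
    (hΨ : ∀ K : ℝ, ∃ R, ∀ r, R ≤ r → K * r ≤ Ψ r) {ε : ℝ} (hε : 0 < ε) :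
    ∃ C, 0 ≤ C ∧ ∀ x y : ℝ, |x - y| ≤ ε + C * sqrtGap x y + ε * (Ψ |x| + Ψ |y|) := by
  -- with this `R`, a point `x` with `|x| ≥ R` satisfies `2 |x| ≤ ε Ψ |x|`
  obtain ⟨R, hR⟩ := hΨ (2 / ε)
  -- on the compact set `S` the defect has a positive lower bound
  set S : Set (ℝ × ℝ) := (Icc (-R) R ×ˢ Icc (-R) R) ∩ {q | ε ≤ |q.1 - q.2|}
  have hS : IsCompact S :=
    (isCompact_Icc.prod isCompact_Icc).inter_right
      (isClosed_le continuous_const (by fun_prop))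
  have key : ∃ c, 0 < c ∧ ∀ q ∈ S, c ≤ sqrtGap q.1 q.2 := by
    rcases S.eq_empty_or_nonempty with h | h
    · exact ⟨1, one_pos, by simp [h]⟩
    · obtain ⟨q, hq, hmin⟩ := hS.exists_isMinOn h continuous_sqrtGap.continuousOn
      refine ⟨_, sqrtGap_pos (x := q.1) (y := q.2) ?_, fun q' hq' => hmin hq'⟩
      intro h
      have := hq.2
      simp only [mem_ofPred_eq, h, sub_self, abs_zero] at this
      linarith
  obtain ⟨c, hc, hcS⟩ := key
  refine ⟨2 * |R| / c, by positivity, fun x y => ?_⟩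
  have hg : 0 ≤ 2 * |R| / c * sqrtGap x y := mul_nonneg (by positivity) (sqrtGap_nonneg x y)
  have hx := hΨ0 |x| (abs_nonneg _)
  have hy := hΨ0 |y| (abs_nonneg _)
  have hxy : |x - y| ≤ |x| + |y| := abs_sub x y
  have big : ∀ r, R ≤ r → 2 * r ≤ ε * Ψ r := by
    intro r hr
    have := mul_le_mul_of_nonneg_left (hR r hr) hε.le
    have h2 : ε * (2 / ε * r) = 2 * r := by field_simp
    linarith
  by_cases h1 : R ≤ |x| ∧ |y| ≤ |x|
  · have := big _ h1.1
    nlinarith [h1.2]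
  by_cases h2 : R ≤ |y| ∧ |x| ≤ |y|
  · have := big _ h2.1
    nlinarith [h2.2]
  have hxR : |x| ≤ R := by
    by_contra! h
    rcases le_total |x| |y| with h' | h'
    · exact h2 ⟨by linarith, h'⟩
    · exact h1 ⟨by linarith, h'⟩
  have hyR : |y| ≤ R := by
    by_contra! h
    rcases le_total |x| |y| with h' | h'
    · exact h2 ⟨by linarith, h'⟩
    · exact h1 ⟨by linarith, h'⟩
  by_cases hd : ε ≤ |x - y|
  · have := hcS (x, y) ⟨⟨abs_le.1 hxR, abs_le.1 hyR⟩, hd⟩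
    have hRR : |R| = R := abs_of_nonneg ((abs_nonneg x).trans hxR)
    have h3 : 2 * |R| ≤ 2 * |R| / c * sqrtGap x y := by
      rw [div_mul_eq_mul_div, le_div_iff₀ hc]
      exact mul_le_mul_of_nonneg_left this (by positivity)
    nlinarith
  · push Not at hd
    nlinarith

section Minimizer

variable {X : Type*} [MeasurableSpace X] {μ : Measure X} [IsFiniteMeasure μ]

lemma integrable_sqrt_one_add_sq {u : X → ℝ} (hu : Integrable u μ) :
    Integrable (fun x => √(1 + u x ^ 2)) μ := by
  refine ((integrable_const (1 : ℝ)).add hu.abs).mono' ?_ (Eventually.of_forall fun x => ?_)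
  · exact (Real.continuous_sqrt.comp_aestronglyMeasurable
      (aestronglyMeasurable_const.add (hu.aestronglyMeasurable.pow 2)))
  · rw [Real.norm_of_nonneg (Real.sqrt_nonneg _)]
    refine Real.sqrt_le_iff.2 ⟨by simp; positivity, ?_⟩
    simp only [Pi.add_apply, ← sq_abs (u x)]
    nlinarith [abs_nonneg (u x)]

/-- A midpoint convex, lower semicontinuous functional on `L¹` that dominates a superlinear
integral functional attains its minimum. Almost minimal elements for `∫ √(1 + u²)` in the
sublevel sets form an `L¹`-Cauchy sequence, so no weak compactness is needed. -/
theorem exists_minimizer_of_superlinear {Ψ : ℝ → ℝ} (hΨm : Measurable fun x => Ψ |x|)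
    (hΨ0 : ∀ r, 0 ≤ r → 0 ≤ Ψ r)
    (hΨ : ∀ K : ℝ, ∃ R, ∀ r, R ≤ r → K * r ≤ Ψ r) {δ : ℝ} (hδ : 0 < δ)
    (G : Lp ℝ 1 μ → ℝ≥0∞)
    (hmid : ∀ u v, G ((1 / 2 : ℝ) • (u + v)) ≤ (G u + G v) / 2)
    (hlsc : LowerSemicontinuous G)
    (hcoer : ∀ u, ENNReal.ofReal δ * ∫⁻ x, ENNReal.ofReal (Ψ |u x|) ∂μ ≤ G u)
    {u₀ : Lp ℝ 1 μ} (hu₀ : G u₀ < ∞) :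
    ∃ v, G v < ∞ ∧ ∀ u, G v ≤ G u := by
  set m : ℝ≥0∞ := ⨅ u, G u with hm
  have hm_top : m < ∞ := (iInf_le _ u₀).trans_lt hu₀
  set C : ℕ → Set (Lp ℝ 1 μ) := fun n => {u | G u ≤ m + ((n : ℝ≥0∞) + 1)⁻¹} with hC
  have hCanti : ∀ {n k}, n ≤ k → C k ⊆ C n := by
    intro n k h u hu
    have hu' : G u ≤ m + ((k : ℝ≥0∞) + 1)⁻¹ := hu
    refine hu'.trans ?_
    gcongr
  have hCne : ∀ n, (C n).Nonempty := by
    intro n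
    have : m < m + ((n : ℝ≥0∞) + 1)⁻¹ :=
      ENNReal.lt_add_right hm_top.ne (by simp)
    obtain ⟨u, hu⟩ := iInf_lt_iff.1 this
    exact ⟨u, hu.le⟩
  have hCmid : ∀ n, ∀ u ∈ C n, ∀ v ∈ C n, (1 / 2 : ℝ) • (u + v) ∈ C n := by
    intro n u hu v hv
    refine (hmid u v).trans ?_
    rw [ENNReal.div_le_iff (by simp) (by simp), mul_two]
    exact add_le_add hu hv
  -- the penalty is bounded on the sublevel sets
  set B : ℝ := (m + 1).toReal / δ with hB
  have hpen_int : ∀ n, ∀ u ∈ C n, Integrable (fun x => Ψ |u x|) μ ∧ ∫ x, Ψ |u x| ∂μ ≤ B := by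
    intro n u hu
    have hmeas : AEStronglyMeasurable (fun x => Ψ |u x|) μ :=
      (hΨm.comp (Lp.stronglyMeasurable u).measurable).aestronglyMeasurable
    have h1 : ENNReal.ofReal δ * ∫⁻ x, ENNReal.ofReal (Ψ |u x|) ∂μ ≤ m + 1 := by
      refine (hcoer u).trans (le_trans hu ?_)
      gcongr
      rw [ENNReal.inv_le_one]
      exact le_add_self
    have h2 : ∫⁻ x, ENNReal.ofReal (Ψ |u x|) ∂μ ≤ ENNReal.ofReal B := by
      rw [hB, ENNReal.ofReal_div_of_pos hδ, ENNReal.ofReal_toReal (by simp [hm_top.ne]),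
        ENNReal.le_div_iff_mul_le (Or.inl (by simpa using hδ)) (Or.inl (by simp)), mul_comm]
      exact h1
    have hnn : 0 ≤ᵐ[μ] fun x => Ψ |u x| := Eventually.of_forall fun x => hΨ0 _ (abs_nonneg _)
    refine ⟨⟨hmeas, ?_⟩, ?_⟩
    · rw [hasFiniteIntegral_iff_ofReal hnn]
      exact h2.trans_lt ENNReal.ofReal_lt_top
    · rw [integral_eq_lintegral_of_nonneg_ae hnn hmeas]
      exact ENNReal.toReal_le_of_le_ofReal (by positivity) h2
  -- the auxiliary functional, and its infima over the shrinking sublevel sets, which increase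
  set θ : Lp ℝ 1 μ → ℝ := fun u => ∫ x, √(1 + u x ^ 2) ∂μ with hθ
  have hint : ∀ u : Lp ℝ 1 μ, Integrable u μ := fun u => L1.integrable_coeFn u
  have hθ0 : ∀ u, 0 ≤ θ u := fun u => integral_nonneg fun x => Real.sqrt_nonneg _
  set s : ℕ → ℝ := fun n => sInf (θ '' C n) with hs
  have hbdd : ∀ n, BddBelow (θ '' C n) := fun n => ⟨0, by rintro _ ⟨u, -, rfl⟩; exact hθ0 u⟩
  have hsle : ∀ n, ∀ u ∈ C n, s n ≤ θ u := fun n u hu => csInf_le (hbdd n) ⟨u, hu, rfl⟩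
  have hsmono : Monotone s := fun n k h =>
    csInf_le_csInf (hbdd n) ((hCne k).image _) (image_mono (hCanti h))
  have hsbdd : BddAbove (range s) := by
    obtain ⟨R, hR⟩ := hΨ 1
    refine ⟨∫ x, (1 + |R| : ℝ) ∂μ + B, ?_⟩
    rintro _ ⟨n, rfl⟩
    obtain ⟨u, hu⟩ := hCne n
    refine (hsle n u hu).trans ?_
    obtain ⟨hi, hle⟩ := hpen_int n u hu
    calc θ u ≤ ∫ x, ((1 + |R| : ℝ) + Ψ |u x|) ∂μ := by
          refine integral_mono (integrable_sqrt_one_add_sq (hint u))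
            ((integrable_const _).add hi) fun x => ?_
          have h0 := hΨ0 |u x| (abs_nonneg _)
          have h1 : |u x| ≤ |R| + Ψ |u x| := by
            rcases le_total R |u x| with h | h
            · have := hR _ h
              linarith [abs_nonneg R]
            · linarith [le_abs_self R]
          refine Real.sqrt_le_iff.2 ⟨by positivity, ?_⟩
          rw [← sq_abs (u x)]
          nlinarith [abs_nonneg (u x), abs_nonneg R]
      _ = ∫ x, (1 + |R| : ℝ) ∂μ + ∫ x, Ψ |u x| ∂μ := integral_add (integrable_const _) hi
      _ ≤ _ := by gcongr
  have hslim := tendsto_atTop_ciSup hsmono hsbdd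
  set sl : ℝ := ⨆ n, s n
  have hv : ∀ n : ℕ, ∃ v ∈ C n, θ v < s n + 1 / ((n : ℝ) + 1) := by
    intro n
    obtain ⟨_, ⟨v, hvC, rfl⟩, h⟩ := Real.lt_sInf_add_pos ((hCne n).image θ)
      (show (0 : ℝ) < 1 / ((n : ℝ) + 1) by positivity)
    exact ⟨v, hvC, h⟩
  choose v hvC hvθ using hv
  have hgapint : ∀ u w : Lp ℝ 1 μ, Integrable (fun x => sqrtGap (u x) (w x)) μ := by
    intro u w
    unfold sqrtGap
    refine (((integrable_sqrt_one_add_sq (hint u)).add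
      (integrable_sqrt_one_add_sq (hint w))).div_const 2).sub ?_
    exact integrable_sqrt_one_add_sq (((hint u).add (hint w)).div_const 2)
  -- the midpoint of `v n` and `v k` lies in `C n`, so `θ` is at least `s n` there
  have hgap : ∀ n k, n ≤ k → ∫ x, sqrtGap (v n x) (v k x) ∂μ ≤ sl - s n + 1 / ((n : ℝ) + 1) := by
    intro n k hnk
    have e : ∫ x, sqrtGap (v n x) (v k x) ∂μ
        = (θ (v n) + θ (v k)) / 2 - θ ((1 / 2 : ℝ) • (v n + v k)) := by
      unfold sqrtGap
      rw [integral_sub, integral_div, integral_add]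
      · congr 1
        refine integral_congr_ae ?_
        filter_upwards [Lp.coeFn_smul (1 / 2 : ℝ) (v n + v k), Lp.coeFn_add (v n) (v k)]
          with x h1 h2
        rw [h1, Pi.smul_apply, h2]
        simp only [Pi.add_apply, smul_eq_mul]
        congr 3; ring
      · exact integrable_sqrt_one_add_sq (hint _)
      · exact integrable_sqrt_one_add_sq (hint _)
      · exact ((integrable_sqrt_one_add_sq (hint _)).add
          (integrable_sqrt_one_add_sq (hint _))).div_const 2
      · exact integrable_sqrt_one_add_sq (((hint _).add (hint _)).div_const 2)
    have h1 := hsle n _ (hCmid n _ (hvC n) _ (hCanti hnk (hvC k)))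
    have h2 := hvθ n
    have h3 := hvθ k
    have h4 : s k ≤ sl := le_ciSup hsbdd k
    have h4' : s n ≤ sl := le_ciSup hsbdd n
    have h5 : 1 / ((k : ℝ) + 1) ≤ 1 / ((n : ℝ) + 1) := by
      have : (n : ℝ) ≤ k := by exact_mod_cast hnk
      gcongr
    rw [e]
    linarith
  have hnorm : ∀ u w : Lp ℝ 1 μ, dist u w = ∫ x, |u x - w x| ∂μ := by
    intro u w
    rw [dist_eq_norm, L1.norm_eq_integral_norm]
    refine integral_congr_ae ?_
    filter_upwards [Lp.coeFn_sub u w] with x hx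
    rw [hx]; rfl
  have hB0 : 0 ≤ B := by positivity
  have hcauchy : CauchySeq v := by
    refine Metric.cauchySeq_iff'.2 fun η hη => ?_
    set ε : ℝ := η / (2 * (μ.real univ + 2 * B + 1)) with hε
    have hD : 0 < μ.real univ + 2 * B + 1 := by positivity
    have hε0 : 0 < ε := by positivity
    obtain ⟨K, hK0, hK⟩ := exists_abs_sub_le_sqrtGap hΨ0 hΨ hε0
    have hlim : Tendsto (fun n : ℕ => K * (sl - s n + 1 / ((n : ℝ) + 1))) atTop (𝓝 0) := by
      have := ((tendsto_const_nhds (x := sl)).sub hslim).add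
        (tendsto_one_div_add_atTop_nhds_zero_nat (𝕜 := ℝ))
      simpa using this.const_mul K
    obtain ⟨N, hN⟩ := ((tendsto_order.1 hlim).2 (η / 2) (by positivity)).exists
    refine ⟨N, fun n hn => ?_⟩
    rw [dist_comm, hnorm]
    obtain ⟨i1, l1⟩ := hpen_int N _ (hvC N)
    obtain ⟨i2, l2⟩ := hpen_int n _ (hvC n)
    calc ∫ x, |v N x - v n x| ∂μ
        ≤ ∫ x, (ε + K * sqrtGap (v N x) (v n x) + ε * (Ψ |v N x| + Ψ |v n x|)) ∂μ := by
          refine integral_mono ((hint _).sub (hint _)).abs ?_ fun x => hK _ _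
          exact ((integrable_const _).add ((hgapint _ _).const_mul K)).add ((i1.add i2).const_mul ε)
      _ = ε * μ.real univ + K * ∫ x, sqrtGap (v N x) (v n x) ∂μ
            + ε * (∫ x, Ψ |v N x| ∂μ + ∫ x, Ψ |v n x| ∂μ) := by
          have j1 : Integrable (fun x => K * sqrtGap (v N x) (v n x)) μ :=
            (hgapint _ _).const_mul K
          have j2 : Integrable (fun x => ε + K * sqrtGap (v N x) (v n x)) μ :=
            (integrable_const _).add j1
          have j3 : Integrable (fun x => ε * (Ψ |v N x| + Ψ |v n x|)) μ :=
            (i1.add i2).const_mul ε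
          rw [integral_add j2 j3, integral_add (integrable_const _) j1, integral_const_mul,
            integral_const_mul, integral_add i1 i2, integral_const, smul_eq_mul,
            mul_comm (μ.real univ)]
      _ ≤ ε * μ.real univ + K * (sl - s N + 1 / ((N : ℝ) + 1)) + ε * (B + B) := by
          gcongr
          exact hgap N n hn
      _ < η := by
          have : ε * (μ.real univ + 2 * B + 1) = η / 2 := by
            rw [hε]; field_simp
          nlinarith
  obtain ⟨w, hw⟩ := cauchySeq_tendsto_of_complete hcauchy
  have hGw : G w ≤ m := by
    refine le_of_forall_lt_imp_le_of_dense fun y hy => ?_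
    have h1 : Tendsto (fun n : ℕ => m + ((n : ℝ≥0∞) + 1)⁻¹) atTop (𝓝 m) := by
      have : Tendsto (fun n : ℕ => ((n : ℝ≥0∞) + 1)⁻¹) atTop (𝓝 0) := by
        have := (tendsto_add_atTop_iff_nat 1).2 ENNReal.tendsto_inv_nat_nhds_zero
        simpa using this
      simpa using this.const_add m
    refine ge_of_tendsto h1 ?_
    filter_upwards [hw.eventually (hlsc w y hy)] with n hn
    exact hn.le.trans (hvC n)
  exact ⟨w, hGw.trans_lt hm_top, fun u => hGw.trans (iInf_le _ u)⟩

end Minimizer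

/-- On `L¹` lower semicontinuity may be tested on norm convergent sequences that also converge
almost everywhere. -/
lemma lowerSemicontinuous_of_forall_seq {X : Type*} [MeasurableSpace X] {μ : Measure X}
    {G : Lp ℝ 1 μ → ℝ≥0∞}
    (h : ∀ (v : ℕ → Lp ℝ 1 μ) (u : Lp ℝ 1 μ) (y : ℝ≥0∞), Tendsto v atTop (𝓝 u) →
      (∀ᵐ x ∂μ, Tendsto (fun n => v n x) atTop (𝓝 (u x))) → (∀ n, G (v n) ≤ y) → G u ≤ y) :
    LowerSemicontinuous G := by
  intro u y hy
  by_contra hcon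
  have hfreq : ∃ᶠ v in 𝓝 u, G v ≤ y := by
    refine fun hn => hcon (hn.mono fun v hv => not_le.1 hv)
  obtain ⟨v, hv, hvy⟩ := exists_seq_forall_of_frequently hfreq
  have hm : TendstoInMeasure μ (fun n => (v n : X → ℝ)) atTop u :=
    tendstoInMeasure_of_tendsto_Lp hv
  obtain ⟨ns, hns, hae⟩ := hm.exists_seq_tendsto_ae
  exact absurd (h (fun n => v (ns n)) u y (hv.comp hns.tendsto_atTop) hae fun n => hvy _)
    (not_le.2 hy)

/-! ### Young functions -/

/-- A Young function is the primitive of a monotone function on the whole line. -/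
lemma IsYoungFunction.exists_monotone {Ψ : ℝ → ℝ} (h : IsYoungFunction Ψ) :
    ∃ ψ : ℝ → ℝ, Monotone ψ ∧ (∀ s, 0 ≤ ψ s) ∧ (∀ s, 0 < s → 0 < ψ s) ∧
      Tendsto ψ atTop atTop ∧ ∀ t, 0 ≤ t → Ψ t = ∫ s in (0 : ℝ)..t, ψ s := by
  obtain ⟨ψ, hint, h0, hpos, -, hmono, hlim⟩ := h
  refine ⟨fun s => ψ (max s 0), fun s t hst => hmono (mem_Ici.2 (le_max_right _ _))
    (mem_Ici.2 (le_max_right _ _)) (max_le_max_right 0 hst), fun s => ?_, fun s hs => ?_, ?_,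
    fun t ht => ?_⟩
  · have := hmono self_mem_Ici (mem_Ici.2 (le_max_right s 0)) (le_max_right s 0)
    rwa [h0] at this
  · simpa [max_eq_left hs.le] using hpos s hs
  · refine hlim.congr' ?_
    filter_upwards [eventually_ge_atTop 0] with s hs
    rw [max_eq_left hs]
  · rw [hint t ht]
    refine intervalIntegral.integral_congr fun s hs => ?_
    rw [uIcc_of_le ht] at hs
    simp only [max_eq_left hs.1]

section Young

variable {Ψ : ℝ → ℝ} (h : IsYoungFunction Ψ)
include h

/-- The increments of a Young function are squeezed between the end values of its density. -/
lemma IsYoungFunction.exists_increment_bounds : ∃ ψ : ℝ → ℝ, Monotone ψ ∧ (∀ s, 0 ≤ ψ s) ∧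
    (∀ s, 0 < s → 0 < ψ s) ∧ Tendsto ψ atTop atTop ∧
    ∀ s t, 0 ≤ s → s ≤ t → (t - s) * ψ s ≤ Ψ t - Ψ s ∧ Ψ t - Ψ s ≤ (t - s) * ψ t := by
  obtain ⟨ψ, hmono, h0, hpos, hlim, hint⟩ := h.exists_monotone
  refine ⟨ψ, hmono, h0, hpos, hlim, fun s t hs hst => ?_⟩
  have hii : ∀ a b, IntervalIntegrable ψ volume a b := fun a b => hmono.intervalIntegrable
  rw [hint t (hs.trans hst), hint s hs, intervalIntegral.integral_interval_sub_left (hii _ _)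
    (hii _ _)]
  constructor
  · have := intervalIntegral.integral_mono_on (f := fun _ => ψ s) (g := ψ) hst (by simp)
      (hii _ _) fun x hx => hmono hx.1
    simpa using this
  · have := intervalIntegral.integral_mono_on (f := ψ) (g := fun _ => ψ t) hst (hii _ _)
      (by simp) fun x hx => hmono hx.2
    simpa using this

lemma IsYoungFunction.zero : Ψ 0 = 0 := by
  obtain ⟨ψ, hint, -⟩ := h
  simpa using hint 0 le_rfl

lemma IsYoungFunction.strictMonoOn : StrictMonoOn Ψ (Ici 0) := by
  obtain ⟨ψ, hmono, h0, hpos, -, hb⟩ := h.exists_increment_bounds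
  intro s hs t ht hst
  have hs' : (0 : ℝ) ≤ s := hs
  have h1 := hb s ((s + t) / 2) hs' (by linarith)
  have h2 := hb ((s + t) / 2) t (by linarith) (by linarith)
  have h3 := hpos ((s + t) / 2) (by linarith)
  have h4 : 0 < (t - (s + t) / 2) * ψ ((s + t) / 2) := mul_pos (by linarith) h3
  have h5 : 0 ≤ ((s + t) / 2 - s) * ψ s := mul_nonneg (by linarith) (h0 s)
  linarith [h1.1, h2.1]

lemma IsYoungFunction.nonneg {r : ℝ} (hr : 0 ≤ r) : 0 ≤ Ψ r := by
  rw [← h.zero]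
  exact h.strictMonoOn.monotoneOn self_mem_Ici (mem_Ici.2 hr) hr

/-- Young functions are superlinear. -/
lemma IsYoungFunction.superlinear (K : ℝ) : ∃ R, ∀ r, R ≤ r → K * r ≤ Ψ r := by
  obtain ⟨ψ, hmono, h0, hpos, hlim, hb⟩ := h.exists_increment_bounds
  obtain ⟨R, hR⟩ := (hlim.eventually_ge_atTop (2 * K)).exists_forall_of_atTop
  refine ⟨max (2 * R) 0, fun r hr => ?_⟩
  have hr0 : 0 ≤ r := (le_max_right _ _).trans hr
  have hr1 : 2 * R ≤ r := (le_max_left _ _).trans hr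
  have h1 := (hb (r / 2) r (by linarith) (by linarith)).1
  have h2 := hR (r / 2) (by linarith)
  have h3 := h.nonneg (show 0 ≤ r / 2 by linarith)
  nlinarith

lemma IsYoungFunction.continuous_comp_abs : Continuous fun x => Ψ |x| := by
  obtain ⟨ψ, hmono, h0, hpos, hlim, hint⟩ := h.exists_monotone
  have h1 : Continuous fun t => ∫ s in (0 : ℝ)..t, ψ s :=
    intervalIntegral.continuous_primitive (fun a b => hmono.intervalIntegrable) 0
  refine (h1.comp continuous_abs).congr fun x => ?_
  simp [hint |x| (abs_nonneg x)]

lemma IsYoungFunction.midpoint_le {x y : ℝ} (hx : 0 ≤ x) (hy : 0 ≤ y) :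
    Ψ ((x + y) / 2) ≤ (Ψ x + Ψ y) / 2 := by
  wlog hxy : x ≤ y generalizing x y
  · rw [add_comm, add_comm (Ψ x)]
    exact this hy hx (by linarith)
  obtain ⟨ψ, -, -, -, -, hb⟩ := h.exists_increment_bounds
  have h1 := (hb x ((x + y) / 2) hx (by linarith)).2
  have h2 := (hb ((x + y) / 2) y (by linarith) (by linarith)).1
  nlinarith

lemma IsYoungFunction.abs_midpoint_le (x y : ℝ) :
    Ψ |(x + y) / 2| ≤ (Ψ |x| + Ψ |y|) / 2 := by
  refine le_trans ?_ (h.midpoint_le (abs_nonneg x) (abs_nonneg y))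
  refine h.strictMonoOn.monotoneOn (mem_Ici.2 (abs_nonneg _)) (mem_Ici.2 (by positivity)) ?_
  rw [abs_div, abs_two]
  have := abs_add_le x y
  gcongr

/-- If `|x| = |y|` then `y = -x`, and the strict inequality comes from the strict monotonicity of
`Ψ` instead of its strict convexity. -/
lemma IsYoungFunction.abs_midpoint_lt (hs : StrictConvexOn ℝ (Ici 0) Ψ) {x y : ℝ} (hxy : x ≠ y) :
    Ψ |(x + y) / 2| < (Ψ |x| + Ψ |y|) / 2 := by
  by_cases hxy' : |x| = |y|
  · have hy : y = -x := by
      rcases abs_eq_abs.1 hxy' with h | h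
      · exact absurd h hxy
      · linarith
    have hx0 : x ≠ 0 := by
      rintro rfl
      simp [hy] at hxy
    subst hy
    have := h.strictMonoOn (self_mem_Ici (a := (0 : ℝ))) (mem_Ici.2 (abs_nonneg x)) (abs_pos.2 hx0)
    rw [h.zero] at this
    simpa [h.zero] using this
  · refine lt_of_le_of_lt (b := Ψ ((|x| + |y|) / 2)) ?_ ?_
    · refine h.strictMonoOn.monotoneOn (mem_Ici.2 (abs_nonneg _)) (mem_Ici.2 (by positivity)) ?_
      rw [abs_div, abs_two]
      have := abs_add_le x y
      gcongr
    · have := hs.2 (mem_Ici.2 (abs_nonneg x)) (mem_Ici.2 (abs_nonneg y)) hxy'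
        (show (0 : ℝ) < 1 / 2 by norm_num) (show (0 : ℝ) < 1 / 2 by norm_num) (by norm_num)
      simp only [smul_eq_mul] at this
      convert this using 1
      · congr 1; ring
      · ring

end Young

/-! ### Convex integral functionals -/

/-- A Carathéodory function agrees, for almost every parameter, with a jointly measurable one. The
null set on which it is changed is chosen uniformly for rational arguments, and continuity takes
care of the others. -/
lemma exists_measurable_uncurry_of_caratheodory {X : Type*} [MeasurableSpace X] {μ : Measure X}
    {F : X → ℝ → ℝ} (hm : ∀ x, AEMeasurable (fun t => F t x) μ)
    (hc : ∀ᵐ t ∂μ, Continuous (F t)) :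
    ∃ F' : X → ℝ → ℝ, Measurable (Function.uncurry F') ∧ ∀ᵐ t ∂μ, F' t = F t := by
  have hq : ∀ᵐ t ∂μ, Continuous (F t) ∧ ∀ q : ℚ, F t q = (hm q).mk _ t :=
    hc.and (ae_all_iff.2 fun q => (hm q).ae_eq_mk)
  obtain ⟨A, hA, hAm, hA0⟩ := exists_measurable_superset_of_null (ae_iff.1 hq)
  have hAc : ∀ t ∉ A, Continuous (F t) ∧ ∀ q : ℚ, F t q = (hm q).mk _ t := by
    intro t ht
    by_contra h
    exact ht (hA h)
  refine ⟨fun t x => Aᶜ.indicator (fun t => F t x) t, ?_, ?_⟩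
  · have hrat : ∀ q : ℚ, Measurable (Aᶜ.indicator fun t => F t q) := by
      intro q
      have : (Aᶜ.indicator fun t => F t q) = Aᶜ.indicator ((hm q).mk _) :=
        indicator_congr fun t ht => (hAc t ht).2 q
      rw [this]
      exact (hm q).measurable_mk.indicator hAm.compl
    have hx : ∀ x : ℝ, Measurable (Aᶜ.indicator fun t => F t x) := by
      intro x
      obtain ⟨q, hqx⟩ : ∃ q : ℕ → ℚ, Tendsto (fun n => (q n : ℝ)) atTop (𝓝 x) := by
        obtain ⟨u, hu, hlim⟩ := mem_closure_iff_seq_limit.1 (Rat.denseRange_cast (𝕜 := ℝ) x)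
        choose q hq using hu
        exact ⟨q, by simpa only [hq] using hlim⟩
      refine measurable_of_tendsto_metrizable (fun n => hrat (q n)) ?_
      rw [tendsto_pi_nhds]
      intro t
      by_cases ht : t ∈ A
      · simp [ht]
      · simpa [ht, Function.comp_def] using ((hAc t ht).1.tendsto x).comp hqx
    have hcont : ∀ t, Continuous fun x => Aᶜ.indicator (fun t => F t x) t := by
      intro t
      by_cases ht : t ∈ A
      · simpa [ht] using continuous_const
      · simpa [ht] using (hAc t ht).1
    exact (measurable_uncurry_of_continuous_of_measurable
      (u := fun x t => Aᶜ.indicator (fun t => F t x) t) hcont hx).comp measurable_swap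
  · have : ∀ᵐ t ∂μ, t ∉ A := measure_eq_zero_iff_ae_notMem.1 hA0
    filter_upwards [this] with t ht
    funext x
    simp [ht]

lemma liminf_add_liminf_le (f g : ℕ → ℝ≥0∞) :
    liminf f atTop + liminf g atTop ≤ liminf (fun n => f n + g n) atTop := by
  rw [liminf_eq_iSup_iInf_of_nat, liminf_eq_iSup_iInf_of_nat, liminf_eq_iSup_iInf_of_nat,
    ENNReal.iSup_add_iSup_of_monotone]
  · gcongr with n
    exact le_iInf₂ fun i hi => add_le_add (iInf₂_le i hi) (iInf₂_le i hi)
  · exact fun a b hab => le_iInf₂ fun i hi => iInf₂_le i (hab.trans hi)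
  · exact fun a b hab => le_iInf₂ fun i hi => iInf₂_le i (hab.trans hi)

section Midpoint

variable {X : Type*} [MeasurableSpace X] {ν : Measure X} {f g h : X → ℝ≥0∞}

lemma lintegral_le_half_add (hf : AEMeasurable f ν)
    (hle : ∀ᵐ q ∂ν, h q ≤ (f q + g q) / 2) :
    ∫⁻ q, h q ∂ν ≤ (∫⁻ q, f q ∂ν + ∫⁻ q, g q ∂ν) / 2 := by
  refine (lintegral_mono_ae hle).trans_eq ?_
  simp only [div_eq_mul_inv]
  rw [lintegral_mul_const' _ _ (by simp), lintegral_add_left' hf]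

/-- Equality of the integrals in a pointwise midpoint inequality forces pointwise equality. -/
lemma ae_eq_half_add_of_lintegral (hf : AEMeasurable f ν) (hg : AEMeasurable g ν)
    (hle : ∀ᵐ q ∂ν, h q ≤ (f q + g q) / 2) (hfin : ∫⁻ q, h q ∂ν ≠ ∞)
    (heq : (∫⁻ q, f q ∂ν + ∫⁻ q, g q ∂ν) / 2 ≤ ∫⁻ q, h q ∂ν) :
    ∀ᵐ q ∂ν, h q = (f q + g q) / 2 := by
  refine ae_eq_of_ae_le_of_lintegral_le hle hfin ((hf.add hg).div_const 2) ?_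
  refine le_trans (le_of_eq ?_) heq
  simp only [div_eq_mul_inv]
  rw [lintegral_mul_const' _ _ (by simp)]
  rw [lintegral_add_left' hf]

lemma ofReal_half_add {x y : ℝ} (hx : 0 ≤ x) (hy : 0 ≤ y) :
    ENNReal.ofReal ((x + y) / 2) = (ENNReal.ofReal x + ENNReal.ofReal y) / 2 := by
  rw [ENNReal.ofReal_div_of_pos two_pos, ENNReal.ofReal_add hx hy]
  simp

lemma coeFn_half_smul_add (u v : Lp ℝ 1 ν) :
    ((1 / 2 : ℝ) • (u + v) : Lp ℝ 1 ν) =ᵐ[ν] fun t => (u t + v t) / 2 := by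
  filter_upwards [Lp.coeFn_smul (1 / 2 : ℝ) (u + v), Lp.coeFn_add u v] with t h1 h2
  rw [h1, Pi.smul_apply, h2]
  simp only [Pi.add_apply, smul_eq_mul]
  ring

end Midpoint

/-! ### The penalised problem for an affine state map -/

/-- Existence and uniqueness of minimisers of `u ↦ ∫ F(t, ξ_u) + δ ∫ Ψ(|u|)` for a state `ξ_u`
that depends on `u` continuously, injectively, and compatibly with midpoints. The state lives on a
product `Y × X`, and `π` recovers the parameter of `F`. -/
theorem exists_minimizer_of_affine_state {X Y : Type*} [MeasurableSpace X] [MeasurableSpace Y]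
    {μ : Measure X} [IsFiniteMeasure μ] {ν : Measure (Y × X)} (π : Y × X → X)
    (hπ : Measure.QuasiMeasurePreserving π ν μ)
    {F : X → ℝ → ℝ} (hFm : ∀ x, AEMeasurable (fun t => F t x) μ)
    (hF0 : ∀ᵐ t ∂μ, ∀ x, 0 ≤ F t x) (hFc : ∀ᵐ t ∂μ, Continuous (F t))
    (hFconv : ∀ᵐ t ∂μ, ConvexOn ℝ univ (F t))
    (ξ : Lp ℝ 1 μ → Y × X → ℝ) (hξm : ∀ u, Measurable (ξ u))
    (hξmid : ∀ u v, ∀ᵐ q ∂ν, ξ ((1 / 2 : ℝ) • (u + v)) q = (ξ u q + ξ v q) / 2)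
    (hξlim : ∀ (v : ℕ → Lp ℝ 1 μ) (u : Lp ℝ 1 μ), Tendsto v atTop (𝓝 u) →
      ∀ᵐ q ∂ν, Tendsto (fun n => ξ (v n) q) atTop (𝓝 (ξ u q)))
    (hξinj : ∀ u v, ξ u =ᵐ[ν] ξ v → u = v)
    {δ : ℝ} (hδ : 0 < δ) {Ψ : ℝ → ℝ} (hΨ : IsYoungFunction Ψ)
    (G : Lp ℝ 1 μ → ℝ≥0∞)
    (hG : ∀ u, G u = ∫⁻ q, ENNReal.ofReal (F (π q) (ξ u q)) ∂ν
      + ENNReal.ofReal δ * ∫⁻ x, ENNReal.ofReal (Ψ |u x|) ∂μ)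
    {u₀ : Lp ℝ 1 μ} (hu₀ : G u₀ < ∞) :
    (∃ v, G v < ∞ ∧ ∀ u, G v ≤ G u) ∧
    (((∀ᵐ t ∂μ, StrictConvexOn ℝ univ (F t)) ∨ StrictConvexOn ℝ (Ici 0) Ψ) →
      ∃! v, ∀ u, G v ≤ G u) := by
  obtain ⟨F', hF'm, hF'⟩ := exists_measurable_uncurry_of_caratheodory hFm hFc
  have hcm : ∀ u, AEMeasurable (fun q => ENNReal.ofReal (F (π q) (ξ u q))) ν := by
    intro u
    refine ((hF'm.comp (hπ.measurable.prodMk (hξm u))).ennreal_ofReal.aemeasurable).congr ?_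
    filter_upwards [hπ.ae hF'] with q hq
    simp [Function.uncurry, hq]
  have hpm : ∀ u : Lp ℝ 1 μ, AEMeasurable (fun x => ENNReal.ofReal (Ψ |u x|)) μ := fun u =>
    (hΨ.continuous_comp_abs.measurable.comp
      (Lp.stronglyMeasurable u).measurable).ennreal_ofReal.aemeasurable
  have hcmid : ∀ u v, ∀ᵐ q ∂ν, ENNReal.ofReal (F (π q) (ξ ((1 / 2 : ℝ) • (u + v)) q)) ≤
      (ENNReal.ofReal (F (π q) (ξ u q)) + ENNReal.ofReal (F (π q) (ξ v q))) / 2 := by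
    intro u v
    filter_upwards [hξmid u v, hπ.ae hF0, hπ.ae hFconv] with q h1 h2 h3
    rw [h1, ← ofReal_half_add (h2 _) (h2 _)]
    refine ENNReal.ofReal_le_ofReal ?_
    have := h3.2 (mem_univ (ξ u q)) (mem_univ (ξ v q)) (show (0 : ℝ) ≤ 1 / 2 by norm_num)
      (show (0 : ℝ) ≤ 1 / 2 by norm_num) (by norm_num)
    simp only [smul_eq_mul] at this
    rw [show 1 / 2 * ξ u q + 1 / 2 * ξ v q = (ξ u q + ξ v q) / 2 by ring] at this
    linarith
  have hpmid : ∀ u v : Lp ℝ 1 μ, ∀ᵐ x ∂μ,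
      ENNReal.ofReal (Ψ |((1 / 2 : ℝ) • (u + v) : Lp ℝ 1 μ) x|) ≤
      (ENNReal.ofReal (Ψ |u x|) + ENNReal.ofReal (Ψ |v x|)) / 2 := by
    intro u v
    filter_upwards [coeFn_half_smul_add u v] with x hx
    rw [hx, ← ofReal_half_add (hΨ.nonneg (abs_nonneg _)) (hΨ.nonneg (abs_nonneg _))]
    exact ENNReal.ofReal_le_ofReal (hΨ.abs_midpoint_le _ _)
  set c : Lp ℝ 1 μ → ℝ≥0∞ := fun u => ∫⁻ q, ENNReal.ofReal (F (π q) (ξ u q)) ∂ν with hc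
  set pen : Lp ℝ 1 μ → ℝ≥0∞ := fun u => ∫⁻ x, ENNReal.ofReal (Ψ |u x|) ∂μ with hpen
  have hG' : ∀ u, G u = c u + ENNReal.ofReal δ * pen u := hG
  have hcle : ∀ u v, c ((1 / 2 : ℝ) • (u + v)) ≤ (c u + c v) / 2 := fun u v =>
    lintegral_le_half_add (hcm u) (hcmid u v)
  have hple : ∀ u v, pen ((1 / 2 : ℝ) • (u + v)) ≤ (pen u + pen v) / 2 := fun u v =>
    lintegral_le_half_add (hpm u) (hpmid u v)
  have hsplit : ∀ u v, (G u + G v) / 2 =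
      (c u + c v) / 2 + ENNReal.ofReal δ * ((pen u + pen v) / 2) := by
    intro u v
    rw [hG', hG']
    simp only [div_eq_mul_inv]
    ring
  have hmid : ∀ u v, G ((1 / 2 : ℝ) • (u + v)) ≤ (G u + G v) / 2 := by
    intro u v
    rw [hsplit, hG']
    gcongr
    · exact hcle u v
    · exact hple u v
  have hlsc : LowerSemicontinuous G := by
    refine lowerSemicontinuous_of_forall_seq fun v u y hv hvae hy => ?_
    have h1 : c u ≤ liminf (fun n => c (v n)) atTop := by
      refine le_trans (lintegral_mono_ae ?_) (lintegral_liminf_le' fun n => hcm (v n))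
      filter_upwards [hξlim v u hv, hπ.ae hFc] with q h1 h2
      exact (((ENNReal.continuous_ofReal.comp h2).tendsto _).comp h1).liminf_eq.ge
    have h2 : pen u ≤ liminf (fun n => pen (v n)) atTop := by
      refine le_trans (lintegral_mono_ae ?_) (lintegral_liminf_le' fun n => hpm (v n))
      filter_upwards [hvae] with x h1
      exact (((ENNReal.continuous_ofReal.comp hΨ.continuous_comp_abs).tendsto _).comp
        h1).liminf_eq.ge
    rw [hG']
    calc c u + ENNReal.ofReal δ * pen u
        ≤ liminf (fun n => c (v n)) atTop
          + ENNReal.ofReal δ * liminf (fun n => pen (v n)) atTop := by gcongr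
      _ = liminf (fun n => c (v n)) atTop
          + liminf (fun n => ENNReal.ofReal δ * pen (v n)) atTop := by
          rw [ENNReal.liminf_const_mul_of_ne_top ENNReal.ofReal_ne_top]
      _ ≤ liminf (fun n => c (v n) + ENNReal.ofReal δ * pen (v n)) atTop :=
          liminf_add_liminf_le _ _
      _ ≤ y := by
          refine liminf_le_of_le (by isBoundedDefault) fun b hb => ?_
          obtain ⟨n, hn⟩ := hb.exists
          exact hn.trans ((hG' _).ge.trans (hy n))
  have hex : ∃ v, G v < ∞ ∧ ∀ u, G v ≤ G u := by
    refine exists_minimizer_of_superlinear hΨ.continuous_comp_abs.measurable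
      (fun r hr => hΨ.nonneg hr) hΨ.superlinear hδ G hmid hlsc (fun u => ?_) hu₀
    rw [hG]
    exact le_add_self
  refine ⟨hex, fun hstrict => ?_⟩
  obtain ⟨v, hvfin, hv⟩ := hex
  refine ⟨v, hv, fun w hw => ?_⟩
  have hwv : G w = G v := le_antisymm (hw v) (hv w)
  have hge : (G w + G v) / 2 ≤ G ((1 / 2 : ℝ) • (w + v)) := by
    rw [hwv, ENNReal.add_div, ENNReal.add_halves]
    exact hv _
  have hδ' : ENNReal.ofReal δ ≠ 0 := by simpa using hδ
  have hfin : (G w + G v) / 2 ≠ ∞ := by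
    rw [hwv, ENNReal.add_div, ENNReal.add_halves]; exact hvfin.ne
  have hge2 := hge
  rw [hsplit, hG'] at hge2
  rw [hsplit] at hfin
  have hfin1 : (c w + c v) / 2 ≠ ∞ := fun h => hfin (by rw [h]; simp)
  have hfin2 : ENNReal.ofReal δ * ((pen w + pen v) / 2) ≠ ∞ := fun h => hfin (by rw [h]; simp)
  have hfin3 : (pen w + pen v) / 2 ≠ ∞ := fun h => hfin2 (by rw [h, ENNReal.mul_top hδ'])
  -- equality at the midpoint of two minimisers forces equality in both parts of the functional
  rcases hstrict with hs | hs
  · have hceq : (c w + c v) / 2 ≤ c ((1 / 2 : ℝ) • (w + v)) := by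
      refine (ENNReal.add_le_add_iff_right hfin2).1 (hge2.trans ?_)
      gcongr
      exact hple w v
    have hae := ae_eq_half_add_of_lintegral (hcm w) (hcm v) (hcmid w v)
      ((hcle w v).trans_lt hfin1.lt_top).ne hceq
    refine hξinj _ _ ?_
    filter_upwards [hae, hξmid w v, hπ.ae hF0, hπ.ae hs] with q h1 h2 h3 h4
    by_contra hne
    rw [h2, ← ofReal_half_add (h3 _) (h3 _), ENNReal.ofReal_eq_ofReal_iff (h3 _)
      (by have := h3 (ξ w q); have := h3 (ξ v q); positivity)] at h1
    have := h4.2 (mem_univ (ξ w q)) (mem_univ (ξ v q)) hne (show (0 : ℝ) < 1 / 2 by norm_num)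
      (show (0 : ℝ) < 1 / 2 by norm_num) (by norm_num)
    simp only [smul_eq_mul] at this
    rw [show 1 / 2 * ξ w q + 1 / 2 * ξ v q = (ξ w q + ξ v q) / 2 by ring, h1] at this
    linarith
  · have hpeq : (pen w + pen v) / 2 ≤ pen ((1 / 2 : ℝ) • (w + v)) := by
      have h1 : ENNReal.ofReal δ * ((pen w + pen v) / 2) ≤
          ENNReal.ofReal δ * pen ((1 / 2 : ℝ) • (w + v)) := by
        refine (ENNReal.add_le_add_iff_left hfin1).1 (hge2.trans ?_)
        gcongr
        exact hcle w v
      exact (ENNReal.mul_le_mul_iff_right hδ' ENNReal.ofReal_ne_top).1 h1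
    have hae := ae_eq_half_add_of_lintegral (hpm w) (hpm v) (hpmid w v)
      ((hple w v).trans_lt hfin3.lt_top).ne hpeq
    refine Lp.ext ?_
    filter_upwards [hae, coeFn_half_smul_add w v] with x h1 h2
    by_contra hne
    have n1 := hΨ.nonneg (abs_nonneg (w x))
    have n2 := hΨ.nonneg (abs_nonneg (v x))
    rw [h2, ← ofReal_half_add n1 n2, ENNReal.ofReal_eq_ofReal_iff (hΨ.nonneg (abs_nonneg _))
      (by positivity)] at h1
    exact (hΨ.abs_midpoint_lt hs hne).ne h1

/-! ### Square-integrable functions -/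

section Norms

variable {X : Type*} [MeasurableSpace X] {μ : Measure X}

lemma eLpNorm_two_sq (f : X → ℝ) : eLpNorm f 2 μ ^ 2 = ∫⁻ x, ‖f x‖ₑ ^ 2 ∂μ := by
  have := eLpNorm_nnreal_pow_eq_lintegral (p := 2) (f := f) (μ := μ) (by norm_num)
  simpa using this

lemma eLpNorm_two_sq_eq_ofReal {f : X → ℝ} (hf : MemLp f 2 μ) :
    eLpNorm f 2 μ ^ 2 = ENNReal.ofReal (∫ x, f x ^ 2 ∂μ) := by
  rw [eLpNorm_two_sq, ofReal_integral_eq_lintegral_ofReal hf.integrable_sq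
    (Eventually.of_forall fun x => sq_nonneg _)]
  refine lintegral_congr fun x => ?_
  rw [← sq_abs, ENNReal.ofReal_pow (abs_nonneg _), Real.enorm_eq_ofReal_abs]

lemma eLpNorm_ofReal_eq {p : ℝ} (hp : 0 < p) (f : X → ℝ) :
    eLpNorm f (ENNReal.ofReal p) μ = (∫⁻ x, ‖f x‖ₑ ^ p ∂μ) ^ (1 / p) := by
  rw [eLpNorm_eq_lintegral_rpow_enorm_toReal (by simpa using hp) (by simp),
    ENNReal.toReal_ofReal hp.le]

lemma integrable_mul_of_memLp_two {f g : X → ℝ} (hf : MemLp f 2 μ) (hg : MemLp g 2 μ) :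
    Integrable (fun x => f x * g x) μ := hf.integrable_mul hg

/-- The square of a sum of pairwise orthogonal functions integrates to the sum of the squares. -/
lemma eLpNorm_sum_sq_of_orthogonal {f : ℕ → X → ℝ} {n : ℕ}
    (hf : ∀ i < n, MemLp (f i) 2 μ)
    (horth : ∀ i j, i < j → j < n → ∫ x, f i x * f j x ∂μ = 0) :
    eLpNorm (fun x => ∑ i ∈ Finset.range n, f i x) 2 μ ^ 2
      = ∑ i ∈ Finset.range n, eLpNorm (f i) 2 μ ^ 2 := by
  induction n with
  | zero => simp
  | succ n ih =>
    have hS : MemLp (fun x => ∑ i ∈ Finset.range n, f i x) 2 μ :=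
      memLp_finsetSum _ fun i hi => hf i (by have := Finset.mem_range.1 hi; omega)
    have hn := hf n (by omega)
    have hcross : ∫ x, (∑ i ∈ Finset.range n, f i x) * f n x ∂μ = 0 := by
      simp_rw [Finset.sum_mul]
      rw [integral_finsetSum]
      · refine Finset.sum_eq_zero fun i hi => ?_
        exact horth i n (Finset.mem_range.1 hi) (by omega)
      · intro i hi
        exact (hf i (by have := Finset.mem_range.1 hi; omega)).integrable_mul hn
    rw [Finset.sum_range_succ, ← ih (fun i hi => hf i (by omega))
      (fun i j hij hj => horth i j hij (by omega))]
    simp_rw [Finset.sum_range_succ]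
    rw [eLpNorm_two_sq_eq_ofReal hS, eLpNorm_two_sq_eq_ofReal hn,
      eLpNorm_two_sq_eq_ofReal (f := fun x => ∑ i ∈ Finset.range n, f i x + f n x) (hS.add hn),
      ← ENNReal.ofReal_add
        (integral_nonneg fun x => sq_nonneg _) (integral_nonneg fun x => sq_nonneg _)]
    congr 1
    have h1 : Integrable (fun x => (∑ i ∈ Finset.range n, f i x) ^ 2) μ := hS.integrable_sq
    have h2 : Integrable (fun x => f n x ^ 2) μ := hn.integrable_sq
    have h3 : Integrable (fun x => (∑ i ∈ Finset.range n, f i x) * f n x) μ :=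
      hS.integrable_mul hn
    calc ∫ x, (∑ i ∈ Finset.range n, f i x + f n x) ^ 2 ∂μ
        = ∫ x, ((∑ i ∈ Finset.range n, f i x) ^ 2 + f n x ^ 2
            + 2 * ((∑ i ∈ Finset.range n, f i x) * f n x)) ∂μ := by
          refine integral_congr_ae (Eventually.of_forall fun x => ?_)
          ring
      _ = _ := by
          have h12 : Integrable (fun x => (∑ i ∈ Finset.range n, f i x) ^ 2 + f n x ^ 2) μ :=
            h1.add h2
          rw [integral_add h12 (h3.const_mul 2), integral_add h1 h2, integral_const_mul,
            hcross]
          simp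

end Norms

/-! ### Gaussian exponential moments -/

section Gaussian

variable (v : ℝ≥0)

lemma integral_exp_mul_gaussian (c : ℝ) :
    ∫ x, Real.exp (c * x) ∂(gaussianReal 0 v) = Real.exp (v * c ^ 2 / 2) := by
  have := congrFun (mgf_fun_id_gaussianReal (μ := 0) (v := v)) c
  simpa [mgf] using this

/-- Obtained as the derivative at `1` of the moment generating function. -/
lemma integral_mul_exp_gaussian :
    ∫ x, x * Real.exp x ∂(gaussianReal 0 v) = v * Real.exp (v / 2) := by
  have h1 : deriv (mgf (fun x => x) (gaussianReal 0 v)) 1 =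
      ∫ x, x * Real.exp (1 * x) ∂(gaussianReal 0 v) := by
    rw [deriv_mgf]
    simp [integrableExpSet, integrable_exp_mul_gaussianReal]
  simp only [one_mul] at h1
  rw [← h1, mgf_fun_id_gaussianReal]
  have : HasDerivAt (fun t : ℝ => Real.exp (0 * t + v * t ^ 2 / 2))
      (Real.exp (0 * 1 + v * 1 ^ 2 / 2) * (0 * 1 + v * (2 * 1) / 2)) 1 := by
    refine HasDerivAt.exp (HasDerivAt.add ((hasDerivAt_id _).const_mul 0) ?_)
    refine HasDerivAt.div_const (HasDerivAt.const_mul _ ?_) 2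
    simpa using hasDerivAt_pow 2 (1 : ℝ)
  rw [this.deriv]
  simp
  ring

lemma memLp_exp_gaussian : MemLp (fun x => Real.exp (x - v / 2)) 2 (gaussianReal 0 v) := by
  rw [memLp_two_iff_integrable_sq (by fun_prop)]
  refine ((integrable_exp_mul_gaussianReal 2).mul_const (Real.exp (-v))).congr
    (Eventually.of_forall fun x => ?_)
  simp only
  rw [← Real.exp_add, ← Real.exp_nat_mul]
  congr 1; push_cast; ring

lemma eLpNorm_exp_gaussian {p : ℝ} (hp : 0 < p) :
    eLpNorm (fun x => Real.exp (x - v / 2)) (ENNReal.ofReal p) (gaussianReal 0 v)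
      = ENNReal.ofReal (Real.exp ((p - 1) * v / 2)) := by
  rw [eLpNorm_ofReal_eq hp]
  have h1 : ∀ x : ℝ, ‖Real.exp (x - v / 2)‖ₑ ^ p =
      ENNReal.ofReal (Real.exp (p * x) * Real.exp (-(p * v / 2))) := by
    intro x
    rw [Real.enorm_eq_ofReal_abs, Real.abs_exp, ENNReal.ofReal_rpow_of_pos (Real.exp_pos _),
      ← Real.exp_mul, ← Real.exp_add]
    congr 2; ring
  simp_rw [h1]
  rw [← ofReal_integral_eq_lintegral_ofReal ((integrable_exp_mul_gaussianReal p).mul_const _)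
    (Eventually.of_forall fun x => by positivity), integral_mul_const, integral_exp_mul_gaussian,
    ← Real.exp_add, ENNReal.ofReal_rpow_of_pos (Real.exp_pos _), ← Real.exp_mul]
  congr 2
  field_simp
  ring

lemma integral_exp_gaussian : ∫ x, Real.exp (x - v / 2) ∂(gaussianReal 0 v) = 1 := by
  have : ∀ x : ℝ, Real.exp (x - v / 2) = Real.exp (1 * x) * Real.exp (-(v / 2)) := by
    intro x; rw [← Real.exp_add]; congr 1; ring
  simp_rw [this]
  rw [integral_mul_const, integral_exp_mul_gaussian, ← Real.exp_add]
  simp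

lemma memLp_id_gaussian_two : MemLp (fun x => x) 2 (gaussianReal 0 v) := by
  simpa [Function.id_def] using memLp_id_gaussianReal (μ := 0) (v := v) 2

lemma integral_sq_gaussian : ∫ x, x ^ 2 ∂(gaussianReal 0 v) = v := by
  have := variance_of_integral_eq_zero (X := fun x => x) (μ := gaussianReal 0 v)
    (by fun_prop) (by simp)
  rw [← this]
  exact variance_fun_id_gaussianReal

lemma integral_exp_sub_one_sq_gaussian :
    ∫ x, (Real.exp (x - v / 2) - 1) ^ 2 ∂(gaussianReal 0 v) = Real.exp v - 1 := by
  have h1 : Integrable (fun x => Real.exp (x - v / 2)) (gaussianReal 0 v) :=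
    (memLp_exp_gaussian v).integrable (by norm_num)
  have h2 : Integrable (fun x => Real.exp (x - v / 2) ^ 2) (gaussianReal 0 v) :=
    (memLp_exp_gaussian v).integrable_sq
  have h3 : ∫ x, Real.exp (x - v / 2) ^ 2 ∂(gaussianReal 0 v) = Real.exp v := by
    have : ∀ x : ℝ, Real.exp (x - v / 2) ^ 2 = Real.exp (2 * x) * Real.exp (-v) := by
      intro x; rw [← Real.exp_add, ← Real.exp_nat_mul]; congr 1; push_cast; ring
    simp_rw [this]
    rw [integral_mul_const, integral_exp_mul_gaussian, ← Real.exp_add]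
    congr 1; ring
  calc _ = ∫ x, (Real.exp (x - v / 2) ^ 2 - 2 * Real.exp (x - v / 2) + 1) ∂(gaussianReal 0 v) := by
        congr 1; ext x; ring
    _ = Real.exp v - 2 * 1 + 1 := by
        have h4 : Integrable (fun x => Real.exp (x - v / 2) ^ 2 - 2 * Real.exp (x - v / 2))
            (gaussianReal 0 v) := h2.sub (h1.const_mul 2)
        rw [integral_add h4 (integrable_const _),
          integral_sub h2 (h1.const_mul 2), integral_const_mul, h3, integral_exp_gaussian]
        simp
    _ = _ := by ring

lemma integral_exp_sub_one_sub_sq_gaussian :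
    ∫ x, (Real.exp (x - v / 2) - 1 - x) ^ 2 ∂(gaussianReal 0 v) = Real.exp v - 1 - v := by
  have h1 : MemLp (fun x => Real.exp (x - v / 2) - 1) 2 (gaussianReal 0 v) :=
    (memLp_exp_gaussian v).sub (memLp_const 1)
  have h2 := memLp_id_gaussian_two v
  have i1 : Integrable (fun x => (Real.exp (x - v / 2) - 1) ^ 2) (gaussianReal 0 v) :=
    h1.integrable_sq
  have i2 : Integrable (fun x : ℝ => x ^ 2) (gaussianReal 0 v) := h2.integrable_sq
  have i4 : Integrable (fun x : ℝ => x) (gaussianReal 0 v) := h2.integrable (by norm_num)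
  have i3 : Integrable (fun x => x * Real.exp (x - v / 2)) (gaussianReal 0 v) :=
    h2.integrable_mul (memLp_exp_gaussian v)
  have e3 : ∫ x, x * Real.exp (x - v / 2) ∂(gaussianReal 0 v) = v := by
    have : ∀ x : ℝ, x * Real.exp (x - v / 2) = x * Real.exp x * Real.exp (-(v / 2)) := by
      intro x; rw [mul_assoc, ← Real.exp_add]; rfl
    simp_rw [this]
    rw [integral_mul_const, integral_mul_exp_gaussian, mul_assoc, ← Real.exp_add]
    simp
  calc _ = ∫ x, ((Real.exp (x - v / 2) - 1) ^ 2 + x ^ 2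
          - 2 * (x * Real.exp (x - v / 2) - x)) ∂(gaussianReal 0 v) := by
        congr 1; ext x; ring
    _ = (Real.exp v - 1) + v - 2 * (v - 0) := by
        have j1 : Integrable (fun x => x * Real.exp (x - v / 2) - x) (gaussianReal 0 v) :=
          i3.sub i4
        have j2 : Integrable (fun x => (Real.exp (x - v / 2) - 1) ^ 2 + x ^ 2)
            (gaussianReal 0 v) := i1.add i2
        rw [integral_sub j2 (j1.const_mul 2), integral_add i1 i2, integral_const_mul,
          integral_sub i3 i4, e3, integral_exp_sub_one_sq_gaussian, integral_sq_gaussian]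
        simp
    _ = _ := by ring

end Gaussian

/-! ### Brownian increments -/

namespace IsFiltrationBrownian

variable {Ω : Type*} {mΩ : MeasurableSpace Ω} {P : Measure Ω} [IsProbabilityMeasure P]
  {ℱ : Filtration ℝ≥0 mΩ} {W : ℝ≥0 → Ω → ℝ} (hW : IsFiltrationBrownian P ℱ W)
include hW

lemma measurable_apply (t : ℝ≥0) : Measurable (W t) := (hW.adapted t).mono (ℱ.le t) le_rfl

lemma hasLaw_sub {s t : ℝ≥0} (hst : s ≤ t) :
    HasLaw (fun ω => W t ω - W s ω) (gaussianReal 0 (t - s)) P := by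
  have e : t - s = nndist (t : ℝ) (s : ℝ) := by
    apply NNReal.eq
    rw [NNReal.coe_sub hst, coe_nndist, Real.dist_eq, abs_of_nonneg (by simpa using hst)]
  rw [e]
  exact hW.isBrownian.toIsPreBrownianReal.hasLaw_sub t s

lemma indepFun_sub {s t : ℝ≥0} (hst : s ≤ t) {η : Ω → ℝ} (hη : Measurable[ℱ s] η) :
    IndepFun η (fun ω => W t ω - W s ω) P := by
  rw [IndepFun_iff_Indep]
  exact indep_of_indep_of_le_left (hW.indep_increment s t hst).symm hη.comap_le

/-- By independence the norm of the product of an `ℱ s`-measurable variable and a function of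
`W t - W s` is the product of the norms. -/
lemma eLpNorm_mul_comp_sub {s t : ℝ≥0} (hst : s ≤ t) {η : Ω → ℝ} (hη : Measurable[ℱ s] η)
    {g : ℝ → ℝ} (hg : Measurable g) {p : ℝ} (hp : 0 < p) :
    eLpNorm (fun ω => η ω * g (W t ω - W s ω)) (ENNReal.ofReal p) P =
      eLpNorm η (ENNReal.ofReal p) P *
        eLpNorm g (ENNReal.ofReal p) (gaussianReal 0 (t - s)) := by
  have hη' : Measurable η := hη.mono (ℱ.le s) le_rfl
  have hWm : Measurable fun ω => W t ω - W s ω :=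
    (hW.measurable_apply t).sub (hW.measurable_apply s)
  simp only [eLpNorm_ofReal_eq hp]
  rw [← ENNReal.mul_rpow_of_nonneg _ _ (by positivity)]
  congr 1
  simp_rw [enorm_mul, ENNReal.mul_rpow_of_nonneg _ _ hp.le]
  have hind : IndepFun (fun ω => ‖η ω‖ₑ ^ p) (fun ω => ‖g (W t ω - W s ω)‖ₑ ^ p) P :=
    (hW.indepFun_sub hst hη).comp (φ := fun x : ℝ => ‖x‖ₑ ^ p)
      (ψ := fun x => ‖g x‖ₑ ^ p) (by fun_prop) (by fun_prop)
  have := lintegral_mul_eq_lintegral_mul_lintegral_of_indepFun (μ := P)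
    (by fun_prop : Measurable fun ω => ‖η ω‖ₑ ^ p)
    (by fun_prop : Measurable fun ω => ‖g (W t ω - W s ω)‖ₑ ^ p) hind
  refine Eq.trans this ?_
  congr 1
  exact (hW.hasLaw_sub hst).lintegral_comp (f := fun x => ‖g x‖ₑ ^ p) (by fun_prop)

lemma eLpNorm_two_mul_comp_sub {s t : ℝ≥0} (hst : s ≤ t) {η : Ω → ℝ} (hη : Measurable[ℱ s] η)
    {g : ℝ → ℝ} (hg : Measurable g) :
    eLpNorm (fun ω => η ω * g (W t ω - W s ω)) 2 P =
      eLpNorm η 2 P * eLpNorm g 2 (gaussianReal 0 (t - s)) := by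
  simpa using hW.eLpNorm_mul_comp_sub hst hη hg two_pos

lemma memLp_two_mul_comp_sub {s t : ℝ≥0} (hst : s ≤ t) {η : Ω → ℝ} (hη : Measurable[ℱ s] η)
    (hη2 : MemLp η 2 P) {g : ℝ → ℝ} (hg : Measurable g)
    (hg2 : MemLp g 2 (gaussianReal 0 (t - s))) :
    MemLp (fun ω => η ω * g (W t ω - W s ω)) 2 P := by
  refine ⟨(hη2.1.mul (hg.comp ((hW.measurable_apply t).sub
    (hW.measurable_apply s))).aestronglyMeasurable), ?_⟩
  rw [hW.eLpNorm_two_mul_comp_sub hst hη hg]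
  exact ENNReal.mul_lt_top hη2.2 hg2.2

lemma integral_mul_comp_sub {s t : ℝ≥0} (hst : s ≤ t) {η : Ω → ℝ} (hη : Measurable[ℱ s] η)
    {g : ℝ → ℝ} (hg : Measurable g) :
    ∫ ω, η ω * g (W t ω - W s ω) ∂P = (∫ ω, η ω ∂P) * ∫ x, g x ∂(gaussianReal 0 (t - s)) := by
  have hWm : Measurable fun ω => W t ω - W s ω :=
    (hW.measurable_apply t).sub (hW.measurable_apply s)
  have hind : IndepFun η (fun ω => g (W t ω - W s ω)) P :=
    (hW.indepFun_sub hst hη).comp measurable_id hg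
  rw [hind.integral_fun_mul_eq_mul_integral
    (hη.mono (ℱ.le s) le_rfl).aestronglyMeasurable (hg.comp hWm).aestronglyMeasurable]
  congr 1
  exact (hW.hasLaw_sub hst).integral_comp hg.aestronglyMeasurable

/-- Martingale differences built from centred functions of disjoint increments are orthogonal. -/
lemma eLpNorm_sum_mul_comp_sub_sq {τ : ℕ → ℝ≥0} (hτ : Monotone τ) {η : ℕ → Ω → ℝ} {n : ℕ}
    (hη : ∀ i < n, Measurable[ℱ (τ i)] (η i)) (hη2 : ∀ i < n, MemLp (η i) 2 P)
    {g : ℕ → ℝ → ℝ} (hg : ∀ i, Measurable (g i))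
    (hg2 : ∀ i < n, MemLp (g i) 2 (gaussianReal 0 (τ (i + 1) - τ i)))
    (hg0 : ∀ i < n, ∫ x, g i x ∂(gaussianReal 0 (τ (i + 1) - τ i)) = 0) :
    eLpNorm (fun ω => ∑ i ∈ Finset.range n, η i ω * g i (W (τ (i + 1)) ω - W (τ i) ω)) 2 P ^ 2
      = ∑ i ∈ Finset.range n,
        eLpNorm (η i) 2 P ^ 2 * eLpNorm (g i) 2 (gaussianReal 0 (τ (i + 1) - τ i)) ^ 2 := by
  have hle : ∀ i, τ i ≤ τ (i + 1) := fun i => hτ (Nat.le_succ i)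
  rw [eLpNorm_sum_sq_of_orthogonal (fun i hi => hW.memLp_two_mul_comp_sub (hle i) (hη i hi)
    (hη2 i hi) (hg i) (hg2 i hi))]
  · refine Finset.sum_congr rfl fun i hi => ?_
    rw [hW.eLpNorm_two_mul_comp_sub (hle i) (hη i (Finset.mem_range.1 hi)) (hg i), mul_pow]
  · intro i j hij hj
    have hmeas : ∀ k l, k ≤ l → Measurable[ℱ (τ l)] (W (τ k)) := fun k l hkl =>
      (hW.adapted (τ k)).mono (ℱ.mono (hτ hkl)) le_rfl
    have h1 : Measurable[ℱ (τ j)]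
        fun ω => η i ω * g i (W (τ (i + 1)) ω - W (τ i) ω) * η j ω := by
      refine Measurable.mul (Measurable.mul ?_ ?_) (hη j hj)
      · exact (hη i (hij.trans hj)).mono (ℱ.mono (hτ hij.le)) le_rfl
      · exact (hg i).comp ((hmeas (i + 1) j hij).sub (hmeas i j hij.le))
    have h2 := hW.integral_mul_comp_sub (hle j) h1 (hg j)
    rw [hg0 j hj, mul_zero] at h2
    rw [← h2]
    congr 1; ext ω; ring

end IsFiltrationBrownian

/-! ### The Itô isometry for elementary integrals -/

section Isometry

variable {Ω : Type*} {mΩ : MeasurableSpace Ω} {P : Measure Ω} [IsProbabilityMeasure P]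
  {ℱ : Filtration ℝ≥0 mΩ} {W : ℝ≥0 → Ω → ℝ}

lemma memLp_of_bounded {η : Ω → ℝ} (hη : Measurable η) {C : ℝ} (hC : ∀ ω, |η ω| ≤ C)
    (p : ℝ≥0∞) : MemLp η p P :=
  MemLp.of_bound hη.aestronglyMeasurable C (Eventually.of_forall hC)

namespace IsFiltrationBrownian

variable (hW : IsFiltrationBrownian P ℱ W)
include hW

lemma memLp_sub (a b : ℝ≥0) : MemLp (fun ω => W b ω - W a ω) 2 P :=
  (hW.isBrownian.isGaussianProcess.hasGaussianLaw_eval b).memLp_two.sub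
    (hW.isBrownian.isGaussianProcess.hasGaussianLaw_eval a).memLp_two

lemma memLp_bdd_mul_sub (a b : ℝ≥0) {η : Ω → ℝ} (hη : Measurable η) {C : ℝ}
    (hC : ∀ ω, |η ω| ≤ C) : MemLp (fun ω => η ω * (W b ω - W a ω)) 2 P :=
  MemLp.mul (p := ⊤) (q := 2) (hW.memLp_sub a b) (memLp_of_bounded hη hC ⊤)

lemma integral_mul_sub_eq_zero {s t : ℝ≥0} (hst : s ≤ t) {η : Ω → ℝ} (hη : Measurable[ℱ s] η) :
    ∫ ω, η ω * (W t ω - W s ω) ∂P = 0 := by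
  rw [hW.integral_mul_comp_sub hst hη (g := fun x => x) measurable_id]
  simp

/-- Covariance of two elementary integrals over possibly overlapping intervals. -/
lemma integral_elementary_mul_elementary {a b c d : ℝ≥0} (hab : a ≤ b) (hcd : c ≤ d)
    {η κ : Ω → ℝ} (hη : Measurable[ℱ a] η) (hκ : Measurable[ℱ c] κ)
    {C D : ℝ} (hC : ∀ ω, |η ω| ≤ C) (hD : ∀ ω, |κ ω| ≤ D) :
    ∫ ω, (η ω * (W b ω - W a ω)) * (κ ω * (W d ω - W c ω)) ∂P
      = (∫ ω, η ω * κ ω ∂P) * ((min b d - max a c : ℝ≥0) : ℝ) := by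
  wlog hac : a ≤ c generalizing a b c d η κ C D
  · have := this hcd hab hκ hη hD hC (le_of_not_ge hac)
    rw [min_comm b d, max_comm a c]
    refine Eq.trans ?_ (this.trans ?_)
    · congr 1; ext ω; ring
    · congr 2; ext ω; ring
  have hη' : Measurable η := hη.mono (ℱ.le a) le_rfl
  have hκ' : Measurable κ := hκ.mono (ℱ.le c) le_rfl
  have hηc : Measurable[ℱ c] η := hη.mono (ℱ.mono hac) le_rfl
  have hWm : ∀ {s t : ℝ≥0}, s ≤ t → Measurable[ℱ t] (W s) := fun h =>
    (hW.adapted _).mono (ℱ.mono h) le_rfl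
  -- an increment that ends before `c` does not contribute
  have hzero : ∀ b' : ℝ≥0, b' ≤ c →
      ∫ ω, (η ω * (W b' ω - W a ω)) * (κ ω * (W d ω - W c ω)) ∂P = 0 := by
    intro b' hb'
    have h1 : Measurable[ℱ c] fun ω => η ω * (W b' ω - W a ω) * κ ω :=
      (hηc.mul ((hWm hb').sub (hWm hac))).mul hκ
    rw [← hW.integral_mul_sub_eq_zero hcd h1]
    congr 1; ext ω; ring
  rw [max_eq_right hac]
  rcases le_or_gt b c with hbc | hcb
  · rw [hzero b hbc, tsub_eq_zero_of_le ((min_le_left _ _).trans hbc)]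
    simp
  set ζ : Ω → ℝ := fun ω => η ω * κ ω with hζ
  have hζm : Measurable[ℱ c] ζ := hηc.mul hκ
  have hζm' : Measurable ζ := hη'.mul hκ'
  have hζb : ∀ ω, |ζ ω| ≤ C * D := fun ω => by
    rw [hζ, abs_mul]
    exact mul_le_mul (hC ω) (hD ω) (abs_nonneg _) ((abs_nonneg _).trans (hC ω))
  have hcm : c ≤ min b d := le_min hcb.le hcd
  have hmM : min b d ≤ max b d := min_le_max
  -- split at `c` and at `min b d`; only the square of the common increment has nonzero mean
  have hsplit : ∀ ω, (η ω * (W b ω - W a ω)) * (κ ω * (W d ω - W c ω)) =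
      (η ω * (W c ω - W a ω)) * (κ ω * (W d ω - W c ω)) +
      (ζ ω * (W (min b d) ω - W c ω) * (W (min b d) ω - W c ω) +
        ζ ω * (W (min b d) ω - W c ω) * (W (max b d) ω - W (min b d) ω)) := by
    intro ω
    simp only [hζ]
    rcases le_total b d with h | h
    · simp only [min_eq_left h, max_eq_right h]; ring
    · simp only [min_eq_right h, max_eq_left h]; ring
  simp_rw [hsplit]
  have i1 := integrable_mul_of_memLp_two (hW.memLp_bdd_mul_sub a c hη' hC)
    (hW.memLp_bdd_mul_sub c d hκ' hD)
  have i2 := integrable_mul_of_memLp_two (hW.memLp_bdd_mul_sub c (min b d) hζm' hζb)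
    (hW.memLp_sub c (min b d))
  have i3 := integrable_mul_of_memLp_two (hW.memLp_bdd_mul_sub c (min b d) hζm' hζb)
    (hW.memLp_sub (min b d) (max b d))
  have i23 : Integrable (fun ω => ζ ω * (W (min b d) ω - W c ω) * (W (min b d) ω - W c ω) +
      ζ ω * (W (min b d) ω - W c ω) * (W (max b d) ω - W (min b d) ω)) P := i2.add i3
  rw [integral_add i1 i23, hzero c le_rfl, zero_add, integral_add i2 i3]
  have h3 : ∫ ω, ζ ω * (W (min b d) ω - W c ω) * (W (max b d) ω - W (min b d) ω) ∂P = 0 :=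
    hW.integral_mul_sub_eq_zero hmM ((hζm.mono (ℱ.mono hcm) le_rfl).mul
      ((hWm le_rfl).sub (hWm hcm)))
  have h2 : ∫ ω, ζ ω * (W (min b d) ω - W c ω) * (W (min b d) ω - W c ω) ∂P =
      (∫ ω, ζ ω ∂P) * ((min b d - c : ℝ≥0) : ℝ) := by
    have := hW.integral_mul_comp_sub hcm hζm (g := fun x => x ^ 2) (by fun_prop)
    rw [integral_sq_gaussian] at this
    rw [← this]
    congr 1; ext ω; ring
  rw [h2, h3, add_zero]

/-- Itô isometry for finite sums of elementary integrands over arbitrary intervals. -/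
lemma eLpNorm_sum_elementary {ι : Type*} (S : Finset ι) {a b : ι → ℝ≥0} {t : ℝ≥0}
    {η : ι → Ω → ℝ} (hab : ∀ i, a i ≤ b i) (hbt : ∀ i, b i ≤ t)
    (hη : ∀ i, Measurable[ℱ (a i)] (η i)) (hb : ∀ i, ∃ C : ℝ, ∀ ω, |η i ω| ≤ C) :
    eLpNorm (fun ω => ∑ i ∈ S, η i ω * (W (b i) ω - W (a i) ω)) 2 P =
      eLpNorm (fun q : ℝ × Ω => ∑ i ∈ S,
        (Ioc (a i : ℝ) (b i)).indicator (fun _ => (1 : ℝ)) q.1 * η i q.2) 2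
        ((volume.restrict (Ioc (0 : ℝ) t)).prod P) := by
  choose C hC using hb
  have hη' : ∀ i, Measurable (η i) := fun i => (hη i).mono (ℱ.le _) le_rfl
  set μt : Measure ℝ := volume.restrict (Ioc (0 : ℝ) t) with hμt
  have hm1 : ∀ i, MemLp (fun ω => η i ω * (W (b i) ω - W (a i) ω)) 2 P := fun i =>
    hW.memLp_bdd_mul_sub _ _ (hη' i) (hC i)
  have hm2 : ∀ i, MemLp (fun q : ℝ × Ω =>
      (Ioc (a i : ℝ) (b i)).indicator (fun _ => (1 : ℝ)) q.1 * η i q.2) 2 (μt.prod P) := by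
    intro i
    refine MemLp.of_bound (C := C i) ?_ (Eventually.of_forall fun q => ?_)
    · refine Measurable.aestronglyMeasurable ?_
      exact ((measurable_const.indicator measurableSet_Ioc).comp measurable_fst).mul
        ((hη' i).comp measurable_snd)
    · rw [norm_mul]
      have h1 : ‖(Ioc (a i : ℝ) (b i)).indicator (fun _ => (1 : ℝ)) q.1‖ ≤ 1 := by
        by_cases h : q.1 ∈ Ioc (a i : ℝ) (b i) <;> simp [h]
      have h2 : ‖η i q.2‖ ≤ C i := hC i q.2
      calc _ ≤ 1 * ‖η i q.2‖ := by gcongr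
        _ ≤ C i := by rwa [one_mul]
  have hsq : ∀ {X : Type _} [MeasurableSpace X] {ν : Measure X} {f : ι → X → ℝ},
      (∀ i, MemLp (f i) 2 ν) → eLpNorm (fun x => ∑ i ∈ S, f i x) 2 ν ^ 2 =
        ENNReal.ofReal (∑ i ∈ S, ∑ j ∈ S, ∫ x, f i x * f j x ∂ν) := by
    intro X _ ν f hf
    rw [eLpNorm_two_sq_eq_ofReal (memLp_finsetSum _ fun i _ => hf i)]
    congr 1
    simp_rw [sq, Finset.sum_mul_sum]
    have hfg : ∀ i j, Integrable (fun x => f i x * f j x) ν := fun i j =>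
      integrable_mul_of_memLp_two (hf i) (hf j)
    rw [integral_finsetSum _ fun i _ => integrable_finsetSum _ fun j _ => hfg i j]
    exact Finset.sum_congr rfl fun i _ => integral_finsetSum _ fun j _ => hfg i j
  refine (ENNReal.pow_right_strictMono two_ne_zero).injective ?_
  rw [hsq hm1, hsq hm2]
  congr 1
  refine Finset.sum_congr rfl fun i _ => Finset.sum_congr rfl fun j _ => ?_
  rw [hW.integral_elementary_mul_elementary (hab i) (hab j) (hη i) (hη j) (hC i) (hC j)]
  have e : ∀ q : ℝ × Ω, (Ioc (a i : ℝ) (b i)).indicator (fun _ => (1 : ℝ)) q.1 * η i q.2 *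
      ((Ioc (a j : ℝ) (b j)).indicator (fun _ => (1 : ℝ)) q.1 * η j q.2) =
      (Ioc (max (a i) (a j) : ℝ) (min (b i) (b j))).indicator (fun _ => (1 : ℝ)) q.1 *
        (η i q.2 * η j q.2) := by
    intro q
    rw [← Ioc_inter_Ioc, ← indicator_indicator]
    by_cases h1 : q.1 ∈ Ioc (a i : ℝ) (b i) <;> by_cases h2 : q.1 ∈ Ioc (a j : ℝ) (b j) <;>
      simp [h1, h2]
  simp_rw [e]
  rw [integral_prod_mul (μ := μt) (ν := P)
    (fun s => (Ioc (max (a i) (a j) : ℝ) (min (b i) (b j))).indicator (fun _ => (1 : ℝ)) s)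
    (fun ω => η i ω * η j ω), mul_comm]
  congr 1
  rw [integral_indicator measurableSet_Ioc, hμt, Measure.restrict_restrict measurableSet_Ioc]
  have hsub : Ioc (max (a i) (a j) : ℝ) (min (b i) (b j)) ∩ Ioc 0 (t : ℝ) =
      Ioc (max (a i) (a j) : ℝ) (min (b i) (b j)) := by
    refine inter_eq_left.2 fun s hs => ⟨lt_of_le_of_lt ?_ hs.1, hs.2.trans ?_⟩
    · exact (a i).2.trans (le_max_left _ _)
    · exact (min_le_left _ _).trans (by exact_mod_cast hbt i)
  rw [hsub]
  simp only [integral_const, smul_eq_mul, mul_one, measureReal_restrict_apply_univ,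
    Real.volume_real_Ioc]
  rw [NNReal.coe_sub_def]
  simp

/-- The Itô isometry for the difference of two simple processes; their grids need not be related. -/
lemma eLpNorm_integral_sub_integral (H K : SimpleProcess ℱ) (t : ℝ≥0) :
    eLpNorm (fun ω => H.integral W t ω - K.integral W t ω) 2 P =
      eLpNorm (fun q : ℝ × Ω => H.eval q.1.toNNReal q.2 - K.eval q.1.toNNReal q.2) 2
        ((volume.restrict (Ioc (0 : ℝ) t)).prod P) := by
  -- coefficients switched on after time `t` do not matter
  set coef : SimpleProcess ℱ → ℕ → Ω → ℝ := fun G i => if G.time i ≤ t then G.coeff i else 0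
    with hcoef
  have hcm : ∀ (G : SimpleProcess ℱ) i, Measurable[ℱ (min (G.time i) t)] (coef G i) := by
    intro G i
    by_cases h : G.time i ≤ t
    · simp only [hcoef, h, if_true]
      rw [min_eq_left h]
      exact G.measurable_coeff i
    · simp only [hcoef, h, if_false]
      exact measurable_const
  have hcb : ∀ (G : SimpleProcess ℱ) i, ∃ C : ℝ, ∀ ω, |coef G i ω| ≤ C := by
    intro G i
    obtain ⟨C, hC⟩ := G.bounded_coeff
    by_cases h : G.time i ≤ t
    · exact ⟨C, fun ω => by simpa only [hcoef, h, if_true] using hC i ω⟩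
    · exact ⟨0, fun ω => by simp [hcoef, h]⟩
  have hint : ∀ (G : SimpleProcess ℱ) ω, G.integral W t ω = ∑ i ∈ Finset.range G.n,
      coef G i ω * (W (min (G.time (i + 1)) t) ω - W (min (G.time i) t) ω) := by
    intro G ω
    refine Finset.sum_congr rfl fun i _ => ?_
    by_cases h : G.time i ≤ t
    · simp only [hcoef, h, if_true]
    · have h1 : t ≤ G.time i := (not_le.1 h).le
      have h2 : t ≤ G.time (i + 1) := h1.trans (G.monotone_time (Nat.le_succ i))
      simp [min_eq_right h1, min_eq_right h2]
  have hev : ∀ (G : SimpleProcess ℱ) (s : ℝ) ω, s ≤ t → G.eval s.toNNReal ω =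
      ∑ i ∈ Finset.range G.n, (Ioc ((min (G.time i) t : ℝ≥0) : ℝ)
        ((min (G.time (i + 1)) t : ℝ≥0) : ℝ)).indicator (fun _ => (1 : ℝ)) s * coef G i ω := by
    intro G s ω hs
    refine Finset.sum_congr rfl fun i _ => ?_
    have hmem : s.toNNReal ∈ Ioc (G.time i) (G.time (i + 1)) ↔
        s ∈ Ioc ((min (G.time i) t : ℝ≥0) : ℝ) ((min (G.time (i + 1)) t : ℝ≥0) : ℝ) := by
      rw [mem_Ioc, mem_Ioc, Real.lt_toNNReal_iff_coe_lt, Real.toNNReal_le_iff_le_coe,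
        NNReal.coe_min, NNReal.coe_min, min_lt_iff, le_min_iff]
      constructor
      · exact fun h => ⟨Or.inl h.1, h.2, hs⟩
      · exact fun h => ⟨h.1.resolve_right (not_lt.2 hs), h.2.1⟩
    by_cases h : s.toNNReal ∈ Ioc (G.time i) (G.time (i + 1))
    · have h' := hmem.1 h
      have ht : G.time i ≤ t := h.1.le.trans (Real.toNNReal_le_iff_le_coe.2 hs)
      rw [indicator_of_mem h, indicator_of_mem h']
      simp [hcoef, ht]
    · rw [indicator_of_notMem h, indicator_of_notMem fun h' => h (hmem.2 h')]
      simp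
  -- the difference is one sum of elementary integrands over the disjoint union of the index sets
  have key := hW.eLpNorm_sum_elementary (ι := ℕ ⊕ ℕ) (t := t)
    ((Finset.range H.n).disjSum (Finset.range K.n))
    (a := Sum.elim (fun i => min (H.time i) t) (fun i => min (K.time i) t))
    (b := Sum.elim (fun i => min (H.time (i + 1)) t) (fun i => min (K.time (i + 1)) t))
    (η := Sum.elim (coef H) (fun i ω => -coef K i ω)) ?_ ?_ ?_ ?_
  · simp only [Finset.sum_disjSum, Sum.elim_inl, Sum.elim_inr] at key
    refine Eq.trans (congrArg (fun f => eLpNorm f 2 P) ?_) (key.trans (eLpNorm_congr_ae ?_))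
    · funext ω
      rw [hint, hint, sub_eq_add_neg, ← Finset.sum_neg_distrib]
      simp only [neg_mul]
    · have hle : ∀ᵐ q : ℝ × Ω ∂((volume.restrict (Ioc (0 : ℝ) t)).prod P), q.1 ≤ (t : ℝ) := by
        refine Measure.quasiMeasurePreserving_fst.ae (p := fun s => s ≤ (t : ℝ)) ?_
        filter_upwards [ae_restrict_mem measurableSet_Ioc] with s hs using hs.2
      filter_upwards [hle] with q hq
      rw [hev H _ _ hq, hev K _ _ hq, sub_eq_add_neg, ← Finset.sum_neg_distrib]
      simp only [mul_neg]
  · rintro (i | i)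
    · exact min_le_min_right _ (H.monotone_time (Nat.le_succ i))
    · exact min_le_min_right _ (K.monotone_time (Nat.le_succ i))
  · rintro (i | i) <;> exact min_le_right _ _
  · rintro (i | i)
    · exact hcm H i
    · exact (hcm K i).neg
  · rintro (i | i)
    · exact hcb H i
    · obtain ⟨C, hC⟩ := hcb K i
      exact ⟨C, fun ω => by simpa using hC ω⟩

end IsFiltrationBrownian

lemma SimpleProcess.measurable_integral (hW : IsFiltrationBrownian P ℱ W) (H : SimpleProcess ℱ)
    (t : ℝ≥0) : Measurable (H.integral W t) := by
  unfold SimpleProcess.integral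
  refine Finset.measurable_sum _ fun i _ => ?_
  exact ((H.measurable_coeff i).mono (ℱ.le _) le_rfl).mul
    ((hW.measurable_apply _).sub (hW.measurable_apply _))

lemma SimpleProcess.measurable_eval (H : SimpleProcess ℱ) :
    Measurable fun q : ℝ × Ω => H.eval q.1.toNNReal q.2 := by
  unfold SimpleProcess.eval
  refine Finset.measurable_sum _ fun i _ => ?_
  have h1 : Measurable fun q : ℝ × Ω => H.coeff i q.2 :=
    ((H.measurable_coeff i).mono (ℱ.le _) le_rfl).comp measurable_snd
  have h2 : MeasurableSet {q : ℝ × Ω | q.1.toNNReal ∈ Ioc (H.time i) (H.time (i + 1))} :=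
    (measurable_fst.real_toNNReal) measurableSet_Ioc
  convert h1.indicator h2 using 1
  funext q
  simp only [indicator, mem_ofPred_eq]

/-- The Itô integral is a contraction from `L²((0,t] × Ω)` to `L²(Ω)`; in particular its value does
not depend on the approximating simple processes. -/
lemma IsItoIntegral.eLpNorm_sub_le (hW : IsFiltrationBrownian P ℱ W) {X X' : ℝ≥0 → Ω → ℝ}
    (hX : Measurable (Function.uncurry X)) (hX' : Measurable (Function.uncurry X')) {t : ℝ≥0}
    {I I' : Ω → ℝ} (h : IsItoIntegral P ℱ W X t I) (h' : IsItoIntegral P ℱ W X' t I') :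
    eLpNorm (fun ω => I ω - I' ω) 2 P ≤
      eLpNorm (fun q : ℝ × Ω => X q.1.toNNReal q.2 - X' q.1.toNNReal q.2) 2
        ((volume.restrict (Ioc (0 : ℝ) t)).prod P) := by
  obtain ⟨hI, H, hH1, hH2⟩ := h
  obtain ⟨hI', K, hK1, hK2⟩ := h'
  set ν := (volume.restrict (Ioc (0 : ℝ) t)).prod P
  have hXm : Measurable fun q : ℝ × Ω => X q.1.toNNReal q.2 :=
    hX.comp (measurable_fst.real_toNNReal.prodMk measurable_snd)
  have hXm' : Measurable fun q : ℝ × Ω => X' q.1.toNNReal q.2 :=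
    hX'.comp (measurable_fst.real_toNNReal.prodMk measurable_snd)
  set D := eLpNorm (fun q : ℝ × Ω => X q.1.toNNReal q.2 - X' q.1.toNNReal q.2) 2 ν
  have hbound : ∀ n, eLpNorm (fun ω => I ω - I' ω) 2 P ≤
      eLpNorm (fun ω => (H n).integral W t ω - I ω) 2 P +
      (eLpNorm (fun q : ℝ × Ω => (H n).eval q.1.toNNReal q.2 - X q.1.toNNReal q.2) 2 ν + D +
        eLpNorm (fun q : ℝ × Ω => (K n).eval q.1.toNNReal q.2 - X' q.1.toNNReal q.2) 2 ν) +
      eLpNorm (fun ω => (K n).integral W t ω - I' ω) 2 P := by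
    intro n
    have m1 : AEStronglyMeasurable (fun ω => (H n).integral W t ω - I ω) P :=
      ((H n).measurable_integral hW t).aestronglyMeasurable.sub hI
    have m2 : AEStronglyMeasurable (fun ω => (H n).integral W t ω - (K n).integral W t ω) P :=
      (((H n).measurable_integral hW t).sub ((K n).measurable_integral hW t)).aestronglyMeasurable
    have m3 : AEStronglyMeasurable (fun ω => (K n).integral W t ω - I' ω) P :=
      ((K n).measurable_integral hW t).aestronglyMeasurable.sub hI'
    have n1 : AEStronglyMeasurable
        (fun q : ℝ × Ω => (H n).eval q.1.toNNReal q.2 - X q.1.toNNReal q.2) ν :=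
      ((H n).measurable_eval.sub hXm).aestronglyMeasurable
    have n2 : AEStronglyMeasurable
        (fun q : ℝ × Ω => X q.1.toNNReal q.2 - X' q.1.toNNReal q.2) ν :=
      (hXm.sub hXm').aestronglyMeasurable
    have n3 : AEStronglyMeasurable
        (fun q : ℝ × Ω => (K n).eval q.1.toNNReal q.2 - X' q.1.toNNReal q.2) ν :=
      ((K n).measurable_eval.sub hXm').aestronglyMeasurable
    have e1 : (fun ω => I ω - I' ω) = (-fun ω => (H n).integral W t ω - I ω) +
        (fun ω => (H n).integral W t ω - (K n).integral W t ω) +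
        (fun ω => (K n).integral W t ω - I' ω) := by
      funext ω; simp only [Pi.add_apply, Pi.neg_apply]; ring
    have e2 : (fun q : ℝ × Ω => (H n).eval q.1.toNNReal q.2 - (K n).eval q.1.toNNReal q.2) =
        (fun q : ℝ × Ω => (H n).eval q.1.toNNReal q.2 - X q.1.toNNReal q.2) +
        (fun q : ℝ × Ω => X q.1.toNNReal q.2 - X' q.1.toNNReal q.2) +
        (-fun q : ℝ × Ω => (K n).eval q.1.toNNReal q.2 - X' q.1.toNNReal q.2) := by
      funext q; simp only [Pi.add_apply, Pi.neg_apply]; ring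
    rw [e1]
    refine (eLpNorm_add_le (m1.neg.add m2) m3 one_le_two).trans ?_
    gcongr
    refine (eLpNorm_add_le m1.neg m2 one_le_two).trans ?_
    rw [eLpNorm_neg]
    gcongr
    rw [hW.eLpNorm_integral_sub_integral, e2]
    refine (eLpNorm_add_le (n1.add n2) n3.neg one_le_two).trans ?_
    rw [eLpNorm_neg]
    gcongr
    exact eLpNorm_add_le n1 n2 one_le_two
  have hlim := (hH2.add ((hH1.add_const D).add hK1)).add hK2
  simp only [zero_add, add_zero] at hlim
  exact ge_of_tendsto' hlim hbound

end Isometry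

/-! ### Integral inequalities -/

section Inequalities

variable {X Y : Type*} [MeasurableSpace X] [MeasurableSpace Y] {μ : Measure X} {ν : Measure Y}

/-- **Minkowski's integral inequality**, with an explicit majorant `w` of the inner norms. -/
lemma lintegral_lintegral_rpow_le [SFinite μ] [SFinite ν] {p : ℝ} (hp : 1 ≤ p)
    {f : X → Y → ℝ≥0∞} (hf : Measurable (Function.uncurry f))
    {w : X → ℝ≥0∞} (hw : Measurable w)
    (hw0 : ∀ᵐ s ∂μ, w s ≠ 0 ∧ w s ≠ ∞ ∧ (∫⁻ y, f s y ^ p ∂ν) ^ (1 / p) ≤ w s) :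
    (∫⁻ y, (∫⁻ s, f s y ∂μ) ^ p ∂ν) ^ (1 / p) ≤ ∫⁻ s, w s ∂μ := by
  have hp0 : 0 < p := by linarith
  have hfs : ∀ s, Measurable (f s) := fun s => hf.comp measurable_prodMk_left
  have hfy : ∀ y, Measurable fun s => f s y := fun y => hf.comp measurable_prodMk_right
  rcases hp.eq_or_lt with rfl | hp1
  · simp only [ENNReal.rpow_one, div_one] at hw0 ⊢
    rw [lintegral_lintegral_swap (f := fun y s => f s y) (hf.comp measurable_swap).aemeasurable]
    exact lintegral_mono_ae (hw0.mono fun s h => h.2.2)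
  have hpq : p.HolderConjugate (p / (p - 1)) := Real.HolderConjugate.conjExponent hp1
  set q : ℝ := p / (p - 1) with hq
  have hq0 : 0 < q := hpq.symm.pos
  have hp1' : 0 < p - 1 := by linarith
  have hdq : 1 / q * p = p - 1 := by rw [hq]; field_simp
  -- Hölder's inequality for `f = (f w^(-1/q)) w^(1/q)`
  have hpoint : ∀ y, (∫⁻ s, f s y ∂μ) ^ p ≤
      (∫⁻ s, f s y ^ p * w s ^ (1 - p) ∂μ) * (∫⁻ s, w s ∂μ) ^ (p - 1) := by
    intro y
    have h1 : ∫⁻ s, f s y ∂μ = ∫⁻ s, (f s y * w s ^ (-(1 / q))) * w s ^ (1 / q) ∂μ := by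
      refine lintegral_congr_ae (hw0.mono fun s h => ?_)
      simp only
      rw [mul_assoc, ← ENNReal.rpow_add _ _ h.1 h.2.1]
      simp
    have h2 := ENNReal.lintegral_mul_le_Lp_mul_Lq μ hpq
      (f := fun s => f s y * w s ^ (-(1 / q))) (g := fun s => w s ^ (1 / q))
      (((hfy y).mul (hw.pow_const _)).aemeasurable) (hw.pow_const _).aemeasurable
    rw [h1]
    refine (ENNReal.rpow_le_rpow h2 hp0.le).trans_eq ?_
    rw [ENNReal.mul_rpow_of_nonneg _ _ hp0.le, ← ENNReal.rpow_mul, ← ENNReal.rpow_mul,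
      one_div_mul_cancel hp0.ne', ENNReal.rpow_one, hdq]
    congr 2
    · funext s
      rw [ENNReal.mul_rpow_of_nonneg _ _ hp0.le, ← ENNReal.rpow_mul]
      congr 2
      linarith
    · refine lintegral_congr fun s => ?_
      rw [← ENNReal.rpow_mul, one_div_mul_cancel hq0.ne', ENNReal.rpow_one]
  have hmain : ∫⁻ y, (∫⁻ s, f s y ∂μ) ^ p ∂ν ≤ (∫⁻ s, w s ∂μ) ^ p := by
    have hm : Measurable (Function.uncurry fun y s => f s y ^ p * w s ^ (1 - p)) :=
      ((hf.comp measurable_swap).pow_const p).mul ((hw.comp measurable_snd).pow_const _)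
    calc ∫⁻ y, (∫⁻ s, f s y ∂μ) ^ p ∂ν
        ≤ ∫⁻ y, (∫⁻ s, f s y ^ p * w s ^ (1 - p) ∂μ) * (∫⁻ s, w s ∂μ) ^ (p - 1) ∂ν :=
          lintegral_mono hpoint
      _ = (∫⁻ s, ∫⁻ y, f s y ^ p * w s ^ (1 - p) ∂ν ∂μ) * (∫⁻ s, w s ∂μ) ^ (p - 1) := by
          rw [lintegral_mul_const _ hm.lintegral_prod_right, lintegral_lintegral_swap
            hm.aemeasurable]
      _ ≤ (∫⁻ s, w s ∂μ) * (∫⁻ s, w s ∂μ) ^ (p - 1) := by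
          gcongr ?_ * _
          refine lintegral_mono_ae (hw0.mono fun s h => ?_)
          rw [lintegral_mul_const _ ((hfs s).pow_const p)]
          calc (∫⁻ y, f s y ^ p ∂ν) * w s ^ (1 - p) ≤ w s ^ p * w s ^ (1 - p) := by
                gcongr
                have := ENNReal.rpow_le_rpow h.2.2 hp0.le
                rwa [← ENNReal.rpow_mul, one_div_mul_cancel hp0.ne', ENNReal.rpow_one] at this
            _ = w s := by
                rw [← ENNReal.rpow_add _ _ h.1 h.2.1]
                simp
      _ = (∫⁻ s, w s ∂μ) ^ p := by
          nth_rw 1 [← ENNReal.rpow_one (∫⁻ s, w s ∂μ)]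
          rw [← ENNReal.rpow_add_of_nonneg _ _ zero_le_one hp1'.le]
          congr 1; ring
  calc _ ≤ ((∫⁻ s, w s ∂μ) ^ p) ^ (1 / p) := ENNReal.rpow_le_rpow hmain (by positivity)
    _ = _ := by rw [← ENNReal.rpow_mul, mul_one_div_cancel hp0.ne', ENNReal.rpow_one]

/-- Minkowski's integral inequality for Bochner integrals. -/
lemma eLpNorm_integral_le [SFinite μ] [SFinite ν] {p : ℝ} (hp : 1 ≤ p)
    {f : X → Y → ℝ} (hf : Measurable (Function.uncurry f))
    {w : X → ℝ≥0∞} (hw : Measurable w)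
    (hw0 : ∀ᵐ s ∂μ, w s ≠ 0 ∧ w s ≠ ∞ ∧ eLpNorm (f s) (ENNReal.ofReal p) ν ≤ w s) :
    eLpNorm (fun y => ∫ s, f s y ∂μ) (ENNReal.ofReal p) ν ≤ ∫⁻ s, w s ∂μ := by
  have hp0 : 0 < p := by linarith
  rw [eLpNorm_ofReal_eq hp0]
  refine le_trans ?_ (lintegral_lintegral_rpow_le hp (f := fun s y => ‖f s y‖ₑ) (ν := ν)
    (hf.enorm) hw ?_)
  · gcongr with y
    exact enorm_integral_le_lintegral_enorm _
  · filter_upwards [hw0] with s hs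
    rwa [eLpNorm_ofReal_eq hp0] at hs

/-- The Cauchy-Schwarz inequality against the constant `1`. -/
lemma lintegral_sq_le (μ : Measure X) {f : X → ℝ≥0∞} (hf : AEMeasurable f μ) :
    (∫⁻ s, f s ∂μ) ^ 2 ≤ μ univ * ∫⁻ s, f s ^ 2 ∂μ := by
  have h := ENNReal.lintegral_mul_le_Lp_mul_Lq μ Real.HolderConjugate.two_two
    (f := fun _ => 1) (g := f) aemeasurable_const hf
  simp only [Pi.mul_apply, one_mul, ENNReal.one_rpow, lintegral_const] at h
  have h2 := pow_le_pow_left₀ (zero_le (a := ∫⁻ s, f s ∂μ)) h 2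
  refine h2.trans_eq ?_
  rw [mul_pow, ← ENNReal.rpow_natCast, ← ENNReal.rpow_natCast, ← ENNReal.rpow_mul,
    ← ENNReal.rpow_mul]
  norm_num

/-- Gronwall's lemma without initial value for extended nonnegative functions. -/
lemma eq_zero_of_le_mul_lintegral {g : ℝ → ℝ≥0∞} {T : ℝ} (hT : 0 < T) {K : ℝ} (hK : 0 ≤ K)
    (hfin : ∫⁻ s in Ioc 0 T, g s < ∞)
    (h : ∀ t, 0 ≤ t → t ≤ T → g t ≤ ENNReal.ofReal K * ∫⁻ s in Ioc 0 t, g s) :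
    ∀ t, 0 ≤ t → t ≤ T → g t = 0 := by
  -- on intervals of length `d` with `K d ≤ 1 / 2` the inequality forces `J ≤ J / 2`
  obtain ⟨n, hn⟩ := exists_nat_gt (2 * K * T)
  have hn0 : (0 : ℝ) < n := lt_of_le_of_lt (by positivity) hn
  set d : ℝ := T / n with hd
  have hd0 : 0 < d := by positivity
  have hKd : K * d ≤ 1 / 2 := by
    rw [hd, mul_div_assoc', div_le_iff₀ hn0]; linarith
  have hnd : n * d = T := by rw [hd]; field_simp
  have key : ∀ k : ℕ, k ≤ n → ∫⁻ s in Ioc 0 (k * d), g s = 0 := by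
    intro k
    induction k with
    | zero => intro _; simp
    | succ k ih =>
      intro hk
      have ih' := ih (by omega)
      have hkT : ((k + 1 : ℕ) : ℝ) * d ≤ T := by
        rw [← hnd]; gcongr
      push_cast at hkT ⊢
      set J := ∫⁻ s in Ioc (k * d) ((k + 1) * d), g s with hJ
      have hkd : (0 : ℝ) ≤ k * d := by positivity
      have hunion : ∀ t, k * d ≤ t → t ≤ (k + 1) * d → ∫⁻ s in Ioc 0 t, g s ≤ J := by
        intro t h1 h2
        calc ∫⁻ s in Ioc 0 t, g s ≤ ∫⁻ s in Ioc 0 (k * d) ∪ Ioc (k * d) ((k + 1) * d), g s := by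
              refine lintegral_mono_set fun s hs => ?_
              rcases le_or_gt s (k * d) with h | h
              · exact Or.inl ⟨hs.1, h⟩
              · exact Or.inr ⟨h, hs.2.trans h2⟩
          _ ≤ _ + J := lintegral_union_le _ _ _
          _ = J := by rw [ih', zero_add]
      have hJfin : J ≠ ∞ := by
        refine (lt_of_le_of_lt (lintegral_mono_set fun s hs => ?_) hfin).ne
        exact ⟨hkd.trans_lt hs.1, hs.2.trans hkT⟩
      have hJle : J ≤ ENNReal.ofReal (1 / 2) * J := by
        calc J ≤ ∫⁻ s in Ioc (k * d) ((k + 1) * d), ENNReal.ofReal K * J := by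
              refine setLIntegral_mono' measurableSet_Ioc fun s hs => ?_
              refine (h s (hkd.trans hs.1.le) (hs.2.trans hkT)).trans ?_
              gcongr
              exact hunion s hs.1.le hs.2
          _ = ENNReal.ofReal (K * d) * J := by
              rw [lintegral_const, Measure.restrict_apply_univ, Real.volume_Ioc,
                show ((k : ℝ) + 1) * d - k * d = d by ring, ENNReal.ofReal_mul hK]
              ring
          _ ≤ _ := by gcongr
      have hJ0 : J = 0 := by
        by_contra hne
        have h1 : ENNReal.ofReal (1 / 2) * J < 1 * J := by
          refine (ENNReal.mul_lt_mul_iff_left hne hJfin).2 ?_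
          rw [← ENNReal.ofReal_one]
          exact (ENNReal.ofReal_lt_ofReal_iff one_pos).2 (by norm_num)
        rw [one_mul] at h1
        exact absurd hJle (not_le.2 h1)
      have := hunion ((k + 1) * d) (by nlinarith) le_rfl
      rw [hJ0] at this
      exact le_antisymm this zero_le
  intro t ht0 htT
  have h1 : ∫⁻ s in Ioc 0 t, g s = 0 := by
    refine le_antisymm ?_ zero_le
    rw [← key n le_rfl, hnd]
    exact lintegral_mono_set (Ioc_subset_Ioc_right htT)
  have := h t ht0 htT
  rw [h1, mul_zero] at this
  exact le_antisymm this zero_le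

end Inequalities

/-! ### Uniqueness of solutions -/

section Uniqueness

variable {Ω : Type*} {mΩ : MeasurableSpace Ω} {P : Measure Ω} [IsProbabilityMeasure P]
  {ℱ : Filtration ℝ≥0 mΩ} {W : ℝ≥0 → Ω → ℝ}

/-- Square integrable solutions of the linear equation are unique up to modification: the second
moment of the difference of two solutions satisfies Gronwall's inequality. -/
theorem IsSolution.ae_eq (hW : IsFiltrationBrownian P ℱ W) {T : ℝ} (hT : 0 < T) {a : ℝ → ℝ}
    {C : ℝ} (haC : ∀ s, |a s| ≤ C) (ham : Measurable a)
    {X₀ : Ω → ℝ} {y X X' : ℝ≥0 → Ω → ℝ}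
    (h : IsSolution P ℱ W T a X₀ y X) (h' : IsSolution P ℱ W T a X₀ y X')
    {t : ℝ≥0} (ht : (t : ℝ) ≤ T) : X t =ᵐ[P] X' t := by
  have hC0 : 0 ≤ C := (abs_nonneg _).trans (haC 0)
  set D : ℝ → Ω → ℝ := fun s ω => X s.toNNReal ω - X' s.toNNReal ω with hD
  have hm : ∀ {Z : ℝ≥0 → Ω → ℝ}, Measurable (Function.uncurry Z) →
      Measurable (Function.uncurry fun (s : ℝ) ω => Z s.toNNReal ω) := fun hZ =>
    hZ.comp (measurable_fst.real_toNNReal.prodMk measurable_snd)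
  have hDm : Measurable (Function.uncurry D) := (hm h.mem.measurable).sub (hm h'.mem.measurable)
  set g : ℝ → ℝ≥0∞ := fun s => ∫⁻ ω, ‖D s ω‖ₑ ^ 2 ∂P with hg
  have hgm : Measurable g := (hDm.enorm.pow_const 2).lintegral_prod_right'
  have hsqadd : ∀ x y : ℝ, ‖x + y‖ₑ ^ 2 ≤ 2 * (‖x‖ₑ ^ 2 + ‖y‖ₑ ^ 2) := by
    intro x y
    have h1 : (‖x‖ₑ + ‖y‖ₑ) ^ 2 ≤ 2 * (‖x‖ₑ ^ 2 + ‖y‖ₑ ^ 2) := by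
      simp only [Real.enorm_eq_ofReal_abs]
      rw [← ENNReal.ofReal_add (abs_nonneg _) (abs_nonneg _), ← ENNReal.ofReal_pow (by positivity),
        ← ENNReal.ofReal_pow (by positivity), ← ENNReal.ofReal_pow (by positivity),
        ← ENNReal.ofReal_add (by positivity) (by positivity),
        show (2 : ℝ≥0∞) = ENNReal.ofReal 2 by simp, ← ENNReal.ofReal_mul (by norm_num)]
      exact ENNReal.ofReal_le_ofReal (by nlinarith [sq_nonneg (|x| - |y|)])
    exact (pow_le_pow_left₀ zero_le (enorm_add_le x y) 2).trans h1
  have hfin1 : ∀ {Z : ℝ≥0 → Ω → ℝ}, MemProcessSpace P ℱ T 2 Z →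
      ∫⁻ s in Ioc 0 T, ∫⁻ ω, ‖Z s.toNNReal ω‖ₑ ^ 2 ∂P < ∞ := by
    intro Z hZ
    refine lt_of_le_of_lt ?_ hZ.lintegral_lt_top
    refine (lintegral_mono_set Ioc_subset_Icc_self).trans_eq ?_
    simp
  have hfin : ∫⁻ s in Ioc 0 T, g s < ∞ := by
    have hle : ∀ s, g s ≤
        2 * (∫⁻ ω, ‖X s.toNNReal ω‖ₑ ^ 2 ∂P + ∫⁻ ω, ‖X' s.toNNReal ω‖ₑ ^ 2 ∂P) := by
      intro s
      have hXs : Measurable fun ω => ‖X s.toNNReal ω‖ₑ ^ 2 :=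
        ((hm h.mem.measurable).comp measurable_prodMk_left).enorm.pow_const 2
      rw [← lintegral_add_left hXs, ← lintegral_const_mul' _ _ (by simp)]
      refine lintegral_mono fun ω => ?_
      have := hsqadd (X s.toNNReal ω) (-X' s.toNNReal ω)
      simpa [hD, sub_eq_add_neg] using this
    refine (lintegral_mono hle).trans_lt ?_
    have hXm : Measurable fun s : ℝ => ∫⁻ ω, ‖X s.toNNReal ω‖ₑ ^ 2 ∂P :=
      ((hm h.mem.measurable).enorm.pow_const 2).lintegral_prod_right'
    rw [lintegral_const_mul' _ _ (by simp), lintegral_add_left hXm]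
    exact ENNReal.mul_lt_top (by simp) (ENNReal.add_lt_top.2 ⟨hfin1 h.mem, hfin1 h'.mem⟩)
  have hgron : ∀ t, 0 ≤ t → t ≤ T →
      g t ≤ ENNReal.ofReal (2 * (C ^ 2 * T + 1)) * ∫⁻ s in Ioc 0 t, g s := by
    intro r hr0 hrT
    lift r to ℝ≥0 using hr0
    set I := fun ω => X r ω - X₀ ω - ∫ s in (0 : ℝ)..r, (a s * X s.toNNReal ω + y s.toNNReal ω)
    set I' := fun ω => X' r ω - X₀ ω - ∫ s in (0 : ℝ)..r, (a s * X' s.toNNReal ω + y s.toNNReal ω)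
    have hI := (h.integral_eq r hrT).eLpNorm_sub_le hW h.mem.measurable h'.mem.measurable
      (h'.integral_eq r hrT)
    have hII : ∫⁻ ω, ‖I ω - I' ω‖ₑ ^ 2 ∂P ≤ ∫⁻ s in Ioc 0 (r : ℝ), g s := by
      have := pow_le_pow_left₀ zero_le hI 2
      have e : ∫⁻ q : ℝ × Ω, ‖X q.1.toNNReal q.2 - X' q.1.toNNReal q.2‖ₑ ^ 2
          ∂((volume.restrict (Ioc (0 : ℝ) r)).prod P) = ∫⁻ s in Ioc 0 (r : ℝ), g s :=
        lintegral_prod _ (hDm.enorm.pow_const 2).aemeasurable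
      rw [eLpNorm_two_sq, eLpNorm_two_sq, e] at this
      exact this
    have hdecomp : ∀ᵐ ω ∂P, D r ω = (∫ s in Ioc 0 (r : ℝ), a s * D s ω) + (I ω - I' ω) := by
      filter_upwards [h.drift_integrable, h'.drift_integrable] with ω h1 h2
      have h1' := h1.mono_set (Ioc_subset_Ioc_right hrT)
      have h2' := h2.mono_set (Ioc_subset_Ioc_right hrT)
      simp only [I, I', hD, intervalIntegral.integral_of_le (NNReal.coe_nonneg r),
        Real.toNNReal_coe]
      have : ∫ s in Ioc 0 (r : ℝ), a s * (X s.toNNReal ω - X' s.toNNReal ω) =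
          (∫ s in Ioc 0 (r : ℝ), (a s * X s.toNNReal ω + y s.toNNReal ω)) -
          ∫ s in Ioc 0 (r : ℝ), (a s * X' s.toNNReal ω + y s.toNNReal ω) := by
        rw [← integral_sub h1' h2']
        congr 1; ext s; ring
      rw [this]; ring
    have hA : ∫⁻ ω, ‖∫ s in Ioc 0 (r : ℝ), a s * D s ω‖ₑ ^ 2 ∂P ≤
        ENNReal.ofReal (C ^ 2 * T) * ∫⁻ s in Ioc 0 (r : ℝ), g s := by
      have haDm : Measurable (Function.uncurry fun ω s => ‖a s * D s ω‖ₑ ^ 2) :=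
        (((ham.comp measurable_snd).mul (hDm.comp measurable_swap)).enorm.pow_const 2)
      calc ∫⁻ ω, ‖∫ s in Ioc 0 (r : ℝ), a s * D s ω‖ₑ ^ 2 ∂P
          ≤ ∫⁻ ω, ENNReal.ofReal T * (∫⁻ s in Ioc 0 (r : ℝ), ‖a s * D s ω‖ₑ ^ 2) ∂P := by
            refine lintegral_mono fun ω => ?_
            refine (pow_le_pow_left₀ zero_le (enorm_integral_le_lintegral_enorm _) 2).trans ?_
            have hmeas : Measurable fun s => ‖a s * D s ω‖ₑ :=
              (ham.mul (hDm.comp measurable_prodMk_right)).enorm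
            refine (lintegral_sq_le _ hmeas.aemeasurable).trans ?_
            gcongr
            simpa using ENNReal.ofReal_le_ofReal hrT
        _ = ENNReal.ofReal T * ∫⁻ s in Ioc 0 (r : ℝ), ∫⁻ ω, ‖a s * D s ω‖ₑ ^ 2 ∂P := by
            rw [lintegral_const_mul' _ _ (by simp), lintegral_lintegral_swap haDm.aemeasurable]
        _ ≤ ENNReal.ofReal T * ∫⁻ s in Ioc 0 (r : ℝ), ENNReal.ofReal (C ^ 2) * g s := by
            gcongr with s
            rw [hg, ← lintegral_const_mul' _ _ (by simp)]
            refine lintegral_mono fun ω => ?_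
            rw [enorm_mul, mul_pow, Real.enorm_eq_ofReal_abs (a s),
              ← ENNReal.ofReal_pow (abs_nonneg _)]
            gcongr
            exact haC s
        _ = _ := by
            rw [lintegral_const_mul' _ _ (by simp), ← mul_assoc,
              ← ENNReal.ofReal_mul hT.le, mul_comm T]
    calc g r = ∫⁻ ω, ‖(∫ s in Ioc 0 (r : ℝ), a s * D s ω) + (I ω - I' ω)‖ₑ ^ 2 ∂P :=
          lintegral_congr_ae (hdecomp.mono fun ω hω => by simp only [hω])
      _ ≤ ∫⁻ ω, 2 * (‖∫ s in Ioc 0 (r : ℝ), a s * D s ω‖ₑ ^ 2 + ‖I ω - I' ω‖ₑ ^ 2) ∂P :=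
          lintegral_mono fun ω => hsqadd _ _
      _ = 2 * (∫⁻ ω, ‖∫ s in Ioc 0 (r : ℝ), a s * D s ω‖ₑ ^ 2 ∂P
            + ∫⁻ ω, ‖I ω - I' ω‖ₑ ^ 2 ∂P) := by
          rw [lintegral_const_mul' _ _ (by simp), lintegral_add_left]
          have : StronglyMeasurable fun ω => ∫ s in Ioc 0 (r : ℝ), a s * D s ω :=
            (((ham.comp measurable_snd).mul
              (hDm.comp measurable_swap)).stronglyMeasurable).integral_prod_right'
              (f := fun q : Ω × ℝ => a q.2 * D q.2 q.1)
          exact this.measurable.enorm.pow_const 2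
      _ ≤ 2 * (ENNReal.ofReal (C ^ 2 * T) * (∫⁻ s in Ioc 0 (r : ℝ), g s)
            + ∫⁻ s in Ioc 0 (r : ℝ), g s) := mul_le_mul_right (add_le_add hA hII) 2
      _ = _ := by
          rw [ENNReal.ofReal_mul (p := 2) (by norm_num),
            ENNReal.ofReal_add (q := 1) (by positivity) (by norm_num)]
          simp only [ENNReal.ofReal_one, ENNReal.ofReal_ofNat]
          ring
  have hzero := eq_zero_of_le_mul_lintegral hT (by positivity) hfin hgron t t.2 ht
  have hDt : Measurable (D t) := hDm.comp measurable_prodMk_left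
  rw [hg, lintegral_eq_zero_iff (hDt.enorm.pow_const 2)] at hzero
  filter_upwards [hzero] with ω hω
  simp only [hD, Real.toNNReal_coe, Pi.zero_apply, ne_eq, OfNat.ofNat_ne_zero, not_false_eq_true,
    pow_eq_zero_iff, enorm_eq_zero] at hω
  linarith

end Uniqueness

/-! ### Adapted modifications -/

lemma measurable_limUnder_real {S : Type*} [MeasurableSpace S] {φ : ℕ → S → ℝ}
    (h : ∀ n, Measurable (φ n)) : Measurable fun x => limUnder atTop fun n => φ n x :=
  (StronglyMeasurable.limUnder fun n => (h n).stronglyMeasurable).measurable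

section Adapted

variable {Ω : Type*} {m mΩ : MeasurableSpace Ω} {P : Measure Ω} [IsProbabilityMeasure P]

/-- A time integral of `m`-measurable variables is almost surely equal to an `m`-measurable one,
although the integrand is only assumed to be jointly measurable for the full `σ`-algebra: by Fubini
and the self-adjointness of the conditional expectation the integral agrees with its
conditional expectation. -/
lemma exists_measurable_ae_eq_integral (hm : m ≤ mΩ)
    {S : Type*} [MeasurableSpace S] {μ : Measure S} [SFinite μ] {f : S → Ω → ℝ}
    (hf : Integrable (Function.uncurry f) (μ.prod P))
    (hfm : ∀ᵐ s ∂μ, Measurable[m] (f s)) :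
    ∃ g : Ω → ℝ, Measurable[m] g ∧ (fun ω => ∫ s, f s ω ∂μ) =ᵐ[P] g := by
  set F : Ω → ℝ := fun ω => ∫ s, f s ω ∂μ with hF
  have hFint : Integrable F P := hf.swap.integral_prod_left
  refine ⟨P[F|m], stronglyMeasurable_condExp.measurable, ?_⟩
  refine Integrable.ae_eq_of_forall_setIntegral_eq _ _ hFint integrable_condExp fun B hB _ => ?_
  set b : Ω → ℝ := B.indicator fun _ => 1 with hb
  have hbint : Integrable b P := (integrable_const 1).indicator hB
  set h : Ω → ℝ := P[b|m] with hh
  have hhb : ∀ᵐ ω ∂P, ‖h ω‖ ≤ 1 := by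
    have := ae_bdd_abs_condExp_of_ae_bdd_abs (m := m) (R := 1) (f := b) (μ := P)
      (Eventually.of_forall fun ω => by
        by_cases hω : ω ∈ B <;> simp [hb, hω])
    simpa using this
  have hbb : ∀ᵐ ω ∂P, ‖b ω‖ ≤ 1 := Eventually.of_forall fun ω => by
    by_cases hω : ω ∈ B <;> simp [hb, hω]
  have hhint : Integrable h P := integrable_condExp
  have hset : ∀ φ : Ω → ℝ, ∫ ω in B, φ ω ∂P = ∫ ω, b ω * φ ω ∂P := by
    intro φ
    rw [← integral_indicator hB]
    congr 1; ext ω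
    by_cases hω : ω ∈ B <;> simp [hb, hω]
  -- moving the conditional expectation to the other factor
  have hswap : ∀ φ : Ω → ℝ, Integrable φ P → StronglyMeasurable[m] φ →
      ∫ ω, b ω * φ ω ∂P = ∫ ω, h ω * φ ω ∂P := by
    intro φ hφ hφm
    have h1 : Integrable (b * φ) P := hφ.bdd_mul hbint.aestronglyMeasurable hbb
    have h2 := condExp_mul_of_stronglyMeasurable_right hφm h1 hbint
    rw [← integral_condExp hm (f := fun ω => b ω * φ ω)]
    exact integral_congr_ae h2
  have hfs : ∀ᵐ s ∂μ, Integrable (f s) P := hf.prod_right_ae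
  have hfub : ∀ c : Ω → ℝ, AEStronglyMeasurable c P → (∀ᵐ ω ∂P, ‖c ω‖ ≤ 1) →
      ∫ ω, c ω * F ω ∂P = ∫ s, ∫ ω, c ω * f s ω ∂P ∂μ := by
    intro c hc hc1
    have hcf : Integrable (Function.uncurry fun s ω => c ω * f s ω) (μ.prod P) :=
      hf.bdd_mul (c := 1) (hc.comp_quasiMeasurePreserving Measure.quasiMeasurePreserving_snd)
        (Measure.quasiMeasurePreserving_snd.ae hc1)
    rw [integral_integral_swap hcf]
    refine integral_congr_ae (Eventually.of_forall fun ω => ?_)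
    simp only [hF]
    rw [integral_const_mul]
  calc ∫ ω in B, F ω ∂P = ∫ s, ∫ ω, b ω * f s ω ∂P ∂μ := by
        rw [hset, hfub b hbint.aestronglyMeasurable hbb]
    _ = ∫ s, ∫ ω, h ω * f s ω ∂P ∂μ := by
        refine integral_congr_ae ?_
        filter_upwards [hfs, hfm] with s h1 h2
        exact hswap _ h1 h2.stronglyMeasurable
    _ = ∫ ω, h ω * F ω ∂P := (hfub h hhint.aestronglyMeasurable hhb).symm
    _ = ∫ ω, h ω * (P[F|m]) ω ∂P := by
        have h1 : Integrable (h * F) P := hFint.bdd_mul hhint.aestronglyMeasurable hhb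
        have h2 := condExp_mul_of_stronglyMeasurable_left (stronglyMeasurable_condExp (f := b)) h1
          hFint
        rw [← integral_condExp hm (f := fun ω => h ω * F ω)]
        exact integral_congr_ae h2
    _ = ∫ ω, b ω * (P[F|m]) ω ∂P :=
        (hswap _ integrable_condExp stronglyMeasurable_condExp).symm
    _ = ∫ ω in B, (P[F|m]) ω ∂P := (hset _).symm

/-- The largest multiple of `1 / (n + 1)` below `t`. -/
def gridFloor (n : ℕ) (t : ℝ≥0) : ℝ≥0 := (⌊t * (n + 1)⌋₊ : ℝ≥0) / (n + 1)

lemma gridFloor_le (n : ℕ) (t : ℝ≥0) : gridFloor n t ≤ t := by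
  unfold gridFloor
  rw [div_le_iff₀ (by positivity)]
  exact Nat.floor_le zero_le

lemma tendsto_gridFloor (t : ℝ≥0) : Tendsto (fun n => gridFloor n t) atTop (𝓝 t) := by
  have h1 : Tendsto (fun n : ℕ => t - 1 / ((n : ℝ≥0) + 1)) atTop (𝓝 (t - 0)) := by
    refine Tendsto.sub tendsto_const_nhds ?_
    exact tendsto_one_div_add_atTop_nhds_zero_nat
  rw [tsub_zero] at h1
  refine tendsto_of_tendsto_of_tendsto_of_le_of_le h1 tendsto_const_nhds (fun n => ?_)
    fun n => gridFloor_le n t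
  simp only
  rw [tsub_le_iff_right]
  unfold gridFloor
  rw [← add_div, le_div_iff₀ (by positivity)]
  exact (Nat.lt_floor_add_one _).le

/-- A process with almost surely continuous paths whose values are almost surely equal to
`ℱ t`-measurable variables is indistinguishable from an adapted, jointly measurable process. No
completeness of the filtration is needed. -/
lemma exists_adapted_measurable_modification {ℱ : Filtration ℝ≥0 mΩ} {Z : ℝ≥0 → Ω → ℝ}
    (hc : ∀ᵐ ω ∂P, Continuous fun t => Z t ω)
    (ha : ∀ t, ∃ g : Ω → ℝ, Measurable[ℱ t] g ∧ Z t =ᵐ[P] g) :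
    ∃ Z' : ℝ≥0 → Ω → ℝ, Adapted ℱ Z' ∧ Measurable (Function.uncurry Z') ∧
      ∀ᵐ ω ∂P, ∀ t, Z' t ω = Z t ω := by
  choose g hg hgZ using ha
  -- the grid points lie below `t`, which keeps the limit adapted, and there are only countably
  -- many of them, which makes it jointly measurable
  refine ⟨fun t ω => limUnder atTop fun n => g (gridFloor n t) ω, fun t => ?_, ?_, ?_⟩
  · exact @measurable_limUnder_real Ω (ℱ t) (fun n ω => g (gridFloor n t) ω) fun n =>
      (hg _).mono (ℱ.mono (gridFloor_le n t)) le_rfl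
  · refine measurable_limUnder_real (φ := fun n (q : ℝ≥0 × Ω) => g (gridFloor n q.1) q.2)
      fun n => ?_
    have h1 : Measurable fun q : ℕ × Ω => g ((q.1 : ℝ≥0) / (n + 1)) q.2 :=
      measurable_from_prod_countable_right fun k =>
        (hg ((k : ℝ≥0) / (n + 1))).mono (ℱ.le _) le_rfl
    have h2 : Measurable fun q : ℝ≥0 × Ω => (⌊q.1 * (n + 1)⌋₊, q.2) :=
      (Nat.measurable_floor.comp (measurable_fst.mul_const _)).prodMk measurable_snd
    exact h1.comp h2
  · have hae : ∀ᵐ ω ∂P, ∀ n k : ℕ, Z ((k : ℝ≥0) / (n + 1)) ω = g ((k : ℝ≥0) / (n + 1)) ω :=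
      ae_all_iff.2 fun n => ae_all_iff.2 fun k => hgZ _
    filter_upwards [hc, hae] with ω h1 h2 t
    refine Tendsto.limUnder_eq ?_
    refine ((h1.tendsto t).comp (tendsto_gridFloor t)).congr fun n => ?_
    exact h2 n _

end Adapted

/-! ### Change of the data by null sets -/

section Congr

variable {Ω : Type*} {mΩ : MeasurableSpace Ω} {P : Measure Ω} [IsProbabilityMeasure P]
  {ℱ : Filtration ℝ≥0 mΩ} {W W' : ℝ≥0 → Ω → ℝ}

lemma IsFiltrationBrownian.congr (hW : IsFiltrationBrownian P ℱ W) (ha : Adapted ℱ W')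
    (h : ∀ᵐ ω ∂P, ∀ t, W' t ω = W t ω) : IsFiltrationBrownian P ℱ W' := by
  have ht : ∀ t, W t =ᵐ[P] W' t := fun t => h.mono fun ω hω => (hω t).symm
  refine ⟨⟨hW.isBrownian.toIsPreBrownianReal.congr ht, ?_⟩, ha, fun s t hst => ?_⟩
  · filter_upwards [hW.isBrownian.cont, h] with ω h1 h2
    simpa only [h2] using h1
  · have hi := hW.indep_increment s t hst
    rw [Indep_iff] at hi ⊢
    rintro _ B ⟨A, hA, rfl⟩ hB
    have e : ((fun ω => W' t ω - W' s ω) ⁻¹' A : Set Ω) =ᵐ[P] (fun ω => W t ω - W s ω) ⁻¹' A := by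
      filter_upwards [ht t, ht s] with ω h1 h2
      apply propext
      change W' t ω - W' s ω ∈ A ↔ W t ω - W s ω ∈ A
      rw [h1, h2]
    rw [measure_congr e, measure_congr (e.inter (ae_eq_refl B))]
    exact hi _ B ⟨A, hA, rfl⟩ hB

/-- A Brownian motion has an indistinguishable version that is jointly measurable. -/
lemma IsFiltrationBrownian.exists_measurable (hW : IsFiltrationBrownian P ℱ W) :
    ∃ W' : ℝ≥0 → Ω → ℝ, IsFiltrationBrownian P ℱ W' ∧ Measurable (Function.uncurry W') ∧
      ∀ᵐ ω ∂P, ∀ t, W' t ω = W t ω := by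
  obtain ⟨W', h1, h2, h3⟩ := exists_adapted_measurable_modification hW.isBrownian.cont
    fun t => ⟨W t, hW.adapted t, ae_eq_refl _⟩
  exact ⟨W', hW.congr h1 h3, h2, h3⟩

lemma IsItoIntegral.congr (h : ∀ᵐ ω ∂P, ∀ t, W' t ω = W t ω) {X : ℝ≥0 → Ω → ℝ} {t : ℝ≥0}
    {I I' : Ω → ℝ} (hI : I =ᵐ[P] I') (hX : IsItoIntegral P ℱ W X t I) :
    IsItoIntegral P ℱ W' X t I' := by
  obtain ⟨h1, H, h2, h3⟩ := hX
  refine ⟨h1.congr hI, H, h2, h3.congr fun n => eLpNorm_congr_ae ?_⟩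
  filter_upwards [h, hI] with ω hω hω'
  simp only [SimpleProcess.integral, hω, hω']

lemma IsSolution.congr (h : ∀ᵐ ω ∂P, ∀ t, W' t ω = W t ω) {T : ℝ} {a a' : ℝ → ℝ}
    (ha : a =ᵐ[volume.restrict (Ioo 0 T)] a') {X₀ : Ω → ℝ} {y X : ℝ≥0 → Ω → ℝ}
    (hX : IsSolution P ℱ W T a X₀ y X) : IsSolution P ℱ W' T a' X₀ y X := by
  have ha' : a =ᵐ[volume.restrict (Ioc 0 T)] a' := by
    rwa [← Measure.restrict_congr_set Ioo_ae_eq_Ioc]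
  refine ⟨hX.mem, hX.continuousOn, hX.initial, ?_, fun t ht => ?_⟩
  · filter_upwards [hX.drift_integrable] with ω hω
    refine hω.congr ?_
    filter_upwards [ha'] with s hs
    rw [hs]
  · refine (hX.integral_eq t ht).congr h (Eventually.of_forall fun ω => ?_)
    simp only
    congr 1
    rw [intervalIntegral.integral_of_le (NNReal.coe_nonneg t),
      intervalIntegral.integral_of_le (NNReal.coe_nonneg t)]
    refine integral_congr_ae ?_
    filter_upwards [ae_restrict_of_ae_restrict_of_subset (Ioc_subset_Ioc_right ht) ha'] with s hs
    rw [hs]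

/-- An essentially bounded coefficient may be replaced by a bounded measurable one. -/
lemma exists_bounded_measurable_ae_eq {T : ℝ} {a : ℝ → ℝ}
    (ha : MemLp a ⊤ (volume.restrict (Ioo 0 T))) :
    ∃ a' : ℝ → ℝ, Measurable a' ∧ (∃ C : ℝ, ∀ s, |a' s| ≤ C) ∧
      a =ᵐ[volume.restrict (Ioo 0 T)] a' := by
  set C : ℝ := (eLpNormEssSup a (volume.restrict (Ioo 0 T))).toReal
  have hC : ∀ᵐ s ∂(volume.restrict (Ioo 0 T)), |a s| ≤ C := by
    have hfin : eLpNormEssSup a (volume.restrict (Ioo 0 T)) ≠ ∞ := by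
      simpa using ha.2.ne
    filter_upwards [enorm_ae_le_eLpNormEssSup a (volume.restrict (Ioo 0 T))] with s hs
    have := (ENNReal.toReal_le_toReal (by simp) hfin).2 hs
    simpa using this
  have hmk := ha.1.aemeasurable
  refine ⟨fun s => max (-C) (min (hmk.mk a s) C), ?_, ⟨C, fun s => ?_⟩, ?_⟩
  · exact measurable_const.max (hmk.measurable_mk.min measurable_const)
  · have hC0 : 0 ≤ C := ENNReal.toReal_nonneg
    exact abs_le.2 ⟨le_max_left _ _, max_le (by linarith) (min_le_right _ _)⟩
  · filter_upwards [hC, hmk.ae_eq_mk] with s h1 h2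
    rw [← h2, min_eq_left (abs_le.1 h1).2, max_eq_right (abs_le.1 h1).1]

end Congr

/-! ### Sources and exponential increments -/

section Source

variable {Ω : Type*} {mΩ : MeasurableSpace Ω}

/-- Adapted, jointly measurable processes `y` with `∫₀ᵀ ‖y(t)‖_{L^p(Ω)} dt < ∞`. -/
structure MemSource (P : Measure Ω) (ℱ : Filtration ℝ≥0 mΩ) (T p : ℝ) (y : ℝ≥0 → Ω → ℝ) :
    Prop where
  adapted : Adapted ℱ y
  measurable : Measurable (Function.uncurry y)
  eLpNorm_lt_top : ∀ t : ℝ≥0, (t : ℝ) ≤ T → eLpNorm (y t) (ENNReal.ofReal p) P < ∞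
  lintegral_lt_top : ∫⁻ s in Ioc (0 : ℝ) T, eLpNorm (y s.toNNReal) (ENNReal.ofReal p) P < ∞

/-- The `L^p` norm of a process at a real time, increased by one to stay away from zero, so that it
can serve as a majorant in `eLpNorm_integral_le`. -/
def normWeight (P : Measure Ω) (p : ℝ) (y : ℝ≥0 → Ω → ℝ) (s : ℝ) : ℝ≥0∞ :=
  eLpNorm (y s.toNNReal) (ENNReal.ofReal p) P + 1

/-- The stochastic exponential `exp (W_t - W_s - (t - s) / 2)`. -/
def expIncr (W : ℝ≥0 → Ω → ℝ) (t s : ℝ) (ω : Ω) : ℝ :=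
  Real.exp (W t.toNNReal ω - W s.toNNReal ω - (t - s) / 2)

lemma measurable_toNNReal_uncurry {Z : ℝ≥0 → Ω → ℝ} (hZ : Measurable (Function.uncurry Z)) :
    Measurable (Function.uncurry fun (s : ℝ) ω => Z s.toNNReal ω) :=
  hZ.comp (measurable_fst.real_toNNReal.prodMk measurable_snd)

variable {P : Measure Ω} [IsProbabilityMeasure P] {ℱ : Filtration ℝ≥0 mΩ} {T p : ℝ}
  {y : ℝ≥0 → Ω → ℝ}

lemma measurable_eLpNorm_section (hp : 0 < p) (hy : Measurable (Function.uncurry y)) :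
    Measurable fun s : ℝ => eLpNorm (y s.toNNReal) (ENNReal.ofReal p) P := by
  simp only [eLpNorm_ofReal_eq hp]
  exact ((measurable_toNNReal_uncurry hy).enorm.pow_const p).lintegral_prod_right'.pow_const _

lemma MemSource.measurable_normWeight (hp : 0 < p) (hy : MemSource P ℱ T p y) :
    Measurable (normWeight P p y) :=
  (measurable_eLpNorm_section hp hy.measurable).add_const 1

lemma MemSource.normWeight_ne_top (hy : MemSource P ℱ T p y) {s : ℝ} (hs : s ∈ Ioc 0 T) :
    normWeight P p y s ≠ ∞ := by
  refine ENNReal.add_ne_top.2 ⟨(hy.eLpNorm_lt_top _ ?_).ne, ENNReal.one_ne_top⟩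
  rw [Real.coe_toNNReal s hs.1.le]
  exact hs.2

lemma normWeight_ne_zero (s : ℝ) : normWeight P p y s ≠ 0 := by simp [normWeight]

lemma MemSource.lintegral_normWeight_lt_top (hy : MemSource P ℱ T p y) :
    ∫⁻ s in Ioc 0 T, normWeight P p y s < ∞ := by
  unfold normWeight
  rw [lintegral_add_right _ measurable_const]
  refine ENNReal.add_lt_top.2 ⟨hy.lintegral_lt_top, ?_⟩
  simp

lemma MemSource.integrable_uncurry (hp : 1 ≤ p) (hy : MemSource P ℱ T p y) :
    Integrable (Function.uncurry fun (s : ℝ) ω => y s.toNNReal ω)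
      ((volume.restrict (Ioc 0 T)).prod P) := by
  have hm := measurable_toNNReal_uncurry hy.measurable
  refine ⟨hm.aestronglyMeasurable, ?_⟩
  rw [hasFiniteIntegral_iff_enorm, lintegral_prod _ hm.enorm.aemeasurable]
  refine lt_of_le_of_lt (lintegral_mono fun s => ?_) hy.lintegral_lt_top
  have hs : Measurable fun ω => y s.toNNReal ω := hm.comp measurable_prodMk_left
  have := eLpNorm_le_eLpNorm_of_exponent_le (μ := P) (p := 1) (q := ENNReal.ofReal p)
    (by rwa [ENNReal.one_le_ofReal]) hs.aestronglyMeasurable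
  rwa [eLpNorm_one_eq_lintegral_enorm] at this

lemma MemSource.ae_intervalIntegrable (hp : 1 ≤ p) (hT : 0 ≤ T) (hy : MemSource P ℱ T p y) :
    ∀ᵐ ω ∂P, IntervalIntegrable (fun s : ℝ => y s.toNNReal ω) volume 0 T := by
  filter_upwards [(hy.integrable_uncurry hp).prod_left_ae] with ω hω
  rw [intervalIntegrable_iff_integrableOn_Ioc_of_le hT]
  exact hω

variable {W : ℝ≥0 → Ω → ℝ}

/-- Pathwise, the stochastic exponential is multiplicative. -/
lemma expIncr_mul (r s t : ℝ) (ω : Ω) : expIncr W t s ω * expIncr W s r ω = expIncr W t r ω := by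
  unfold expIncr
  rw [← Real.exp_add]
  congr 1; ring

lemma continuous_expIncr {ω : Ω} (hω : Continuous fun t => W t ω) (t : ℝ) :
    Continuous fun s => expIncr W t s ω := by
  unfold expIncr
  have : Continuous fun s : ℝ => W s.toNNReal ω := hω.comp continuous_real_toNNReal
  fun_prop

lemma measurable_expIncr (hWm : Measurable (Function.uncurry W)) (t : ℝ) :
    Measurable (Function.uncurry fun s ω => expIncr W t s ω) := by
  have h1 : Measurable fun q : ℝ × Ω => W q.1.toNNReal q.2 := measurable_toNNReal_uncurry hWm
  have h2 : Measurable fun q : ℝ × Ω => W t.toNNReal q.2 :=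
    (hWm.comp measurable_prodMk_left).comp measurable_snd
  exact Real.measurable_exp.comp
    ((h2.sub h1).sub ((measurable_const.sub measurable_fst).div_const 2))

/-- Minkowski's inequality and the independence of increments: the `L^p` norm of
`∫ y_s g_s(W_t - W_s) ds`. -/
lemma eLpNorm_integral_mul_increment_le (hW : IsFiltrationBrownian P ℱ W)
    (hWm : Measurable (Function.uncurry W)) (hp : 1 ≤ p) (hy : MemSource P ℱ T p y)
    {r t : ℝ} (hr : 0 ≤ r) (ht : t ≤ T) {g : ℝ → ℝ → ℝ} (hg : Measurable (Function.uncurry g))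
    {c : ℝ≥0∞} (hc : c ≠ ∞) (hc0 : r < t → c ≠ 0)
    (hgc : ∀ s ∈ Ioc r t,
      eLpNorm (g s) (ENNReal.ofReal p) (gaussianReal 0 (t.toNNReal - s.toNNReal)) ≤ c) :
    eLpNorm (fun ω => ∫ s in Ioc r t,
        y s.toNNReal ω * g s (W t.toNNReal ω - W s.toNNReal ω)) (ENNReal.ofReal p) P ≤
      c * ∫⁻ s in Ioc r t, normWeight P p y s := by
  have hp0 : 0 < p := by linarith
  rw [← lintegral_const_mul' _ _ hc]
  have h1 : Measurable fun q : ℝ × Ω => W q.1.toNNReal q.2 := measurable_toNNReal_uncurry hWm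
  have h2 : Measurable fun q : ℝ × Ω => W t.toNNReal q.2 :=
    (hWm.comp measurable_prodMk_left).comp measurable_snd
  refine eLpNorm_integral_le hp
    (f := fun s ω => y s.toNNReal ω * g s (W t.toNNReal ω - W s.toNNReal ω)) ?_
    ((hy.measurable_normWeight hp0).const_mul c) ?_
  · exact (measurable_toNNReal_uncurry hy.measurable).mul
      (hg.comp (measurable_fst.prodMk (h2.sub h1)))
  · filter_upwards [ae_restrict_mem measurableSet_Ioc] with s hs
    have hs' : s ∈ Ioc 0 T := ⟨hr.trans_lt hs.1, hs.2.trans ht⟩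
    refine ⟨mul_ne_zero (hc0 (hs.1.trans_le hs.2)) (normWeight_ne_zero s),
      ENNReal.mul_ne_top hc (hy.normWeight_ne_top hs'), ?_⟩
    have hgs : Measurable (g s) := hg.comp measurable_prodMk_left
    rw [hW.eLpNorm_mul_comp_sub (Real.toNNReal_le_toNNReal hs.2) (hy.adapted _) hgs hp0, mul_comm]
    exact mul_le_mul' (hgc s hs) le_self_add

end Source

/-! ### The discretised stochastic exponential -/

/-- The `L²` norm of `exp (G - h / 2) - 1` for a centred Gaussian `G` of variance `h`. -/
def expModulus (h : ℝ) : ℝ≥0∞ := ENNReal.ofReal √(Real.exp h - 1)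

lemma expModulus_mono {h k : ℝ} (hk : h ≤ k) : expModulus h ≤ expModulus k := by
  unfold expModulus; gcongr

lemma expModulus_ne_zero {h : ℝ} (hh : 0 < h) : expModulus h ≠ 0 := by
  unfold expModulus
  simpa using Real.one_lt_exp_iff.2 hh

lemma eLpNorm_exp_sub_one_gaussian (v : ℝ≥0) :
    eLpNorm (fun x => Real.exp (x - v / 2) - 1) 2 (gaussianReal 0 v) = expModulus v := by
  refine (ENNReal.pow_right_strictMono two_ne_zero).injective ?_
  have h1 : MemLp (fun x => Real.exp (x - v / 2) - 1) 2 (gaussianReal 0 v) :=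
    (memLp_exp_gaussian v).sub (memLp_const 1)
  rw [eLpNorm_two_sq_eq_ofReal h1, integral_exp_sub_one_sq_gaussian, expModulus,
    ← ENNReal.ofReal_pow (Real.sqrt_nonneg _), Real.sq_sqrt]
  simp

lemma memLp_exp_sub_one_sub_gaussian (v : ℝ≥0) :
    MemLp (fun x => Real.exp (x - v / 2) - 1 - x) 2 (gaussianReal 0 v) :=
  ((memLp_exp_gaussian v).sub (memLp_const 1)).sub (memLp_id_gaussian_two v)

lemma eLpNorm_exp_sub_one_sub_sq_gaussian (v : ℝ≥0) :
    eLpNorm (fun x => Real.exp (x - v / 2) - 1 - x) 2 (gaussianReal 0 v) ^ 2 =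
      ENNReal.ofReal (Real.exp v - 1 - v) := by
  rw [eLpNorm_two_sq_eq_ofReal (memLp_exp_sub_one_sub_gaussian v),
    integral_exp_sub_one_sub_sq_gaussian]

lemma integral_exp_sub_one_sub_gaussian (v : ℝ≥0) :
    ∫ x, (Real.exp (x - v / 2) - 1 - x) ∂(gaussianReal 0 v) = 0 := by
  have h1 : Integrable (fun x => Real.exp (x - v / 2)) (gaussianReal 0 v) :=
    (memLp_exp_gaussian v).integrable (by norm_num)
  have h2 : Integrable (fun x : ℝ => x) (gaussianReal 0 v) :=
    (memLp_id_gaussian_two v).integrable (by norm_num)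
  have h3 : Integrable (fun x => Real.exp (x - v / 2) - 1) (gaussianReal 0 v) :=
    h1.sub (integrable_const 1)
  rw [integral_sub h3 h2, integral_sub h1 (integrable_const 1), integral_exp_gaussian]
  simp

section Core

variable {Ω : Type*} {mΩ : MeasurableSpace Ω} {P : Measure Ω} [IsProbabilityMeasure P]
  {ℱ : Filtration ℝ≥0 mΩ} {W : ℝ≥0 → Ω → ℝ} {T : ℝ} {y X : ℝ≥0 → Ω → ℝ}

/-- `X` is given by the variation of constants formula
`X_t = ∫₀ᵗ exp (W_t - W_s - (t - s) / 2) y_s ds`. -/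
structure IsExplicit (P : Measure Ω) (ℱ : Filtration ℝ≥0 mΩ) (W : ℝ≥0 → Ω → ℝ) (T : ℝ)
    (y X : ℝ≥0 → Ω → ℝ) : Prop where
  adapted : Adapted ℱ X
  measurable : Measurable (Function.uncurry X)
  eq : ∀ t : ℝ≥0, (t : ℝ) ≤ T →
    X t =ᵐ[P] fun ω => ∫ s in (0 : ℝ)..t, expIncr W t s ω * y s.toNNReal ω

variable (hW : IsFiltrationBrownian P ℱ W) (hWm : Measurable (Function.uncurry W))
  (hT : 0 < T) (hy : MemSource P ℱ T 2 y) (hX : IsExplicit P ℱ W T y X)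
include hW hWm hy

/-- The bound for the `L²` norm of the explicit solution. -/
def stateBound (P : Measure Ω) (T : ℝ) (y : ℝ≥0 → Ω → ℝ) : ℝ≥0∞ :=
  ENNReal.ofReal (Real.exp (T / 2)) * ∫⁻ s in Ioc 0 T, normWeight P 2 y s

omit hW hWm in
lemma stateBound_ne_top : stateBound P T y ≠ ∞ :=
  ENNReal.mul_ne_top ENNReal.ofReal_ne_top hy.lintegral_normWeight_lt_top.ne

omit hW hWm hy in
lemma coe_toNNReal_sub {s t : ℝ} (hs : 0 ≤ s) (hst : s ≤ t) :
    ((t.toNNReal - s.toNNReal : ℝ≥0) : ℝ) = t - s := by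
  rw [NNReal.coe_sub (Real.toNNReal_le_toNNReal hst), Real.coe_toNNReal _ hs,
    Real.coe_toNNReal _ (hs.trans hst)]

lemma eLpNorm_integral_expIncr_le {r t : ℝ} (hr : 0 ≤ r) (ht : t ≤ T) :
    eLpNorm (fun ω => ∫ s in Ioc r t, expIncr W t s ω * y s.toNNReal ω) 2 P ≤
      ENNReal.ofReal (Real.exp (T / 2)) * ∫⁻ s in Ioc r t, normWeight P 2 y s := by
  have h := eLpNorm_integral_mul_increment_le hW hWm one_le_two hy hr ht
    (g := fun s x => Real.exp (x - (t - s) / 2)) (c := ENNReal.ofReal (Real.exp (T / 2)))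
    (by unfold Function.uncurry; fun_prop) ENNReal.ofReal_ne_top
    (fun _ => by simpa using Real.exp_pos _) ?_
  · simpa only [ENNReal.ofReal_ofNat, mul_comm (y _ _), expIncr] using h
  · intro s hs
    have hv := coe_toNNReal_sub (hr.trans hs.1.le) hs.2
    rw [← hv, eLpNorm_exp_gaussian _ two_pos, hv]
    refine ENNReal.ofReal_le_ofReal (Real.exp_le_exp.2 ?_)
    have := hr.trans hs.1.le
    linarith

lemma eLpNorm_integral_expIncr_sub_one_le {r t : ℝ} (hr : 0 ≤ r) (ht : t ≤ T) :
    eLpNorm (fun ω => ∫ s in Ioc r t, (expIncr W t s ω - 1) * y s.toNNReal ω) 2 P ≤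
      expModulus (t - r) * ∫⁻ s in Ioc r t, normWeight P 2 y s := by
  have h := eLpNorm_integral_mul_increment_le hW hWm one_le_two hy hr ht
    (g := fun s x => Real.exp (x - (t - s) / 2) - 1) (c := expModulus (t - r))
    (by unfold Function.uncurry; fun_prop) ENNReal.ofReal_ne_top
    (fun h => expModulus_ne_zero (by linarith)) ?_
  · simpa only [ENNReal.ofReal_ofNat, mul_comm (y _ _), expIncr] using h
  · intro s hs
    have hv := coe_toNNReal_sub (hr.trans hs.1.le) hs.2
    rw [← hv, ENNReal.ofReal_ofNat, eLpNorm_exp_sub_one_gaussian, hv]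
    exact expModulus_mono (by linarith [hs.1])

include hX

lemma IsExplicit.eLpNorm_le {t : ℝ≥0} (ht : (t : ℝ) ≤ T) :
    eLpNorm (X t) 2 P ≤ stateBound P T y := by
  rw [eLpNorm_congr_ae (hX.eq t ht)]
  simp only [intervalIntegral.integral_of_le (NNReal.coe_nonneg t)]
  refine (eLpNorm_integral_expIncr_le hW hWm hy le_rfl ht).trans ?_
  unfold stateBound
  gcongr

omit hy in
lemma IsExplicit.measurable_apply (t : ℝ≥0) : Measurable (X t) :=
  hX.measurable.comp measurable_prodMk_left

lemma IsExplicit.memLp {t : ℝ≥0} (ht : (t : ℝ) ≤ T) : MemLp (X t) 2 P :=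
  ⟨(hX.measurable_apply hW hWm t).aestronglyMeasurable,
    (hX.eLpNorm_le hW hWm hy ht).trans_lt (stateBound_ne_top hy).lt_top⟩

/-- The flow property: the state at time `t` in terms of the state at an earlier time `r`. -/
lemma IsExplicit.ae_eq_flow {r t : ℝ≥0} (hrt : r ≤ t) (ht : (t : ℝ) ≤ T) :
    ∀ᵐ ω ∂P, X t ω = X r ω * expIncr W t r ω +
      ∫ s in (r : ℝ)..t, expIncr W t s ω * y s.toNNReal ω := by
  have hrt' : (r : ℝ) ≤ t := hrt
  have hT : 0 ≤ T := t.2.trans ht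
  filter_upwards [hX.eq t ht, hX.eq r (hrt'.trans ht), hW.isBrownian.cont,
    hy.ae_intervalIntegrable one_le_two hT] with ω h1 h2 h3 h4
  have hint : ∀ a b : ℝ, a ∈ Icc 0 T → b ∈ Icc 0 T →
      IntervalIntegrable (fun s => expIncr W t s ω * y s.toNNReal ω) volume a b := by
    intro a b ha hb
    refine IntervalIntegrable.continuousOn_mul (h4.mono_set ?_)
      (continuous_expIncr h3 t).continuousOn
    rw [uIcc_of_le hT]
    exact uIcc_subset_Icc ha hb
  rw [h1, h2, ← intervalIntegral.integral_add_adjacent_intervals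
    (hint 0 r ⟨le_rfl, hT⟩ ⟨r.2, hrt'.trans ht⟩) (hint r t ⟨r.2, hrt'.trans ht⟩ ⟨t.2, ht⟩),
    mul_comm, ← intervalIntegral.integral_const_mul]
  congr 2
  funext s
  rw [← expIncr_mul s r t, mul_assoc]

lemma IsExplicit.ae_intervalIntegrable_mul {r t : ℝ≥0} (hrt : r ≤ t) (ht : (t : ℝ) ≤ T) :
    ∀ᵐ ω ∂P, IntervalIntegrable (fun s : ℝ => y s.toNNReal ω) volume r t ∧
      IntervalIntegrable (fun s => expIncr W t s ω * y s.toNNReal ω) volume r t := by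
  have hrt' : (r : ℝ) ≤ t := hrt
  have hT : 0 ≤ T := t.2.trans ht
  filter_upwards [hW.isBrownian.cont, hy.ae_intervalIntegrable one_le_two hT] with ω h3 h4
  have h5 : IntervalIntegrable (fun s : ℝ => y s.toNNReal ω) volume r t := by
    refine h4.mono_set ?_
    rw [uIcc_of_le hT]
    exact uIcc_subset_Icc ⟨r.2, hrt'.trans ht⟩ ⟨t.2, ht⟩
  exact ⟨h5, h5.continuousOn_mul (continuous_expIncr h3 t).continuousOn⟩

/-- One step of the Euler scheme: the remainder consists of a martingale difference of second order
and a small drift term. -/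
lemma IsExplicit.ae_eq_step {r t : ℝ≥0} (hrt : r ≤ t) (ht : (t : ℝ) ≤ T) :
    ∀ᵐ ω ∂P, X t ω - X r ω - X r ω * (W t ω - W r ω) - ∫ s in (r : ℝ)..t, y s.toNNReal ω =
      X r ω * (Real.exp (W t ω - W r ω - ((t - r : ℝ≥0) : ℝ) / 2) - 1 - (W t ω - W r ω)) +
      ∫ s in Ioc (r : ℝ) t, (expIncr W t s ω - 1) * y s.toNNReal ω := by
  have hrt' : (r : ℝ) ≤ t := hrt
  filter_upwards [hX.ae_eq_flow hW hWm hy hrt ht,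
    hX.ae_intervalIntegrable_mul hW hWm hy hrt ht] with ω h1 h2
  rw [← intervalIntegral.integral_of_le hrt']
  simp only [sub_mul, one_mul]
  rw [intervalIntegral.integral_sub h2.2 h2.1, h1, expIncr, Real.toNNReal_coe, Real.toNNReal_coe,
    NNReal.coe_sub hrt]
  ring

lemma IsExplicit.eLpNorm_sub_le {r t : ℝ≥0} (hrt : r ≤ t) (ht : (t : ℝ) ≤ T) :
    eLpNorm (fun ω => X t ω - X r ω) 2 P ≤ stateBound P T y * expModulus (t - r) +
      ENNReal.ofReal (Real.exp (T / 2)) * ∫⁻ s in Ioc (r : ℝ) t, normWeight P 2 y s := by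
  have hrt' : (r : ℝ) ≤ t := hrt
  have e : (fun ω => X t ω - X r ω) =ᵐ[P] (fun ω => X r ω *
      (fun x => Real.exp (x - ((t - r : ℝ≥0) : ℝ) / 2) - 1) (W t ω - W r ω)) +
      fun ω => ∫ s in Ioc (r : ℝ) t, expIncr W t s ω * y s.toNNReal ω := by
    filter_upwards [hX.ae_eq_flow hW hWm hy hrt ht] with ω h1
    simp only [Pi.add_apply]
    rw [h1, expIncr, Real.toNNReal_coe, Real.toNNReal_coe, NNReal.coe_sub hrt,
      intervalIntegral.integral_of_le hrt']
    ring
  rw [eLpNorm_congr_ae e]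
  have hWt : Measurable fun ω => W t ω - W r ω :=
    (hW.measurable_apply t).sub (hW.measurable_apply r)
  refine (eLpNorm_add_le ?_ ?_ one_le_two).trans (add_le_add ?_ ?_)
  · refine ((hX.measurable_apply hW hWm r).mul ?_).aestronglyMeasurable
    exact ((Real.measurable_exp.comp (hWt.sub_const _)).sub_const 1)
  · have hm := ((measurable_expIncr hWm t).mul
      (measurable_toNNReal_uncurry hy.measurable)).stronglyMeasurable
    exact (StronglyMeasurable.integral_prod_left' (μ := volume.restrict (Ioc (r : ℝ) t))
      hm).aestronglyMeasurable
  · rw [hW.eLpNorm_two_mul_comp_sub hrt (hX.adapted r)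
      (g := fun x => Real.exp (x - ((t - r : ℝ≥0) : ℝ) / 2) - 1) (by fun_prop),
      eLpNorm_exp_sub_one_gaussian, NNReal.coe_sub hrt]
    gcongr
    exact hX.eLpNorm_le hW hWm hy (hrt'.trans ht)
  · exact eLpNorm_integral_expIncr_le hW hWm hy r.2 ht

end Core

/-! ### The explicit process solves the Itô equation -/

/-- Truncation: square integrable variables are approximated by bounded ones that are measurable for
the same `σ`-algebra. -/
lemma exists_bounded_approx {Ω : Type*} {m mΩ : MeasurableSpace Ω} {P : Measure Ω} (hm : m ≤ mΩ)
    {f : Ω → ℝ} (hf : Measurable[m] f) (hf2 : MemLp f 2 P) {ε : ℝ} (hε : 0 < ε) :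
    ∃ g : Ω → ℝ, Measurable[m] g ∧ (∃ C : ℝ, 0 ≤ C ∧ ∀ ω, |g ω| ≤ C) ∧
      eLpNorm (fun ω => g ω - f ω) 2 P ≤ ENNReal.ofReal ε := by
  obtain ⟨M, hM, h⟩ := hf2.eLpNorm_indicator_norm_ge_pos_le
    (hf.mono hm le_rfl).stronglyMeasurable hε
  refine ⟨{ω | |f ω| < M}.indicator f, ?_, ⟨M, hM.le, fun ω => ?_⟩, ?_⟩
  · refine Measurable.indicator hf ?_
    exact measurableSet_lt (@Measurable.comp _ _ _ m _ _ _ _ measurable_abs hf) measurable_const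
  · by_cases hω : |f ω| < M
    · rw [indicator_of_mem (mem_ofPred_eq ▸ hω)]; exact hω.le
    · rw [indicator_of_notMem (by simpa using hω)]; simpa using hM.le
  · refine le_trans (le_of_eq ?_) h
    rw [← eLpNorm_neg]
    congr 1
    funext ω
    by_cases hω : |f ω| < M
    · have : ω ∉ {x | M ≤ (‖f x‖₊ : ℝ)} := by simpa using hω
      rw [indicator_of_notMem this]
      simp [indicator, hω]
    · have : ω ∈ {x | M ≤ (‖f x‖₊ : ℝ)} := by simpa using hω
      rw [indicator_of_mem this]
      simp [indicator, hω]

lemma exp_sub_one_sub_le {x : ℝ} (hx : 0 ≤ x) : Real.exp x - 1 - x ≤ x ^ 2 * Real.exp x := by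
  have h1 : Real.exp x - 1 ≤ x * Real.exp x := by
    have h := Real.add_one_le_exp (-x)
    rw [Real.exp_neg] at h
    have h3 := mul_le_mul_of_nonneg_right h (Real.exp_pos x).le
    rw [inv_mul_cancel₀ (Real.exp_pos x).ne'] at h3
    linarith
  nlinarith

section Core

variable {Ω : Type*} {mΩ : MeasurableSpace Ω} {P : Measure Ω} [IsProbabilityMeasure P]
  {ℱ : Filtration ℝ≥0 mΩ} {W : ℝ≥0 → Ω → ℝ} {T : ℝ} {y X : ℝ≥0 → Ω → ℝ}

/-- Orthogonal martingale differences over a uniform grid: `N` terms of norm at most `b √v` have a sum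
of norm at most `b √(N v)`. -/
lemma IsFiltrationBrownian.eLpNorm_sum_uniform_le (hW : IsFiltrationBrownian P ℱ W) {N : ℕ}
    {Δ : ℝ≥0} {η : ℕ → Ω → ℝ} (hη : ∀ i < N, Measurable[ℱ (i * Δ)] (η i))
    {b : ℝ≥0∞} (hb : b ≠ ∞) (hηb : ∀ i < N, eLpNorm (η i) 2 P ≤ b)
    {g : ℝ → ℝ} (hg : Measurable g) (hg2 : MemLp g 2 (gaussianReal 0 Δ))
    (hg0 : ∫ x, g x ∂(gaussianReal 0 Δ) = 0) {v : ℝ} (hv : 0 ≤ v)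
    (hgv : eLpNorm g 2 (gaussianReal 0 Δ) ^ 2 ≤ ENNReal.ofReal v) :
    eLpNorm (fun ω => ∑ i ∈ Finset.range N,
      η i ω * g (W ((i + 1 : ℕ) * Δ) ω - W (i * Δ) ω)) 2 P ≤ b * ENNReal.ofReal √(N * v) := by
  have hd : ∀ i : ℕ, ((i + 1 : ℕ) : ℝ≥0) * Δ - i * Δ = Δ := fun i => by
    rw [← tsub_mul]; simp
  have hmono : Monotone fun i : ℕ => (i : ℝ≥0) * Δ := fun i j h => by
    dsimp only; gcongr
  refine (ENNReal.pow_right_strictMono two_ne_zero).le_iff_le.1 ?_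
  have h := hW.eLpNorm_sum_mul_comp_sub_sq (τ := fun i => (i : ℝ≥0) * Δ) hmono (n := N) hη
    (fun i hi => ⟨((hη i hi).mono (ℱ.le _) le_rfl).aestronglyMeasurable,
      (hηb i hi).trans_lt hb.lt_top⟩) (g := fun _ => g) (fun _ => hg)
    (fun i _ => by simpa only [hd] using hg2) (fun i _ => by simpa only [hd] using hg0)
  rw [h]
  simp only [hd]
  refine (Finset.sum_le_sum (g := fun _ => b ^ 2 * ENNReal.ofReal v) fun i hi => ?_).trans_eq ?_
  · gcongr
    exact hηb i (Finset.mem_range.1 hi)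
  · rw [Finset.sum_const, Finset.card_range, nsmul_eq_mul, mul_pow,
      ← ENNReal.ofReal_pow (Real.sqrt_nonneg _), Real.sq_sqrt (by positivity),
      ENNReal.ofReal_mul (by positivity), ENNReal.ofReal_natCast]
    ring

variable (hW : IsFiltrationBrownian P ℱ W) (hWm : Measurable (Function.uncurry W))
  (hy : MemSource P ℱ T 2 y) (hX : IsExplicit P ℱ W T y X)
include hW hWm hy hX

/-- The remainder of the Euler scheme with `N` steps of length `Δ`. -/
lemma IsExplicit.eLpNorm_euler_remainder_le {t Δ : ℝ≥0} {N : ℕ} (ht : (t : ℝ) ≤ T)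
    (hN : (N : ℝ≥0) * Δ = t) :
    eLpNorm (fun ω => (X t ω - ∫ s in (0 : ℝ)..t, y s.toNNReal ω) -
        ∑ i ∈ Finset.range N, X (i * Δ) ω * (W ((i + 1 : ℕ) * Δ) ω - W (i * Δ) ω)) 2 P ≤
      stateBound P T y * ENNReal.ofReal √(N * ((Δ : ℝ) ^ 2 * Real.exp Δ)) +
      expModulus Δ * ∫⁻ s in Ioc 0 T, normWeight P 2 y s := by
  set τ : ℕ → ℝ≥0 := fun i => (i : ℝ≥0) * Δ with hτ
  have hmono : Monotone τ := fun i j h => by simp only [hτ]; gcongr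
  have hle : ∀ i, τ i ≤ τ (i + 1) := fun i => hmono (Nat.le_succ i)
  have hτt : ∀ i ≤ N, τ i ≤ t := fun i hi => hN ▸ hmono hi
  have hτT : ∀ i ≤ N, (τ i : ℝ) ≤ T := fun i hi => le_trans (by exact_mod_cast hτt i hi) ht
  have hd : ∀ i : ℕ, τ (i + 1) - τ i = Δ := fun i => by
    simp only [hτ]; rw [← tsub_mul]; simp
  have hd' : ∀ i : ℕ, (τ (i + 1) : ℝ) - τ i = Δ := fun i => by
    rw [← NNReal.coe_sub (hle i), hd]
  have hT : 0 ≤ T := (NNReal.coe_nonneg t).trans ht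
  set g2 : ℝ → ℝ := fun x => Real.exp (x - Δ / 2) - 1 - x with hg2
  have e : (fun ω => (X t ω - ∫ s in (0 : ℝ)..t, y s.toNNReal ω) -
        ∑ i ∈ Finset.range N, X (τ i) ω * (W (τ (i + 1)) ω - W (τ i) ω)) =ᵐ[P]
      (fun ω => ∑ i ∈ Finset.range N, X (τ i) ω * g2 (W (τ (i + 1)) ω - W (τ i) ω)) +
      ∑ i ∈ Finset.range N, fun ω => ∫ s in Ioc (τ i : ℝ) (τ (i + 1)),
        (expIncr W (τ (i + 1)) s ω - 1) * y s.toNNReal ω := by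
    have hstep : ∀ᵐ ω ∂P, ∀ i < N, X (τ (i + 1)) ω - X (τ i) ω -
        X (τ i) ω * (W (τ (i + 1)) ω - W (τ i) ω) -
        ∫ s in (τ i : ℝ)..τ (i + 1), y s.toNNReal ω =
        X (τ i) ω * g2 (W (τ (i + 1)) ω - W (τ i) ω) +
        ∫ s in Ioc (τ i : ℝ) (τ (i + 1)), (expIncr W (τ (i + 1)) s ω - 1) * y s.toNNReal ω := by
      refine ae_all_iff.2 fun i => ?_
      by_cases hi : i < N
      · filter_upwards [hX.ae_eq_step hW hWm hy (hle i) (hτT (i + 1) hi)] with ω h _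
        rw [h, hd]
      · exact Eventually.of_forall fun ω h => absurd h hi
    have h0 : X 0 =ᵐ[P] 0 := by
      filter_upwards [hX.eq 0 (by simpa using hT)] with ω h
      rw [h]; simp
    filter_upwards [hstep, h0, hy.ae_intervalIntegrable one_le_two hT] with ω h1 h2 h3
    have hint : ∀ k < N, IntervalIntegrable (fun s : ℝ => y s.toNNReal ω) volume
        (τ k : ℝ) (τ (k + 1)) := fun k hk => by
      refine h3.mono_set ?_
      rw [uIcc_of_le hT]
      exact uIcc_subset_Icc ⟨NNReal.coe_nonneg _, hτT k hk.le⟩ ⟨NNReal.coe_nonneg _, hτT _ hk⟩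
    have hy' := intervalIntegral.sum_integral_adjacent_intervals
      (a := fun k => (τ k : ℝ)) (n := N) hint
    have hτ0 : τ 0 = 0 := by simp [hτ]
    have hX' := Finset.sum_range_sub (fun i => X (τ i) ω) N
    rw [show τ N = t from hN] at hy' hX'
    rw [hτ0, h2] at hX'
    rw [hτ0, NNReal.coe_zero] at hy'
    simp only [Pi.zero_apply, sub_zero] at hX'
    rw [Pi.add_apply, Finset.sum_apply, ← Finset.sum_add_distrib, ← hX', ← hy',
      ← Finset.sum_sub_distrib, ← Finset.sum_sub_distrib]
    refine Finset.sum_congr rfl fun i hi => ?_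
    rw [← h1 i (Finset.mem_range.1 hi)]
    ring
  rw [eLpNorm_congr_ae e]
  have hsm : ∀ i, AEStronglyMeasurable (fun ω => ∫ s in Ioc (τ i : ℝ) (τ (i + 1)),
      (expIncr W (τ (i + 1)) s ω - 1) * y s.toNNReal ω) P := fun i => by
    have hm := (((measurable_expIncr hWm (τ (i + 1))).sub_const 1).mul
      (measurable_toNNReal_uncurry hy.measurable)).stronglyMeasurable
    exact (StronglyMeasurable.integral_prod_left'
      (μ := volume.restrict (Ioc (τ i : ℝ) (τ (i + 1)))) hm).aestronglyMeasurable
  have hg2m : Measurable g2 := by simp only [hg2]; fun_prop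
  refine (eLpNorm_add_le ?_ (Finset.aestronglyMeasurable_sum _ fun i _ => hsm i)
    one_le_two).trans (add_le_add ?_ ?_)
  · refine (Finset.measurable_sum _ fun i _ => (hX.measurable_apply hW hWm _).mul
      (hg2m.comp ((hW.measurable_apply _).sub (hW.measurable_apply _)))).aestronglyMeasurable
  · refine hW.eLpNorm_sum_uniform_le (fun i _ => hX.adapted _) (stateBound_ne_top hy)
      (fun i hi => hX.eLpNorm_le hW hWm hy (hτT i hi.le)) hg2m
      (memLp_exp_sub_one_sub_gaussian Δ) (integral_exp_sub_one_sub_gaussian Δ) (by positivity) ?_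
    rw [eLpNorm_exp_sub_one_sub_sq_gaussian]
    exact ENNReal.ofReal_le_ofReal (exp_sub_one_sub_le Δ.2)
  · refine (eLpNorm_sum_le (fun i _ => hsm i) one_le_two).trans ?_
    have hb : ∀ i ∈ Finset.range N, eLpNorm (fun ω => ∫ s in Ioc (τ i : ℝ) (τ (i + 1)),
        (expIncr W (τ (i + 1)) s ω - 1) * y s.toNNReal ω) 2 P ≤
        expModulus Δ * ∫⁻ s in Ioc (τ i : ℝ) (τ (i + 1)), normWeight P 2 y s := fun i hi => by
      have h := eLpNorm_integral_expIncr_sub_one_le hW hWm hy (NNReal.coe_nonneg (τ i))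
        (hτT (i + 1) (Finset.mem_range.1 hi))
      rwa [hd'] at h
    refine (Finset.sum_le_sum hb).trans ?_
    rw [← Finset.mul_sum]
    gcongr
    have hmono' : Monotone fun i => (τ i : ℝ) := fun i j h => by exact_mod_cast hmono h
    have hdisj : (↑(Finset.range N) : Set ℕ).PairwiseDisjoint
        fun i => Ioc (τ i : ℝ) (τ (i + 1)) := fun i _ j _ hij =>
      hmono'.pairwise_disjoint_on_Ioc_succ hij
    rw [← lintegral_biUnion_finset hdisj (fun i _ => measurableSet_Ioc)]
    refine lintegral_mono_set (iUnion₂_subset fun i hi => ?_)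
    exact Ioc_subset_Ioc (NNReal.coe_nonneg _) (hτT (i + 1) (Finset.mem_range.1 hi))

/-- Simple processes built from the truncated values of `X` at the grid points, with the errors of
their elementary integrals and of their values. -/
lemma IsExplicit.exists_simpleProcess {t Δ : ℝ≥0} {N : ℕ} (ht : (t : ℝ) ≤ T)
    (hN : (N : ℝ≥0) * Δ = t) {ε : ℝ} (hε : 0 < ε) :
    ∃ H : SimpleProcess ℱ,
      eLpNorm (fun ω => H.integral W t ω - (X t ω - ∫ s in (0 : ℝ)..t, y s.toNNReal ω)) 2 P ≤
        ENNReal.ofReal ε * ENNReal.ofReal √(N * Δ) +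
        (stateBound P T y * ENNReal.ofReal √(N * ((Δ : ℝ) ^ 2 * Real.exp Δ)) +
          expModulus Δ * ∫⁻ s in Ioc 0 T, normWeight P 2 y s) ∧
      ∀ s ∈ Ioc (0 : ℝ) t,
        eLpNorm (fun ω => H.eval s.toNNReal ω - X s.toNNReal ω) 2 P ≤
          ENNReal.ofReal ε + (stateBound P T y * expModulus Δ +
            ENNReal.ofReal (Real.exp (T / 2)) *
              ∫⁻ r in Ioc (s - Δ) s, normWeight P 2 y r ∂(volume.restrict (Ioc 0 T))) := by
  set τ : ℕ → ℝ≥0 := fun i => (i : ℝ≥0) * Δ with hτ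
  have hmono : Monotone τ := fun i j h => by simp only [hτ]; gcongr
  have hle : ∀ i, τ i ≤ τ (i + 1) := fun i => hmono (Nat.le_succ i)
  have hτt : ∀ i ≤ N, τ i ≤ t := fun i hi => hN ▸ hmono hi
  have hτT : ∀ i ≤ N, (τ i : ℝ) ≤ T := fun i hi => le_trans (by exact_mod_cast hτt i hi) ht
  have hd : ∀ i : ℕ, τ (i + 1) = τ i + Δ := fun i => by
    simp only [hτ]; push_cast; ring
  have hex : ∀ i, ∃ (c : Ω → ℝ) (C : ℝ), Measurable[ℱ (τ i)] c ∧ 0 ≤ C ∧ (∀ ω, |c ω| ≤ C) ∧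
      (i < N → eLpNorm (fun ω => c ω - X (τ i) ω) 2 P ≤ ENNReal.ofReal ε) := fun i => by
    by_cases hi : i < N
    · obtain ⟨c, h1, ⟨C, h2, h4⟩, h3⟩ := exists_bounded_approx (ℱ.le _) (hX.adapted (τ i))
        (hX.memLp hW hWm hy (hτT i hi.le)) hε
      exact ⟨c, C, h1, h2, h4, fun _ => h3⟩
    · exact ⟨0, 0, measurable_const, le_rfl, by simp, fun h => absurd h hi⟩
  choose c C hcm hC0 hC hc using hex
  let H : SimpleProcess ℱ :=
    { n := N
      time := τ
      monotone_time := hmono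
      coeff := fun i => if i < N then c i else 0
      measurable_coeff := fun i => by
        split_ifs
        · exact hcm i
        · exact measurable_const
      bounded_coeff := by
        refine ⟨∑ i ∈ Finset.range N, C i, fun i ω => ?_⟩
        split_ifs with h
        · exact (hC i ω).trans (Finset.single_le_sum (f := C) (fun j _ => hC0 j)
            (Finset.mem_range.2 h))
        · simpa using Finset.sum_nonneg fun j _ => hC0 j }
  have hcX : ∀ i, Measurable fun ω => c i ω - X (τ i) ω := fun i =>
    ((hcm i).mono (ℱ.le _) le_rfl).sub (hX.measurable_apply hW hWm _)
  refine ⟨H, ?_, fun s hs => ?_⟩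
  · have e : (fun ω => H.integral W t ω - (X t ω - ∫ s in (0 : ℝ)..t, y s.toNNReal ω)) =
        (fun ω => ∑ i ∈ Finset.range N,
          (c i ω - X (τ i) ω) * (fun x => x) (W (τ (i + 1)) ω - W (τ i) ω)) +
        -(fun ω => (X t ω - ∫ s in (0 : ℝ)..t, y s.toNNReal ω) -
          ∑ i ∈ Finset.range N, X (τ i) ω * (W (τ (i + 1)) ω - W (τ i) ω)) := by
      funext ω
      have hH : H.integral W t ω =
          ∑ i ∈ Finset.range N, c i ω * (W (τ (i + 1)) ω - W (τ i) ω) := by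
        refine Finset.sum_congr rfl fun i hi => ?_
        have hi' : i < N := Finset.mem_range.1 hi
        simp only [H, hi', if_true]
        rw [min_eq_left (hτt i hi'.le), min_eq_left (hτt (i + 1) hi')]
      simp only [Pi.add_apply, Pi.neg_apply, hH, sub_mul, Finset.sum_sub_distrib]
      ring
    rw [e]
    have hWm' : ∀ i, Measurable fun ω => W (τ (i + 1)) ω - W (τ i) ω := fun i =>
      (hW.measurable_apply _).sub (hW.measurable_apply _)
    have hm1 : AEStronglyMeasurable (fun ω => ∑ i ∈ Finset.range N,
        (c i ω - X (τ i) ω) * (fun x => x) (W (τ (i + 1)) ω - W (τ i) ω)) P :=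
      (Finset.measurable_sum _ fun i _ => (hcX i).mul (hWm' i)).aestronglyMeasurable
    have hm2 : AEStronglyMeasurable (fun ω => (X t ω - ∫ s in (0 : ℝ)..t, y s.toNNReal ω) -
        ∑ i ∈ Finset.range N, X (τ i) ω * (W (τ (i + 1)) ω - W (τ i) ω)) P := by
      simp only [intervalIntegral.integral_of_le (NNReal.coe_nonneg t)]
      refine AEStronglyMeasurable.sub (AEStronglyMeasurable.sub
        (hX.measurable_apply hW hWm t).aestronglyMeasurable ?_)
        (Finset.measurable_sum _ fun i _ =>
          (hX.measurable_apply hW hWm _).mul (hWm' i)).aestronglyMeasurable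
      exact (StronglyMeasurable.integral_prod_left' (μ := volume.restrict (Ioc (0 : ℝ) t))
        (measurable_toNNReal_uncurry hy.measurable).stronglyMeasurable).aestronglyMeasurable
    refine (eLpNorm_add_le hm1 hm2.neg one_le_two).trans ?_
    rw [eLpNorm_neg]
    refine add_le_add ?_ (hX.eLpNorm_euler_remainder_le hW hWm hy ht hN)
    refine hW.eLpNorm_sum_uniform_le (fun i _ => (hcm i).sub (hX.adapted _)) ENNReal.ofReal_ne_top
      hc measurable_id (memLp_id_gaussian_two Δ) (by simp) Δ.2 ?_
    have hid := eLpNorm_two_sq_eq_ofReal (memLp_id_gaussian_two Δ)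
    rw [integral_sq_gaussian] at hid
    exact hid.le
  · have hs' : s.toNNReal ∈ ⋃ i ∈ Ico 0 N, Ioc (τ i) (τ (i + 1)) := by
      have h := hmono.biUnion_Ico_Ioc_map_succ 0 N
      simp only [Nat.succ_eq_succ, Nat.succ_eq_add_one] at h
      rw [h, show τ N = t from hN, mem_Ioc, Real.toNNReal_le_iff_le_coe]
      exact ⟨by simpa [hτ] using hs.1, hs.2⟩
    obtain ⟨i, hi, hsi⟩ := mem_iUnion₂.1 hs'
    have hiN : i < N := hi.2
    have hev : ∀ ω, H.eval s.toNNReal ω = c i ω := fun ω => by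
      unfold SimpleProcess.eval
      rw [Finset.sum_eq_single i]
      · rw [indicator_of_mem hsi]; simp [H, hiN]
      · intro j _ hj
        exact indicator_of_notMem
          (fun h => (hmono.pairwise_disjoint_on_Ioc_succ hj).le_bot ⟨h, hsi⟩) _
      · intro h; exact absurd (Finset.mem_range.2 hiN) h
    have e : (fun ω => H.eval s.toNNReal ω - X s.toNNReal ω) =
        (fun ω => c i ω - X (τ i) ω) + -(fun ω => X s.toNNReal ω - X (τ i) ω) := by
      funext ω; simp [hev]
    have hsT : ((s.toNNReal : ℝ≥0) : ℝ) ≤ T := by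
      rw [Real.coe_toNNReal _ hs.1.le]; exact hs.2.trans ht
    have hsX : Measurable fun ω => X s.toNNReal ω - X (τ i) ω :=
      (hX.measurable_apply hW hWm _).sub (hX.measurable_apply hW hWm _)
    have hdiff : s - Δ ≤ τ i := by
      have h2 := hsi.2
      rw [hd, Real.toNNReal_le_iff_le_coe, NNReal.coe_add] at h2
      linarith
    rw [e]
    refine (eLpNorm_add_le (hcX i).aestronglyMeasurable hsX.aestronglyMeasurable.neg
      one_le_two).trans ?_
    rw [eLpNorm_neg]
    refine add_le_add (hc i hiN) ((hX.eLpNorm_sub_le hW hWm hy hsi.1.le hsT).trans ?_)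
    rw [Real.coe_toNNReal _ hs.1.le]
    refine add_le_add (mul_le_mul_right ?_ _) (mul_le_mul_right ?_ _)
    · exact expModulus_mono (by linarith)
    · rw [Measure.restrict_restrict measurableSet_Ioc]
      refine lintegral_mono_set fun r hr => ⟨⟨hdiff.trans_lt hr.1, hr.2⟩, ?_, ?_⟩
      · exact (NNReal.coe_nonneg _).trans_lt hr.1
      · exact hr.2.trans (hs.2.trans ht)

/-- The explicit process satisfies `X_t - ∫₀ᵗ y_s ds = ∫₀ᵗ X dW`: refine the grid and relax the
truncation at the same time. -/
theorem IsExplicit.isItoIntegral {t : ℝ≥0} (ht : (t : ℝ) ≤ T) :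
    IsItoIntegral P ℱ W X t (fun ω => X t ω - ∫ s in (0 : ℝ)..t, y s.toNNReal ω) := by
  refine ⟨?_, ?_⟩
  · simp only [intervalIntegral.integral_of_le (NNReal.coe_nonneg t)]
    refine (hX.measurable_apply hW hWm t).aestronglyMeasurable.sub ?_
    exact (StronglyMeasurable.integral_prod_left' (μ := volume.restrict (Ioc (0 : ℝ) t))
      (measurable_toNNReal_uncurry hy.measurable).stronglyMeasurable).aestronglyMeasurable
  set Δ : ℕ → ℝ≥0 := fun n => t / (n + 1 : ℕ) with hΔ
  set ε : ℕ → ℝ := fun n => 1 / ((n : ℝ) + 1) with hε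
  have hN : ∀ n : ℕ, ((n + 1 : ℕ) : ℝ≥0) * Δ n = t := fun n => by
    simp only [hΔ]; field_simp
  have hN' : ∀ n : ℕ, ((n + 1 : ℕ) : ℝ) * Δ n = t := fun n => by exact_mod_cast hN n
  have hεpos : ∀ n, 0 < ε n := fun n => by positivity
  have hεlim : Tendsto ε atTop (𝓝 0) := tendsto_one_div_add_atTop_nhds_zero_nat
  have hΔeq : ∀ n, (Δ n : ℝ) = t * ε n := fun n => by
    simp only [hΔ, hε]; push_cast; ring
  have hΔlim : Tendsto (fun n => (Δ n : ℝ)) atTop (𝓝 0) := by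
    simp only [hΔeq]
    simpa using hεlim.const_mul (t : ℝ)
  have hΔt : ∀ n, (Δ n : ℝ) ≤ t := fun n => by
    rw [hΔeq]
    refine mul_le_of_le_one_right (NNReal.coe_nonneg t) ?_
    simp only [hε]
    rw [div_le_one (by positivity)]
    linarith [Nat.cast_nonneg (α := ℝ) n]
  have hε1 : ∀ n, ε n ≤ 1 := fun n => by
    simp only [hε]
    rw [div_le_one (by positivity)]
    linarith [Nat.cast_nonneg (α := ℝ) n]
  have hof : ∀ {f : ℕ → ℝ}, Tendsto f atTop (𝓝 0) →
      Tendsto (fun n => ENNReal.ofReal (f n)) atTop (𝓝 0) := fun hf => by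
    simpa using ENNReal.tendsto_ofReal hf
  have hκ : Tendsto (fun n => expModulus (Δ n)) atTop (𝓝 0) := by
    refine hof ?_
    have hc : Continuous fun x : ℝ => √(Real.exp x - 1) := by fun_prop
    have h := hc.tendsto 0
    simp only [Real.exp_zero, sub_self, Real.sqrt_zero] at h
    exact h.comp hΔlim
  set A := ∫⁻ s in Ioc 0 T, normWeight P 2 y s with hA
  have hAfin : A ≠ ∞ := hy.lintegral_normWeight_lt_top.ne
  set S := stateBound P T y with hS
  have hSfin : S ≠ ∞ := stateBound_ne_top hy
  choose H hH1 hH2 using fun n => hX.exists_simpleProcess hW hWm hy ht (hN n) (hεpos n)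
  refine ⟨H, ?_, ?_⟩
  · have hDm : ∀ n, Measurable fun q : ℝ × Ω =>
        (H n).eval q.1.toNNReal q.2 - X q.1.toNNReal q.2 := fun n =>
      (H n).measurable_eval.sub (measurable_toNNReal_uncurry hX.measurable)
    have hsq : ∀ n, eLpNorm (fun q : ℝ × Ω => (H n).eval q.1.toNNReal q.2 - X q.1.toNNReal q.2) 2
        ((volume.restrict (Ioc (0 : ℝ) t)).prod P) ^ 2 = ∫⁻ s in Ioc (0 : ℝ) t,
          eLpNorm (fun ω => (H n).eval s.toNNReal ω - X s.toNNReal ω) 2 P ^ 2 := fun n => by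
      simp only [eLpNorm_two_sq]
      exact lintegral_prod _ ((hDm n).enorm.pow_const 2).aemeasurable
    -- the pointwise error bound tends to zero and is dominated by the constant `B`
    set b : ℕ → ℝ → ℝ≥0∞ := fun n s => ENNReal.ofReal (ε n) + (S * expModulus (Δ n) +
      ENNReal.ofReal (Real.exp (T / 2)) *
        ∫⁻ r in Ioc (s - Δ n) s, normWeight P 2 y r ∂(volume.restrict (Ioc 0 T))) with hb
    set B : ℝ≥0∞ := 1 + (S * expModulus t + ENNReal.ofReal (Real.exp (T / 2)) * A) with hB
    have hBfin : B ≠ ∞ := by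
      refine ENNReal.add_ne_top.2 ⟨ENNReal.one_ne_top, ENNReal.add_ne_top.2 ⟨?_, ?_⟩⟩
      · exact ENNReal.mul_ne_top hSfin ENNReal.ofReal_ne_top
      · exact ENNReal.mul_ne_top ENNReal.ofReal_ne_top hAfin
    have hbB : ∀ n s, b n s ≤ B := fun n s => by
      refine add_le_add ?_ (add_le_add (mul_le_mul_right (expModulus_mono (hΔt n)) _)
        (mul_le_mul_right (setLIntegral_le_lintegral _ _) _))
      exact ENNReal.ofReal_le_one.2 (hε1 n)
    have hblim : ∀ s, Tendsto (fun n => b n s) atTop (𝓝 0) := fun s => by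
      have h3 : Tendsto (fun n => ∫⁻ r in Ioc (s - Δ n) s, normWeight P 2 y r
          ∂(volume.restrict (Ioc 0 T))) atTop (𝓝 0) := by
        refine tendsto_setLIntegral_zero hAfin ?_
        refine tendsto_of_tendsto_of_tendsto_of_le_of_le tendsto_const_nhds (hof hΔlim)
          (fun n => zero_le) (fun n => (Measure.restrict_apply_le _ _).trans ?_)
        simp
      have h := (hof hεlim).add ((ENNReal.Tendsto.const_mul hκ (Or.inr hSfin)).add
        (ENNReal.Tendsto.const_mul h3
          (Or.inr (ENNReal.ofReal_ne_top (r := Real.exp (T / 2))))))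
      simp only [mul_zero, add_zero] at h
      exact h
    have hlim : Tendsto (fun n => ∫⁻ s in Ioc (0 : ℝ) t,
        eLpNorm (fun ω => (H n).eval s.toNNReal ω - X s.toNNReal ω) 2 P ^ 2) atTop (𝓝 0) := by
      have h := tendsto_lintegral_of_dominated_convergence (μ := volume.restrict (Ioc (0 : ℝ) t))
        (F := fun n s => eLpNorm (fun ω => (H n).eval s.toNNReal ω - X s.toNNReal ω) 2 P ^ 2)
        (f := fun _ => 0) (fun _ => B ^ 2) ?_ ?_ ?_ ?_
      · simpa using h
      · intro n
        simp only [eLpNorm_two_sq]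
        exact ((hDm n).enorm.pow_const 2).lintegral_prod_right'
      · intro n
        filter_upwards [ae_restrict_mem measurableSet_Ioc] with s hs
        exact pow_le_pow_left₀ zero_le ((hH2 n s hs).trans (hbB n s)) 2
      · rw [lintegral_const]
        exact ENNReal.mul_ne_top (ENNReal.pow_ne_top hBfin) (by simp)
      · filter_upwards [ae_restrict_mem measurableSet_Ioc] with s hs
        have h2 := ENNReal.Tendsto.pow (n := 2) (hblim s)
        rw [zero_pow two_ne_zero] at h2
        exact tendsto_of_tendsto_of_tendsto_of_le_of_le tendsto_const_nhds h2
          (fun n => zero_le) (fun n => pow_le_pow_left₀ zero_le (hH2 n s hs) 2)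
    simp only [← hsq] at hlim
    have h := (ENNReal.continuous_rpow_const (y := 1 / 2)).tendsto 0 |>.comp hlim
    rw [ENNReal.zero_rpow_of_pos (by norm_num)] at h
    refine h.congr fun n => ?_
    simp only [Function.comp]
    rw [← ENNReal.rpow_natCast, ← ENNReal.rpow_mul]
    norm_num
  · refine tendsto_of_tendsto_of_tendsto_of_le_of_le tendsto_const_nhds ?_
      (fun n => zero_le) hH1
    have h1 : Tendsto (fun n => ENNReal.ofReal (ε n) *
        ENNReal.ofReal √(((n + 1 : ℕ) : ℝ) * Δ n)) atTop (𝓝 0) := by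
      simp only [hN']
      simpa using ENNReal.Tendsto.mul_const (hof hεlim) (Or.inr ENNReal.ofReal_ne_top)
    have h2 : Tendsto (fun n => ENNReal.ofReal
        √(((n + 1 : ℕ) : ℝ) * ((Δ n : ℝ) ^ 2 * Real.exp (Δ n)))) atTop (𝓝 0) := by
      have e : ∀ n, ((n + 1 : ℕ) : ℝ) * ((Δ n : ℝ) ^ 2 * Real.exp (Δ n)) =
          t * (Δ n * Real.exp (Δ n)) := fun n => by
        rw [← hN' n]; ring
      simp only [e]
      refine hof ?_
      have hc : Continuous fun x : ℝ => √(t * (x * Real.exp x)) := by fun_prop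
      have h := hc.tendsto 0
      simp only [zero_mul, mul_zero, Real.sqrt_zero] at h
      exact h.comp hΔlim
    have h := h1.add ((ENNReal.Tendsto.const_mul h2 (Or.inr hSfin)).add
      (ENNReal.Tendsto.mul_const hκ (Or.inr hAfin)))
    simpa using h

end Core

/-! ### Variation of constants -/

section Drift

variable {a : ℝ → ℝ} {C : ℝ}

/-- The primitive `∫₀ᵗ a(s) ds`. -/
def drift (a : ℝ → ℝ) (t : ℝ) : ℝ := ∫ s in (0 : ℝ)..t, a s

lemma intervalIntegrable_of_abs_le (ham : Measurable a) (haC : ∀ s, |a s| ≤ C) (r t : ℝ) :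
    IntervalIntegrable a volume r t :=
  (intervalIntegrable_const (c := C)).mono_fun ham.aestronglyMeasurable
    (Eventually.of_forall fun s => by
      simpa using (haC s).trans (le_abs_self C))

lemma abs_drift_sub_le (ham : Measurable a) (haC : ∀ s, |a s| ≤ C) (r t : ℝ) :
    |drift a t - drift a r| ≤ C * |t - r| := by
  unfold drift
  rw [intervalIntegral.integral_interval_sub_left (intervalIntegrable_of_abs_le ham haC _ _)
    (intervalIntegrable_of_abs_le ham haC _ _)]
  exact intervalIntegral.norm_integral_le_of_norm_le_const (f := a) (C := C) fun s _ => haC s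

lemma lipschitzWith_drift (ham : Measurable a) (haC : ∀ s, |a s| ≤ C) :
    LipschitzWith C.toNNReal (drift a) := by
  have hC : 0 ≤ C := (abs_nonneg _).trans (haC 0)
  refine LipschitzWith.of_dist_le_mul fun x y => ?_
  rw [Real.dist_eq, Real.dist_eq, Real.coe_toNNReal _ hC]
  exact abs_drift_sub_le ham haC y x

/-- On a compact interval `exp` is Lipschitz on the range of the primitive. -/
lemma absolutelyContinuousOnInterval_exp_drift (ham : Measurable a) (haC : ∀ s, |a s| ≤ C)
    {t : ℝ} : AbsolutelyContinuousOnInterval (fun s => Real.exp (drift a s)) 0 t := by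
  have hD := lipschitzWith_drift ham haC
  have hcomp : IsCompact (drift a '' uIcc 0 t) := isCompact_uIcc.image hD.continuous
  obtain ⟨R, hR⟩ := hcomp.isBounded.subset_closedBall 0
  obtain ⟨K, hK⟩ := Real.contDiff_exp.contDiffOn.exists_lipschitzOnWith (n := 1) one_ne_zero
    (convex_closedBall (0 : ℝ) R) (isCompact_closedBall _ _)
  exact (hK.comp hD.lipschitzOnWith
    fun s hs => hR (mem_image_of_mem _ hs)).absolutelyContinuousOnInterval

/-- The product rule for `exp (∫₀ᵗ a) * ∫₀ᵗ g`, in integrated form. -/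
lemma exp_drift_mul_integral (ham : Measurable a) (haC : ∀ s, |a s| ≤ C) {t : ℝ}
    {g : ℝ → ℝ} (hg : IntervalIntegrable g volume 0 t) :
    Real.exp (drift a t) * ∫ s in (0 : ℝ)..t, g s =
      ∫ s in (0 : ℝ)..t,
        (Real.exp (drift a s) * a s * (∫ r in (0 : ℝ)..s, g r) + Real.exp (drift a s) * g s) := by
  have hG := hg.absolutelyContinuousOnInterval_intervalIntegral (c := 0) left_mem_uIcc
  have h := (absolutelyContinuousOnInterval_exp_drift ham haC
    (t := t)).integral_deriv_mul_eq_sub hG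
  rw [intervalIntegral.integral_same, mul_zero, sub_zero] at h
  rw [← h]
  refine intervalIntegral.integral_congr_ae ?_
  filter_upwards [hg.ae_hasDerivAt_integral,
    (intervalIntegrable_of_abs_le ham haC 0 t).ae_hasDerivAt_integral] with s h1 h2 hs
  have hs' := uIoc_subset_uIcc hs
  have h3 : HasDerivAt (drift a) (a s) s := h2 hs' 0 left_mem_uIcc
  rw [(h1 hs' 0 left_mem_uIcc).deriv, h3.exp.deriv]

end Drift

section State

variable {Ω : Type*} {mΩ : MeasurableSpace Ω} {P : Measure Ω} [IsProbabilityMeasure P]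
  {ℱ : Filtration ℝ≥0 mΩ} {W : ℝ≥0 → Ω → ℝ} {T p C : ℝ} {a : ℝ → ℝ} {y : ℝ≥0 → Ω → ℝ}

lemma MemSource.mono {q : ℝ} (hqp : q ≤ p) (hy : MemSource P ℱ T p y) :
    MemSource P ℱ T q y := by
  have h : ∀ t, eLpNorm (y t) (ENNReal.ofReal q) P ≤ eLpNorm (y t) (ENNReal.ofReal p) P :=
    fun t => eLpNorm_le_eLpNorm_of_exponent_le (ENNReal.ofReal_le_ofReal hqp)
      (hy.measurable.comp measurable_prodMk_left).aestronglyMeasurable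
  exact ⟨hy.adapted, hy.measurable, fun t ht => (h t).trans_lt (hy.eLpNorm_lt_top t ht),
    (lintegral_mono fun s => h _).trans_lt hy.lintegral_lt_top⟩

/-- The fundamental solution `exp (∫ₛᵗ a + W_t - W_s - (t - s) / 2)` of the linear equation. -/
def stateFlow (a : ℝ → ℝ) (W : ℝ≥0 → Ω → ℝ) (t s : ℝ) (ω : Ω) : ℝ :=
  Real.exp (drift a t - drift a s) * expIncr W t s ω

/-- The solution of the linear equation with zero initial value, by variation of constants. -/
def explicitState (a : ℝ → ℝ) (W y : ℝ≥0 → Ω → ℝ) (t : ℝ) (ω : Ω) : ℝ :=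
  ∫ s in (0 : ℝ)..t, stateFlow a W t s ω * y s.toNNReal ω

/-- The fundamental solution factorises into a function of `t` and a function of `s`. -/
lemma stateFlow_eq (t s : ℝ) (ω : Ω) : stateFlow a W t s ω = stateFlow a W t 0 ω *
    stateFlow a W 0 s ω := by
  unfold stateFlow
  rw [← expIncr_mul s 0 t, mul_mul_mul_comm, ← Real.exp_add]
  congr 3; ring

lemma stateFlow_pos (t s : ℝ) (ω : Ω) : 0 < stateFlow a W t s ω :=
  mul_pos (Real.exp_pos _) (Real.exp_pos _)

variable (ham : Measurable a) (haC : ∀ s, |a s| ≤ C)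
include ham haC

lemma continuous_stateFlow_right {ω : Ω} (hω : Continuous fun t => W t ω) (t : ℝ) :
    Continuous fun s => stateFlow a W t s ω := by
  have h1 := (lipschitzWith_drift ham haC).continuous
  have h2 := continuous_expIncr hω t
  unfold stateFlow
  fun_prop

lemma continuous_stateFlow_left {ω : Ω} (hω : Continuous fun t => W t ω) (s : ℝ) :
    Continuous fun t => stateFlow a W t s ω := by
  have h1 := (lipschitzWith_drift ham haC).continuous
  have h2 : Continuous fun s : ℝ => W s.toNNReal ω := hω.comp continuous_real_toNNReal
  unfold stateFlow expIncr
  fun_prop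

lemma intervalIntegrable_stateFlow_mul {ω : Ω} (hω : Continuous fun t => W t ω) {f : ℝ → ℝ}
    {r t : ℝ} (hf : IntervalIntegrable f volume r t) (u : ℝ) :
    IntervalIntegrable (fun s => stateFlow a W u s ω * f s) volume r t :=
  hf.continuousOn_mul (continuous_stateFlow_right ham haC hω u).continuousOn

/-- The explicit state solves the equation without drift coefficient when `a X` is counted as a
part of the source. -/
lemma explicitState_eq {ω : Ω} (hω : Continuous fun t => W t ω) {t : ℝ}
    (hy : IntervalIntegrable (fun s : ℝ => y s.toNNReal ω) volume 0 t) :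
    explicitState a W y t ω = ∫ s in (0 : ℝ)..t,
      expIncr W t s ω * (a s * explicitState a W y s ω + y s.toNNReal ω) := by
  have hD := (lipschitzWith_drift ham haC).continuous
  set g : ℝ → ℝ := fun s => (Real.exp (-drift a s) * expIncr W t s ω) * y s.toNNReal ω with hg
  have hgi : IntervalIntegrable g volume 0 t := by
    refine hy.continuousOn_mul (Continuous.continuousOn ?_)
    have := continuous_expIncr hω t
    fun_prop
  have hX : ∀ s, expIncr W t s ω * explicitState a W y s ω =
      Real.exp (drift a s) * ∫ r in (0 : ℝ)..s, g r := by
    intro s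
    unfold explicitState
    rw [← intervalIntegral.integral_const_mul, ← intervalIntegral.integral_const_mul]
    congr 1
    funext r
    simp only [hg, stateFlow]
    rw [sub_eq_add_neg, Real.exp_add, ← expIncr_mul r s t]
    ring
  have h := exp_drift_mul_integral ham haC hgi
  rw [← hX t] at h
  have htt : expIncr W t t ω = 1 := by simp [expIncr]
  rw [htt, one_mul] at h
  rw [h]
  congr 1
  funext s
  rw [mul_assoc, mul_left_comm, ← hX s]
  simp only [hg]
  have : Real.exp (drift a s) * Real.exp (-drift a s) = 1 := by
    rw [← Real.exp_add]; simp
  linear_combination (expIncr W t s ω * y s.toNNReal ω) * this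

lemma continuousOn_explicitState {ω : Ω} (hω : Continuous fun t => W t ω) (hT : 0 ≤ T)
    (hy : IntervalIntegrable (fun s : ℝ => y s.toNNReal ω) volume 0 T) :
    ContinuousOn (fun t => explicitState a W y t ω) (Icc 0 T) := by
  have h1 : ∀ t, explicitState a W y t ω = stateFlow a W t 0 ω *
      ∫ s in (0 : ℝ)..t, stateFlow a W 0 s ω * y s.toNNReal ω := fun t => by
    unfold explicitState
    rw [← intervalIntegral.integral_const_mul]
    congr 1; funext s
    rw [stateFlow_eq, mul_assoc]
  simp only [h1]
  refine (continuous_stateFlow_left ham haC hω 0).continuousOn.mul ?_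
  have h2 := intervalIntegrable_stateFlow_mul ham haC hω hy 0
  have h3 := intervalIntegral.continuousOn_primitive_interval'  h2 left_mem_uIcc
  rwa [uIcc_of_le hT] at h3

variable (hW : IsFiltrationBrownian P ℱ W) (hWm : Measurable (Function.uncurry W))
include hW hWm

omit ham haC hW in
lemma measurable_stateFlow (hD : Continuous (drift a)) (t : ℝ) :
    Measurable (Function.uncurry fun s ω => stateFlow a W t s ω) :=
  (Real.measurable_exp.comp ((hD.measurable.comp measurable_fst).const_sub _)).mul
    (measurable_expIncr hWm t)

/-- The bound for the `L^p` norm of the fundamental solution on `[0,T]`. -/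
def flowBound (C T p : ℝ) : ℝ≥0∞ := ENNReal.ofReal (Real.exp (C * T + (p - 1) * T / 2))

lemma eLpNorm_stateFlow_mul_le (hp : 1 ≤ p) (hy : MemSource P ℱ T p y) {s t : ℝ} (hs : 0 ≤ s)
    (hst : s ≤ t) (ht : t ≤ T) :
    eLpNorm (fun ω => stateFlow a W t s ω * y s.toNNReal ω) (ENNReal.ofReal p) P ≤
      flowBound C T p * normWeight P p y s := by
  have hp0 : 0 < p := by linarith
  have hC : 0 ≤ C := (abs_nonneg _).trans (haC 0)
  have hv := coe_toNNReal_sub hs hst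
  have e : (fun ω => stateFlow a W t s ω * y s.toNNReal ω) =
      Real.exp (drift a t - drift a s) • fun ω => (y s.toNNReal ω *
        (fun x => Real.exp (x - ((t.toNNReal - s.toNNReal : ℝ≥0) : ℝ) / 2))
          (W t.toNNReal ω - W s.toNNReal ω)) := by
    funext ω
    simp only [Pi.smul_apply, smul_eq_mul, stateFlow, expIncr, hv]
    ring
  rw [e, eLpNorm_const_smul,
    hW.eLpNorm_mul_comp_sub (Real.toNNReal_le_toNNReal hst) (hy.adapted _)
      (g := fun x => Real.exp (x - ((t.toNNReal - s.toNNReal : ℝ≥0) : ℝ) / 2)) (by fun_prop) hp0,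
    eLpNorm_exp_gaussian _ hp0, hv, Real.enorm_of_nonneg (Real.exp_pos _).le, mul_left_comm,
    ← ENNReal.ofReal_mul (Real.exp_pos _).le, ← Real.exp_add, mul_comm]
  refine mul_le_mul' (ENNReal.ofReal_le_ofReal (Real.exp_le_exp.2 ?_)) le_self_add
  have h1 := (le_abs_self _).trans (abs_drift_sub_le ham haC s t)
  rw [abs_of_nonneg (sub_nonneg.2 hst)] at h1
  have h2 : C * (t - s) ≤ C * T := mul_le_mul_of_nonneg_left (by linarith) hC
  have h3 : (p - 1) * (t - s) ≤ (p - 1) * T :=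
    mul_le_mul_of_nonneg_left (by linarith) (by linarith)
  linarith

lemma eLpNorm_explicitState_le (hp : 1 ≤ p) (hy : MemSource P ℱ T p y) {t : ℝ} (ht0 : 0 ≤ t)
    (ht : t ≤ T) :
    eLpNorm (explicitState a W y t) (ENNReal.ofReal p) P ≤
      flowBound C T p * ∫⁻ s in Ioc 0 T, normWeight P p y s := by
  have hp0 : 0 < p := by linarith
  have hD := (lipschitzWith_drift ham haC).continuous
  have hfb : flowBound C T p ≠ ∞ := ENNReal.ofReal_ne_top
  refine le_trans ?_ (mul_le_mul_right
    (lintegral_mono_set (Ioc_subset_Ioc_right ht) (f := normWeight P p y)) _)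
  rw [← lintegral_const_mul' _ _ hfb]
  unfold explicitState
  simp only [intervalIntegral.integral_of_le ht0]
  refine eLpNorm_integral_le hp (f := fun s ω => stateFlow a W t s ω * y s.toNNReal ω)
    ((measurable_stateFlow hWm hD t).mul (measurable_toNNReal_uncurry hy.measurable))
    ((hy.measurable_normWeight hp0).const_mul _) ?_
  filter_upwards [ae_restrict_mem measurableSet_Ioc] with s hs
  have hfb0 : flowBound C T p ≠ 0 := by
    unfold flowBound; simpa using Real.exp_pos _
  exact ⟨mul_ne_zero hfb0 (normWeight_ne_zero s),
    ENNReal.mul_ne_top hfb (hy.normWeight_ne_top ⟨hs.1, hs.2.trans ht⟩),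
    eLpNorm_stateFlow_mul_le ham haC hW hWm hp hy hs.1.le hs.2 ht⟩

lemma integrable_stateFlow_mul (hy : MemSource P ℱ T 1 y) {t : ℝ} (ht : t ≤ T) :
    Integrable (Function.uncurry fun s ω => stateFlow a W t s ω * y s.toNNReal ω)
      ((volume.restrict (Ioc 0 t)).prod P) := by
  have hD := (lipschitzWith_drift ham haC).continuous
  have hm : Measurable (Function.uncurry fun s ω => stateFlow a W t s ω * y s.toNNReal ω) :=
    (measurable_stateFlow hWm hD t).mul (measurable_toNNReal_uncurry hy.measurable)
  refine ⟨hm.aestronglyMeasurable, ?_⟩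
  rw [hasFiniteIntegral_iff_enorm, lintegral_prod _ hm.enorm.aemeasurable]
  have hfin : flowBound C T 1 * ∫⁻ s in Ioc 0 T, normWeight P 1 y s < ∞ :=
    ENNReal.mul_lt_top ENNReal.ofReal_lt_top hy.lintegral_normWeight_lt_top
  refine lt_of_le_of_lt ?_ hfin
  refine le_trans ?_ (mul_le_mul_right
    (lintegral_mono_set (Ioc_subset_Ioc_right ht) (f := normWeight P 1 y)) _)
  have hfb : flowBound C T 1 ≠ ∞ := ENNReal.ofReal_ne_top
  rw [← lintegral_const_mul' _ _ hfb]
  refine setLIntegral_mono' measurableSet_Ioc fun s hs => ?_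
  have h := eLpNorm_stateFlow_mul_le ham haC hW hWm le_rfl hy hs.1.le hs.2 ht
  rwa [ENNReal.ofReal_one, eLpNorm_one_eq_lintegral_enorm] at h

/-- The explicit state at time `t` is almost surely equal to an `ℱ t`-measurable variable. -/
lemma exists_measurable_ae_eq_explicitState (hy : MemSource P ℱ T 1 y) {t : ℝ≥0}
    (ht : (t : ℝ) ≤ T) :
    ∃ g : Ω → ℝ, Measurable[ℱ t] g ∧ explicitState a W y t =ᵐ[P] g := by
  unfold explicitState
  simp only [intervalIntegral.integral_of_le (NNReal.coe_nonneg t)]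
  refine exists_measurable_ae_eq_integral (ℱ.le t)
    (integrable_stateFlow_mul ham haC hW hWm hy ht) ?_
  filter_upwards [ae_restrict_mem measurableSet_Ioc] with s hs
  have hst : s.toNNReal ≤ t := Real.toNNReal_le_iff_le_coe.2 hs.2
  have h1 : Measurable[ℱ t] (W s.toNNReal) := (hW.adapted _).mono (ℱ.mono hst) le_rfl
  have h2 : Measurable[ℱ t] (W (t : ℝ).toNNReal) := by
    rw [Real.toNNReal_coe]; exact hW.adapted t
  have h3 : Measurable[ℱ t] (y s.toNNReal) := (hy.adapted _).mono (ℱ.mono hst) le_rfl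
  have h4 : Measurable[ℱ t] fun ω => W (t : ℝ).toNNReal ω - W s.toNNReal ω - (t - s) / 2 :=
    (h2.sub h1).sub_const _
  exact ((Real.measurable_exp.comp h4).const_mul _).mul h3

/-- Existence: the explicit state has an adapted, jointly measurable version, and this version
solves the Itô equation. -/
theorem exists_isSolution (hT : 0 < T) (hy : MemSource P ℱ T 2 y) :
    ∃ X, IsSolution P ℱ W T a 0 y X ∧
      ∀ᵐ ω ∂P, ∀ t : ℝ≥0, (t : ℝ) ≤ T → X t ω = explicitState a W y t ω := by
  have hC : 0 ≤ C := (abs_nonneg _).trans (haC 0)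
  have hy1 : MemSource P ℱ T 1 y := hy.mono one_le_two
  have hyint := hy.ae_intervalIntegrable one_le_two hT.le
  have hTn : ((T.toNNReal : ℝ≥0) : ℝ) = T := Real.coe_toNNReal T hT.le
  have hmin : ∀ t : ℝ≥0, ((min t T.toNNReal : ℝ≥0) : ℝ) ≤ T := fun t => by
    rw [NNReal.coe_min, hTn]; exact min_le_right _ _
  have hmin' : ∀ t : ℝ≥0, (t : ℝ) ≤ T → min t T.toNNReal = t := fun t ht =>
    min_eq_left (by rw [← NNReal.coe_le_coe, hTn]; exact ht)
  -- stop at time `T` in order to work with processes on the whole half line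
  obtain ⟨X, hXa, hXm, hX⟩ := exists_adapted_measurable_modification (P := P) (ℱ := ℱ)
    (Z := fun t ω => explicitState a W y (min t T.toNNReal : ℝ≥0) ω) (by
      filter_upwards [hW.isBrownian.cont, hyint] with ω h1 h2
      exact (continuousOn_explicitState ham haC h1 hT.le h2).comp_continuous
        (NNReal.continuous_coe.comp (continuous_id.min continuous_const))
        fun t => ⟨NNReal.coe_nonneg _, hmin t⟩) (fun t => by
      obtain ⟨g, hg1, hg2⟩ := exists_measurable_ae_eq_explicitState ham haC hW hWm hy1 (hmin t)
      exact ⟨g, hg1.mono (ℱ.mono (min_le_left _ _)) le_rfl, hg2⟩)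
  have hXeq : ∀ᵐ ω ∂P, ∀ t : ℝ≥0, (t : ℝ) ≤ T → X t ω = explicitState a W y t ω := by
    filter_upwards [hX] with ω h t ht
    rw [h t, hmin' t ht]
  have hXt : ∀ t, Measurable (X t) := fun t => hXm.comp measurable_prodMk_left
  set B : ℝ≥0∞ := flowBound C T 2 * ∫⁻ s in Ioc 0 T, normWeight P 2 y s with hB
  have hBfin : B < ∞ := ENNReal.mul_lt_top ENNReal.ofReal_lt_top hy.lintegral_normWeight_lt_top
  have hXB : ∀ t : ℝ≥0, (t : ℝ) ≤ T → eLpNorm (X t) (ENNReal.ofReal 2) P ≤ B := fun t ht => by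
    rw [eLpNorm_congr_ae (hXeq.mono fun ω h => h t ht)]
    exact eLpNorm_explicitState_le ham haC hW hWm one_le_two hy (NNReal.coe_nonneg t) ht
  -- `X` is explicit without drift coefficient for this source
  set z : ℝ≥0 → Ω → ℝ := fun t ω => a t * X t ω + y t ω with hz
  have hzt : ∀ t : ℝ≥0, (t : ℝ) ≤ T → eLpNorm (z t) (ENNReal.ofReal 2) P ≤
      ENNReal.ofReal C * B + eLpNorm (y t) (ENNReal.ofReal 2) P := fun t ht => by
    have hyt : Measurable (y t) := hy.measurable.comp measurable_prodMk_left
    refine (eLpNorm_add_le (f := fun ω => a t * X t ω) (g := y t)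
      ((hXt t).const_mul _).aestronglyMeasurable hyt.aestronglyMeasurable
      (by simp)).trans (add_le_add ?_ le_rfl)
    rw [show (fun ω => a t * X t ω) = a t • X t from rfl, eLpNorm_const_smul]
    refine mul_le_mul' ?_ (hXB t ht)
    rw [← ofReal_norm]
    exact ENNReal.ofReal_le_ofReal (haC t)
  have hzS : MemSource P ℱ T 2 z := by
    refine ⟨fun t => ((hXa t).const_mul _).add (hy.adapted t), ?_, fun t ht => ?_, ?_⟩
    · exact (((ham.comp measurable_subtype_coe).comp measurable_fst).mul hXm).add hy.measurable
    · refine (hzt t ht).trans_lt (ENNReal.add_lt_top.2 ⟨?_, hy.eLpNorm_lt_top t ht⟩)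
      exact ENNReal.mul_lt_top ENNReal.ofReal_lt_top hBfin
    · refine (setLIntegral_mono' measurableSet_Ioc fun s hs => hzt s.toNNReal (by
        rw [Real.coe_toNNReal _ hs.1.le]; exact hs.2)).trans_lt ?_
      rw [lintegral_add_left measurable_const]
      refine ENNReal.add_lt_top.2 ⟨?_, hy.lintegral_lt_top⟩
      rw [lintegral_const]
      refine ENNReal.mul_lt_top (ENNReal.mul_lt_top ENNReal.ofReal_lt_top hBfin) (by simp)
  have hzeq : ∀ t ω, ∀ s ∈ uIoc (0 : ℝ) (t : ℝ≥0), z s.toNNReal ω =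
      a s * X s.toNNReal ω + y s.toNNReal ω := fun t ω s hs => by
    rw [uIoc_of_le (NNReal.coe_nonneg t)] at hs
    simp only [hz]
    rw [Real.coe_toNNReal _ hs.1.le]
  have hXE : IsExplicit P ℱ W T z X := by
    refine ⟨hXa, hXm, fun t ht => ?_⟩
    filter_upwards [hXeq, hW.isBrownian.cont, hyint] with ω h1 h2 h3
    have h3' : IntervalIntegrable (fun s : ℝ => y s.toNNReal ω) volume 0 t := by
      refine h3.mono_set ?_
      rw [uIcc_of_le hT.le]
      exact uIcc_subset_Icc ⟨le_rfl, hT.le⟩ ⟨NNReal.coe_nonneg t, ht⟩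
    rw [h1 t ht, explicitState_eq ham haC h2 h3']
    refine intervalIntegral.integral_congr_ae (Eventually.of_forall fun s hs => ?_)
    rw [hzeq t ω s hs]
    rw [uIoc_of_le (NNReal.coe_nonneg t)] at hs
    rw [h1 s.toNNReal (by rw [Real.coe_toNNReal _ hs.1.le]; exact hs.2.trans ht),
      Real.coe_toNNReal _ hs.1.le]
  refine ⟨X, ⟨⟨hXa, hXm, fun t ht => ⟨(hXt t).aestronglyMeasurable, (hXB t ht).trans_lt hBfin⟩,
    ?_⟩, ?_, ?_, ?_, fun t ht => ?_⟩, hXeq⟩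
  · have hb : ∀ s ∈ Icc (0 : ℝ) T,
        (∫⁻ ω, ‖X s.toNNReal ω‖ₑ ^ (2 : ℝ) ∂P) ^ (2 / 2 : ℝ) ≤ B ^ 2 := fun s hs => by
      have h := pow_le_pow_left₀ zero_le (hXB s.toNNReal
        (by rw [Real.coe_toNNReal _ hs.1]; exact hs.2)) 2
      rw [ENNReal.ofReal_ofNat, eLpNorm_two_sq] at h
      simpa using h
    refine (setLIntegral_mono' measurableSet_Icc hb).trans_lt ?_
    rw [lintegral_const]
    exact ENNReal.mul_lt_top (ENNReal.pow_lt_top hBfin) (by simp)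
  · filter_upwards [hXeq, hW.isBrownian.cont, hyint] with ω h1 h2 h3
    refine ContinuousOn.congr (f := fun t : ℝ≥0 => explicitState a W y t ω) ?_ fun t ht => h1 t ht
    exact (continuousOn_explicitState ham haC h2 hT.le h3).comp
      NNReal.continuous_coe.continuousOn fun t ht => ⟨NNReal.coe_nonneg t, ht⟩
  · filter_upwards [hXeq] with ω h1
    rw [h1 0 (by simpa using hT.le)]
    simp [explicitState]
  · filter_upwards [hzS.ae_intervalIntegrable one_le_two hT.le] with ω h
    rw [intervalIntegrable_iff_integrableOn_Ioc_of_le hT.le] at h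
    refine h.congr_fun (fun s hs => ?_) measurableSet_Ioc
    refine hzeq T.toNNReal ω s ?_
    rw [hTn, uIoc_of_le hT.le]; exact hs
  · refine (hXE.isItoIntegral hW hWm hzS ht).congr (Eventually.of_forall fun _ _ => rfl)
      (Eventually.of_forall fun ω => ?_)
    simp only [Pi.zero_apply, sub_zero]
    congr 1
    exact intervalIntegral.integral_congr_ae (Eventually.of_forall fun s hs => hzeq t ω s hs)

end State

/-! ### The response to a control -/

section Response

variable {Ω : Type*} {mΩ : MeasurableSpace Ω} {W : ℝ≥0 → Ω → ℝ} {T C : ℝ} {a : ℝ → ℝ}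

/-- The amount `∫₀ᵗ exp (∫ₛᵗ a + W_t - W_s - (t - s) / 2) u(s) ds` by which a control `u` lowers
the state. -/
def controlResponse (a : ℝ → ℝ) (W : ℝ≥0 → Ω → ℝ) (u : ℝ → ℝ) (t : ℝ) (ω : Ω) : ℝ :=
  ∫ s in (0 : ℝ)..t, stateFlow a W t s ω * u s

lemma L1.intervalIntegrable (u : L1 T) {t : ℝ} (ht : t ∈ Icc 0 T) :
    IntervalIntegrable u volume 0 t := by
  rw [intervalIntegrable_iff_integrableOn_Ioc_of_le ht.1, IntegrableOn]
  have h : Integrable u (volume.restrict (Ioc 0 T)) := by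
    rw [← Measure.restrict_congr_set Ioo_ae_eq_Ioc]
    exact L1.integrable_coeFn u
  exact h.mono_measure (Measure.restrict_mono (Ioc_subset_Ioc_right ht.2) le_rfl)

/-- The endpoints carry no mass: statements about `(0, T)` pass to the interval of integration. -/
lemma ae_uIoc_of_ae_restrict_Ioo {p : ℝ → Prop} (h : ∀ᵐ s ∂(volume.restrict (Ioo 0 T)), p s)
    {t : ℝ} (ht : t ∈ Icc 0 T) : ∀ᵐ s, s ∈ uIoc 0 t → p s := by
  rw [Measure.restrict_congr_set Ioo_ae_eq_Ioc, ae_restrict_iff' measurableSet_Ioc] at h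
  filter_upwards [h] with s hs hst
  rw [uIoc_of_le ht.1] at hst
  exact hs ⟨hst.1, hst.2.trans ht.2⟩

variable (ham : Measurable a) (haC : ∀ s, |a s| ≤ C)
include ham haC

lemma explicitState_sub_control {z : ℝ≥0 → Ω → ℝ} {ω : Ω} (hω : Continuous fun t => W t ω)
    (hz : IntervalIntegrable (fun s : ℝ => z s.toNNReal ω) volume 0 T) (u : L1 T) {t : ℝ}
    (ht : t ∈ Icc 0 T) :
    explicitState a W (fun t ω => z t ω - u (t : ℝ)) t ω =
      explicitState a W z t ω - controlResponse a W u t ω := by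
  have hz' : IntervalIntegrable (fun s : ℝ => z s.toNNReal ω) volume 0 t := by
    refine hz.mono_set ?_
    rw [uIcc_of_le (ht.1.trans ht.2)]
    exact uIcc_subset_Icc ⟨le_rfl, ht.1.trans ht.2⟩ ht
  unfold explicitState controlResponse
  rw [← intervalIntegral.integral_sub (intervalIntegrable_stateFlow_mul ham haC hω hz' t)
    (intervalIntegrable_stateFlow_mul ham haC hω (L1.intervalIntegrable u ht) t)]
  refine intervalIntegral.integral_congr_ae (Eventually.of_forall fun s hs => ?_)
  rw [uIoc_of_le ht.1] at hs
  simp only [Real.coe_toNNReal _ hs.1.le]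
  ring

lemma controlResponse_half_smul_add {ω : Ω} (hω : Continuous fun t => W t ω) (u v : L1 T) {t : ℝ}
    (ht : t ∈ Icc 0 T) :
    controlResponse a W ((1 / 2 : ℝ) • (u + v) : L1 T) t ω =
      (controlResponse a W u t ω + controlResponse a W v t ω) / 2 := by
  unfold controlResponse
  rw [← intervalIntegral.integral_add
    (intervalIntegrable_stateFlow_mul ham haC hω (L1.intervalIntegrable u ht) t)
    (intervalIntegrable_stateFlow_mul ham haC hω (L1.intervalIntegrable v ht) t),
    ← intervalIntegral.integral_div]
  refine intervalIntegral.integral_congr_ae ?_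
  filter_upwards [ae_uIoc_of_ae_restrict_Ioo (coeFn_half_smul_add u v) ht] with s h1 h2
  rw [h1 h2]
  ring

/-- Along each path the response is continuous in the `L¹` norm of the control, because the
fundamental solution is bounded. -/
lemma tendsto_controlResponse {ω : Ω} (hω : Continuous fun t => W t ω) {v : ℕ → L1 T} {u : L1 T}
    (hv : Tendsto v atTop (𝓝 u)) {t : ℝ} (ht : t ∈ Icc 0 T) :
    Tendsto (fun n => controlResponse a W (v n) t ω) atTop (𝓝 (controlResponse a W u t ω)) := by
  obtain ⟨M, hM⟩ := (isCompact_Icc (a := (0 : ℝ)) (b := T)).exists_bound_of_continuousOn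
    (continuous_stateFlow_right ham haC hω t).continuousOn
  have hM0 : 0 ≤ M := (norm_nonneg _).trans (hM t ht)
  rw [tendsto_iff_norm_sub_tendsto_zero] at hv ⊢
  refine squeeze_zero (fun _ => norm_nonneg _) (fun n => ?_)
    (by simpa using hv.const_mul M)
  unfold controlResponse
  rw [← intervalIntegral.integral_sub
    (intervalIntegrable_stateFlow_mul ham haC hω (L1.intervalIntegrable (v n) ht) t)
    (intervalIntegrable_stateFlow_mul ham haC hω (L1.intervalIntegrable u ht) t),
    intervalIntegral.integral_of_le ht.1, L1.norm_eq_integral_norm]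
  have hint : Integrable (fun s => M * ‖(v n - u : L1 T) s‖) (volume.restrict (Ioc 0 T)) := by
    rw [← Measure.restrict_congr_set Ioo_ae_eq_Ioc]
    exact (L1.integrable_coeFn _).norm.const_mul M
  rw [← integral_const_mul, ← integral_Ioc_eq_integral_Ioo]
  refine (norm_integral_le_of_norm_le
    (hint.mono_measure (Measure.restrict_mono (Ioc_subset_Ioc_right ht.2) le_rfl)) ?_).trans ?_
  · filter_upwards [ae_restrict_of_ae (ae_uIoc_of_ae_restrict_Ioo (Lp.coeFn_sub (v n) u) ht),
      ae_restrict_mem measurableSet_Ioc] with s h1 h2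
    rw [← mul_sub, norm_mul, h1 (by rwa [uIoc_of_le ht.1]), Pi.sub_apply]
    exact mul_le_mul_of_nonneg_right (hM s ⟨h2.1.le, h2.2.trans ht.2⟩) (norm_nonneg _)
  · exact integral_mono_measure (Measure.restrict_mono (Ioc_subset_Ioc_right ht.2) le_rfl)
      (Eventually.of_forall fun s => mul_nonneg hM0 (norm_nonneg _)) hint

/-- The response determines the control, by Lebesgue's differentiation theorem. -/
lemma eq_of_controlResponse_eq {ω : Ω} (hω : Continuous fun t => W t ω) {u v : L1 T} (hT : 0 < T)
    (h : ∀ᵐ t ∂(volume.restrict (Ioo 0 T)),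
      controlResponse a W u t ω = controlResponse a W v t ω) : u = v := by
  have hTT : T ∈ Icc 0 T := ⟨hT.le, le_rfl⟩
  set f : ℝ → ℝ := fun s => stateFlow a W 0 s ω * u s - stateFlow a W 0 s ω * v s with hf
  have hiu := intervalIntegrable_stateFlow_mul ham haC hω (L1.intervalIntegrable u hTT) 0
  have hiv := intervalIntegrable_stateFlow_mul ham haC hω (L1.intervalIntegrable v hTT) 0
  have hfi : IntervalIntegrable f volume 0 T := hiu.sub hiv
  set G : ℝ → ℝ := fun t => ∫ s in (0 : ℝ)..t, f s with hG
  have hGae : G =ᵐ[volume.restrict (Ioo 0 T)] fun _ => 0 := by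
    filter_upwards [h, ae_restrict_mem measurableSet_Ioo] with t ht htT
    have htI : t ∈ Icc 0 T := ⟨htT.1.le, htT.2.le⟩
    have e : ∀ w : L1 T, controlResponse a W w t ω =
        stateFlow a W t 0 ω * ∫ s in (0 : ℝ)..t, stateFlow a W 0 s ω * w s := fun w => by
      unfold controlResponse
      rw [← intervalIntegral.integral_const_mul]
      congr 1; funext s
      rw [stateFlow_eq, mul_assoc]
    rw [e, e] at ht
    have ht' := mul_left_cancel₀ (stateFlow_pos t 0 ω).ne' ht
    simp only [hG, hf]
    rw [intervalIntegral.integral_sub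
      (intervalIntegrable_stateFlow_mul ham haC hω (L1.intervalIntegrable u htI) 0)
      (intervalIntegrable_stateFlow_mul ham haC hω (L1.intervalIntegrable v htI) 0), ht', sub_self]
  have hGc : ContinuousOn G (Ioo 0 T) := by
    have := intervalIntegral.continuousOn_primitive_interval' hfi left_mem_uIcc
    rw [uIcc_of_le hT.le] at this
    exact this.mono Ioo_subset_Icc_self
  have hG0 := Measure.eqOn_open_of_ae_eq hGae isOpen_Ioo hGc continuousOn_const
  refine Lp.ext ?_
  filter_upwards [ae_restrict_of_ae hfi.ae_hasDerivAt_integral,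
    ae_restrict_mem measurableSet_Ioo] with t h1 h2
  have h3 : HasDerivAt G (f t) t :=
    h1 (by rw [uIcc_of_le hT.le]; exact Ioo_subset_Icc_self h2) 0 left_mem_uIcc
  have h4 : HasDerivAt G 0 t := (hasDerivAt_const t (0 : ℝ)).congr_of_eventuallyEq
    (hG0.eventuallyEq_of_mem (isOpen_Ioo.mem_nhds h2))
  have h5 := h3.unique h4
  simp only [hf] at h5
  exact mul_left_cancel₀ (stateFlow_pos 0 t ω).ne' (sub_eq_zero.1 h5)

end Response

/-! ### The gap process -/

section Gap

variable {Ω : Type*} {mΩ : MeasurableSpace Ω} {P : Measure Ω} [IsProbabilityMeasure P]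
  {ℱ : Filtration ℝ≥0 mΩ} {W W' : ℝ≥0 → Ω → ℝ} {T p C : ℝ} {a a' : ℝ → ℝ} {z : ℝ≥0 → Ω → ℝ}

/-- By the Cauchy-Schwarz inequality in time. -/
lemma MemProcessSpace.memSource (hp : 0 < p) (hz : MemProcessSpace P ℱ T p z) :
    MemSource P ℱ T p z := by
  refine ⟨hz.adapted, hz.measurable, fun t ht => (hz.memLp t ht).2, ?_⟩
  have h := lintegral_sq_le (volume.restrict (Ioc 0 T))
    (measurable_eLpNorm_section (P := P) hp hz.measurable).aemeasurable
  have hfin : ∫⁻ s in Ioc 0 T, eLpNorm (z s.toNNReal) (ENNReal.ofReal p) P ^ 2 < ∞ := by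
    refine lt_of_le_of_lt ?_ hz.lintegral_lt_top
    refine (lintegral_mono_set Ioc_subset_Icc_self).trans (lintegral_mono fun s => ?_)
    rw [eLpNorm_ofReal_eq hp, ← ENNReal.rpow_natCast, ← ENNReal.rpow_mul]
    refine le_of_eq ?_
    congr 1
    push_cast; ring
  have hlt := h.trans_lt (ENNReal.mul_lt_top (by simp) hfin)
  simpa using hlt

lemma MemSource.sub_control (hp : 1 ≤ p) (hz : MemSource P ℱ T p z) (u : L1 T) :
    MemSource P ℱ T p (fun t ω => z t ω - u (t : ℝ)) := by
  have hum : Measurable u := (Lp.stronglyMeasurable u).measurable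
  have hp0 : 0 < p := by linarith
  have hb : ∀ t : ℝ≥0, eLpNorm (fun ω => z t ω - u (t : ℝ)) (ENNReal.ofReal p) P ≤
      eLpNorm (z t) (ENNReal.ofReal p) P + ‖u (t : ℝ)‖ₑ := fun t => by
    have hzt : Measurable (z t) := hz.measurable.comp measurable_prodMk_left
    refine (eLpNorm_sub_le (f := z t) (g := fun _ => u (t : ℝ)) hzt.aestronglyMeasurable
      aestronglyMeasurable_const (by simpa using hp)).trans (add_le_add le_rfl ?_)
    rw [eLpNorm_const _ (by simpa using hp0) (NeZero.ne P)]
    simp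
  refine ⟨fun t => (hz.adapted t).sub_const _, ?_, fun t ht => ?_, ?_⟩
  · exact hz.measurable.sub ((hum.comp measurable_subtype_coe).comp measurable_fst)
  · exact (hb t).trans_lt (ENNReal.add_lt_top.2 ⟨hz.eLpNorm_lt_top t ht, by simp⟩)
  · have hle : ∫⁻ s in Ioc (0 : ℝ) T, eLpNorm (fun ω => z s.toNNReal ω -
        u ((s.toNNReal : ℝ≥0) : ℝ)) (ENNReal.ofReal p) P ≤
        ∫⁻ s in Ioc (0 : ℝ) T, (eLpNorm (z s.toNNReal) (ENNReal.ofReal p) P +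
          ‖u ((s.toNNReal : ℝ≥0) : ℝ)‖ₑ) := lintegral_mono fun s => hb (Real.toNNReal s)
    refine hle.trans_lt ?_
    rw [lintegral_add_left (measurable_eLpNorm_section hp0 hz.measurable)]
    refine ENNReal.add_lt_top.2 ⟨hz.lintegral_lt_top, ?_⟩
    have h1 : ∫⁻ s in Ioc (0 : ℝ) T, ‖u ((s.toNNReal : ℝ≥0) : ℝ)‖ₑ =
        ∫⁻ s in Ioc (0 : ℝ) T, ‖u s‖ₑ :=
      setLIntegral_congr_fun measurableSet_Ioc fun s hs => by
        simp only [Real.coe_toNNReal _ hs.1.le]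
    rw [h1, ← Measure.restrict_congr_set Ioo_ae_eq_Ioc]
    exact (L1.integrable_coeFn u).2

variable (hW' : IsFiltrationBrownian P ℱ W') (hW'm : Measurable (Function.uncurry W'))
  (hWW' : ∀ᵐ ω ∂P, ∀ t, W' t ω = W t ω) (ham : Measurable a') (haC : ∀ s, |a' s| ≤ C)
  (haa' : a =ᵐ[volume.restrict (Ioo 0 T)] a') (hT : 0 < T)
include hW' hW'm hWW' ham haC haa' hT

/-- Here `W'` is a jointly measurable version of `W` and `a'` a bounded measurable version of `a`.
The equation for the gap process has a solution, so `solutionMap` does not take its default value, and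
by uniqueness the gap process agrees with the explicit state at each time. -/
lemma gap_spec (hz : MemSource P ℱ T 2 z) (u : L1 T) :
    Measurable (Function.uncurry (gap P ℱ W T a z u)) ∧
    (∀ t : ℝ≥0, (t : ℝ) ≤ T → gap P ℱ W T a z u t =ᵐ[P]
      explicitState a' W' (fun t ω => z t ω - u (t : ℝ)) t) ∧
    ∀ᵐ q ∂(P.prod (volume.restrict (Ioo 0 T))), gap P ℱ W T a z u q.2.toNNReal q.1 =
      explicitState a' W' (fun t ω => z t ω - u (t : ℝ)) q.2 q.1 := by
  obtain ⟨X, hX, hXe⟩ := exists_isSolution ham haC hW' hW'm hT (hz.sub_control one_le_two u)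
  have hWW : ∀ᵐ ω ∂P, ∀ t, W t ω = W' t ω := hWW'.mono fun ω h t => (h t).symm
  have hex : ∃ X, IsSolution P ℱ W T a 0 (fun t ω => z t ω - u (t : ℝ)) X :=
    ⟨X, hX.congr hWW haa'.symm⟩
  have hg : IsSolution P ℱ W T a 0 (fun t ω => z t ω - u (t : ℝ)) (gap P ℱ W T a z u) := by
    unfold gap solutionMap
    rw [dif_pos hex]
    exact hex.choose_spec
  have hgX : ∀ t : ℝ≥0, (t : ℝ) ≤ T → gap P ℱ W T a z u t =ᵐ[P] X t := fun t ht =>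
    IsSolution.ae_eq hW' hT haC ham (hg.congr hWW' haa') hX ht
  refine ⟨hg.mem.measurable, fun t ht => ?_, ?_⟩
  · filter_upwards [hgX t ht, hXe] with ω h1 h2
    rw [h1, h2 t ht]
  · have hm : ∀ {Z : ℝ≥0 → Ω → ℝ}, Measurable (Function.uncurry Z) →
        Measurable fun q : Ω × ℝ => Z q.2.toNNReal q.1 := fun hZ =>
      (measurable_toNNReal_uncurry hZ).comp measurable_swap
    have hset : MeasurableSet {q : Ω × ℝ | gap P ℱ W T a z u q.2.toNNReal q.1 =
        X q.2.toNNReal q.1} := measurableSet_eq_fun (hm hg.mem.measurable) (hm hX.mem.measurable)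
    have h1 : ∀ᵐ q ∂(P.prod (volume.restrict (Ioo 0 T))),
        gap P ℱ W T a z u q.2.toNNReal q.1 = X q.2.toNNReal q.1 := by
      rw [Measure.ae_prod_iff_ae_ae hset]
      refine (Measure.ae_ae_comm (p := fun ω (s : ℝ) => gap P ℱ W T a z u s.toNNReal ω =
        X s.toNNReal ω) hset).2 ?_
      filter_upwards [ae_restrict_mem measurableSet_Ioo] with s hs
      exact hgX s.toNNReal (by rw [Real.coe_toNNReal _ hs.1.le]; exact hs.2.le)
    filter_upwards [h1, Measure.quasiMeasurePreserving_fst.ae hXe,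
      Measure.quasiMeasurePreserving_snd.ae (ae_restrict_mem measurableSet_Ioo)] with q h1 h2 h3
    rw [h1, h2 q.2.toNNReal (by rw [Real.coe_toNNReal _ h3.1.le]; exact h3.2.le),
      Real.coe_toNNReal _ h3.1.le]

/-- The gap process is the uncontrolled state minus the response to the control. -/
lemma ae_gap_eq_sub (hz : MemSource P ℱ T 2 z) (u : L1 T) :
    ∀ᵐ q ∂(P.prod (volume.restrict (Ioo 0 T))), gap P ℱ W T a z u q.2.toNNReal q.1 =
      explicitState a' W' z q.2 q.1 - controlResponse a' W' u q.2 q.1 := by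
  filter_upwards [(gap_spec hW' hW'm hWW' ham haC haa' hT hz u).2.2,
    Measure.quasiMeasurePreserving_fst.ae hW'.isBrownian.cont,
    Measure.quasiMeasurePreserving_fst.ae (hz.ae_intervalIntegrable one_le_two hT.le),
    Measure.quasiMeasurePreserving_snd.ae (ae_restrict_mem measurableSet_Ioo)] with q h1 h2 h3 h4
  rw [h1, explicitState_sub_control ham haC h2 h3 u ⟨h4.1.le, h4.2.le⟩]

lemma exists_eLpNorm_gap_le (hp : 2 ≤ p) (hz : MemSource P ℱ T p z) (u : L1 T) :
    ∃ B : ℝ≥0∞, B < ∞ ∧ ∀ t : ℝ≥0, (t : ℝ) ≤ T →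
      eLpNorm (gap P ℱ W T a z u t) (ENNReal.ofReal p) P ≤ B := by
  have hp1 : 1 ≤ p := by linarith
  refine ⟨flowBound C T p *
      ∫⁻ s in Ioc 0 T, normWeight P p (fun t ω => z t ω - u (t : ℝ)) s,
    ENNReal.mul_lt_top ENNReal.ofReal_lt_top (hz.sub_control hp1 u).lintegral_normWeight_lt_top,
    fun t ht => ?_⟩
  rw [eLpNorm_congr_ae ((gap_spec hW' hW'm hWW' ham haC haa' hT (hz.mono hp) u).2.1 t ht)]
  exact eLpNorm_explicitState_le ham haC hW' hW'm hp1 (hz.sub_control hp1 u)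
    (NNReal.coe_nonneg t) ht

end Gap

/-! ### The cost functional -/

section Cost

variable {Ω : Type*} {mΩ : MeasurableSpace Ω} {P : Measure Ω} [IsProbabilityMeasure P]
  {T p : ℝ}

lemma aemeasurable_running_cost {F : ℝ → ℝ → ℝ}
    (hFm : ∀ x, AEMeasurable (fun t => F t x) (volume.restrict (Ioo 0 T)))
    (hFc : ∀ᵐ t ∂(volume.restrict (Ioo 0 T)), Continuous (F t)) {X : ℝ≥0 → Ω → ℝ}
    (hX : Measurable (Function.uncurry X)) :
    AEMeasurable (fun q : Ω × ℝ => ENNReal.ofReal (F q.2 (X q.2.toNNReal q.1)))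
      (P.prod (volume.restrict (Ioo 0 T))) := by
  obtain ⟨F', hF'm, hF'⟩ := exists_measurable_uncurry_of_caratheodory hFm hFc
  have hXm : Measurable fun q : Ω × ℝ => X q.2.toNNReal q.1 :=
    (measurable_toNNReal_uncurry hX).comp measurable_swap
  refine ((hF'm.comp (measurable_snd.prodMk hXm)).ennreal_ofReal.aemeasurable).congr ?_
  filter_upwards [Measure.quasiMeasurePreserving_snd.ae hF'] with q hq
  simp only [Function.comp, Function.uncurry, hq]

lemma rpow_abs_le_one_add {α : ℝ} (hα : 0 < α) (hαp : α ≤ p) (x : ℝ) :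
    |x| ^ α ≤ 1 + |x| ^ p := by
  rcases le_total |x| 1 with h | h
  · have h1 := Real.rpow_le_one (abs_nonneg x) h hα.le
    have h2 := Real.rpow_nonneg (abs_nonneg x) p
    linarith
  · have h1 := Real.rpow_le_rpow_of_exponent_le h hαp
    linarith

/-- The growth condition makes the expected running cost of an `L^p`-bounded process finite. -/
lemma lintegral_running_cost_lt_top {F : ℝ → ℝ → ℝ}
    (hFm : ∀ x, AEMeasurable (fun t => F t x) (volume.restrict (Ioo 0 T)))
    (hFc : ∀ᵐ t ∂(volume.restrict (Ioo 0 T)), Continuous (F t)) {X : ℝ≥0 → Ω → ℝ}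
    (hX : Measurable (Function.uncurry X)) (hp : 0 < p) {B : ℝ≥0∞} (hB : B < ∞)
    (hXB : ∀ t : ℝ≥0, (t : ℝ) ≤ T → eLpNorm (X t) (ENNReal.ofReal p) P ≤ B)
    {α : ℝ} (hα : 0 < α) (hαp : α ≤ p) {L : ℝ → ℝ} (hL : IntegrableOn L (Ioo 0 T))
    (hL0 : ∀ t ∈ Ioo 0 T, 0 ≤ L t)
    (hF : ∀ t ∈ Ioo 0 T, ∀ x, F t x ≤ L t * (1 + |x| ^ α)) :
    ∫⁻ q, ENNReal.ofReal (F q.2 (X q.2.toNNReal q.1)) ∂(P.prod (volume.restrict (Ioo 0 T))) <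
      ∞ := by
  rw [lintegral_prod_symm _ (aemeasurable_running_cost hFm hFc hX)]
  have hK : 2 + B ^ p ≠ ∞ :=
    ENNReal.add_ne_top.2 ⟨by simp, (ENNReal.rpow_lt_top_of_nonneg hp.le hB.ne).ne⟩
  have hb : ∀ t ∈ Ioo 0 T, ∫⁻ ω, ENNReal.ofReal (F t (X t.toNNReal ω)) ∂P ≤
      ENNReal.ofReal (L t) * (2 + B ^ p) := fun t ht => by
    have hpt : ∀ x : ℝ, ENNReal.ofReal (F t x) ≤ ENNReal.ofReal (L t) * (2 + ‖x‖ₑ ^ p) := by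
      intro x
      have h1 : F t x ≤ L t * (2 + |x| ^ p) := by
        refine (hF t ht x).trans (mul_le_mul_of_nonneg_left ?_ (hL0 t ht))
        linarith [rpow_abs_le_one_add hα hαp x]
      refine (ENNReal.ofReal_le_ofReal h1).trans_eq ?_
      rw [ENNReal.ofReal_mul (hL0 t ht), ENNReal.ofReal_add (by norm_num) (by positivity),
        ← ENNReal.ofReal_rpow_of_nonneg (abs_nonneg x) hp.le, ← Real.enorm_eq_ofReal_abs]
      simp
    have hXm : Measurable (X t.toNNReal) := hX.comp measurable_prodMk_left
    refine (lintegral_mono fun ω => hpt _).trans ?_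
    rw [lintegral_const_mul' _ _ ENNReal.ofReal_ne_top, lintegral_add_left measurable_const,
      lintegral_const, measure_univ, mul_one]
    gcongr
    have h2 := hXB t.toNNReal (by rw [Real.coe_toNNReal _ ht.1.le]; exact ht.2.le)
    rw [eLpNorm_ofReal_eq hp] at h2
    have h3 := ENNReal.rpow_le_rpow h2 hp.le
    rwa [← ENNReal.rpow_mul, one_div, inv_mul_cancel₀ hp.ne', ENNReal.rpow_one] at h3
  refine (setLIntegral_mono' measurableSet_Ioo hb).trans_lt ?_
  rw [lintegral_mul_const' _ _ hK]
  refine ENNReal.mul_lt_top ?_ hK.lt_top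
  refine lt_of_le_of_lt (lintegral_mono fun t => ?_) hL.2
  exact Real.ofReal_le_enorm (L t)

end Cost

end DriftControl

end

theorem mainTheorem3 {Ω : Type*} {mΩ : MeasurableSpace Ω}
    (P : Measure Ω) [IsProbabilityMeasure P]
    (ℱ : Filtration ℝ≥0 mΩ) (W : ℝ≥0 → Ω → ℝ)
    (hW : DriftControl.IsFiltrationBrownian P ℱ W)
    (T : ℝ) (hT : 0 < T)
    (a : ℝ → ℝ) (ha : MemLp a ⊤ (volume.restrict (Ioo 0 T)))
    -- integrability of the stochastic drift
    (p : ℝ) (hp : 2 ≤ p)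
    (z : ℝ≥0 → Ω → ℝ) (hz : DriftControl.MemProcessSpace P ℱ T p z)
    -- the running cost: measurable in time, nonnegative, of class C² in the state variable
    -- with jointly continuous derivatives, of controlled growth, convex in the state variable
    (F : ℝ → ℝ → ℝ)
    (hF_meas : ∀ x, AEMeasurable (fun t => F t x) (volume.restrict (Ioo 0 T)))
    (hF_nonneg : ∀ t ∈ Icc 0 T, ∀ x, 0 ≤ F t x)
    (hF_smooth : ∀ t ∈ Icc 0 T, ContDiff ℝ 2 (F t))
    (hF_deriv : ContinuousOn (fun q : ℝ × ℝ => deriv (F q.1) q.2) (Icc 0 T ×ˢ univ))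
    (hF_deriv2 : ContinuousOn (fun q : ℝ × ℝ => deriv (deriv (F q.1)) q.2) (Icc 0 T ×ˢ univ))
    (hF_growth : ∃ α : ℝ, 0 < α ∧ α < p ∧ ∃ L : ℝ → ℝ, IntegrableOn L (Ioo 0 T) ∧
      (∀ t ∈ Icc 0 T, 0 ≤ L t) ∧
      ∀ t ∈ Icc 0 T, ∀ x : ℝ,
        |F t x| + |deriv (F t) x| + |deriv (deriv (F t)) x| ≤ L t * (1 + |x| ^ α))
    (hF_convex : ∀ t ∈ Icc 0 T, ConvexOn ℝ univ (F t))
    (δ : ℝ) (hδ : 0 < δ)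
    (Ψ : ℝ → ℝ) (hΨ : DriftControl.IsYoungFunction Ψ) (hΨ2 : DriftControl.SatisfiesDelta2 Ψ) :
    (∃ v : DriftControl.L1 T,
      DriftControl.penalizedCost P ℱ W T a z F δ Ψ v < ∞ ∧
      ∀ u : DriftControl.L1 T,
        DriftControl.penalizedCost P ℱ W T a z F δ Ψ v ≤
          DriftControl.penalizedCost P ℱ W T a z F δ Ψ u) ∧
    (((∀ t ∈ Icc 0 T, StrictConvexOn ℝ univ (F t)) ∨ StrictConvexOn ℝ (Ici 0) Ψ) →
      ∃! v : DriftControl.L1 T, ∀ u : DriftControl.L1 T,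
        DriftControl.penalizedCost P ℱ W T a z F δ Ψ v ≤
          DriftControl.penalizedCost P ℱ W T a z F δ Ψ u) := by
  open DriftControl in
  have hp0 : 0 < p := by linarith
  -- pass to a jointly measurable Brownian motion and to a bounded measurable coefficient
  obtain ⟨W', hW', hW'm, hWW'⟩ := hW.exists_measurable
  obtain ⟨a', ham, ⟨C, haC⟩, haa'⟩ := exists_bounded_measurable_ae_eq ha
  have hzp : MemSource P ℱ T p z := hz.memSource hp0
  have hz2 : MemSource P ℱ T 2 z := hzp.mono hp
  set μ : Measure ℝ := volume.restrict (Ioo 0 T) with hμ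
  have hIoo : ∀ᵐ t ∂μ, t ∈ Ioo 0 T := ae_restrict_mem measurableSet_Ioo
  have hIcc : ∀ᵐ t ∂μ, t ∈ Icc 0 T := hIoo.mono fun t ht => Ioo_subset_Icc_self ht
  have hFc : ∀ᵐ t ∂μ, Continuous (F t) := hIcc.mono fun t ht => (hF_smooth t ht).continuous
  have hgm : ∀ u : L1 T, Measurable (Function.uncurry (gap P ℱ W T a z u)) := fun u =>
    (gap_spec hW' hW'm hWW' ham haC haa' hT hz2 u).1
  have hgap := ae_gap_eq_sub hW' hW'm hWW' ham haC haa' hT hz2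
  have hcont : ∀ᵐ q ∂(P.prod μ), Continuous fun t => W' t q.1 :=
    Measure.quasiMeasurePreserving_fst.ae hW'.isBrownian.cont
  have htime : ∀ᵐ q ∂(P.prod μ), q.2 ∈ Icc 0 T := Measure.quasiMeasurePreserving_snd.ae hIcc
  have hcost : ∀ u : L1 T, cost P ℱ W T a z F u = ∫⁻ q, ENNReal.ofReal
      (F q.2 (gap P ℱ W T a z u q.2.toNNReal q.1)) ∂(P.prod μ) := fun u => by
    rw [lintegral_prod _ (aemeasurable_running_cost hF_meas hFc (hgm u))]
    rfl
  -- the zero control has finite cost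
  have hfin : penalizedCost P ℱ W T a z F δ Ψ (0 : L1 T) < ∞ := by
    obtain ⟨B, hB, hgB⟩ := exists_eLpNorm_gap_le hW' hW'm hWW' ham haC haa' hT hp hzp (0 : L1 T)
    obtain ⟨α, hα, hαp, L, hL, hL0, hFL⟩ := hF_growth
    have h0 : penalty T Ψ (0 : L1 T) = 0 := by
      unfold penalty
      refine (lintegral_congr_ae ?_).trans lintegral_zero
      filter_upwards [Lp.coeFn_zero ℝ 1 (volume.restrict (Ioo (0 : ℝ) T))] with t ht
      rw [ht]
      simp [hΨ.zero]
    unfold penalizedCost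
    rw [h0, mul_zero, add_zero, hcost]
    refine lintegral_running_cost_lt_top hF_meas hFc (hgm 0) hp0 hB hgB hα hαp.le hL
      (fun t ht => hL0 t (Ioo_subset_Icc_self ht)) fun t ht x => ?_
    refine le_trans ?_ (hFL t (Ioo_subset_Icc_self ht) x)
    linarith [le_abs_self (F t x), abs_nonneg (deriv (F t) x), abs_nonneg (deriv (deriv (F t)) x)]
  have key := exists_minimizer_of_affine_state (μ := μ) (ν := P.prod μ) Prod.snd
    Measure.quasiMeasurePreserving_snd hF_meas (hIcc.mono hF_nonneg) hFc (hIcc.mono hF_convex)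
    (fun u q => gap P ℱ W T a z u q.2.toNNReal q.1)
    (fun u => (measurable_toNNReal_uncurry (hgm u)).comp measurable_swap) ?_ ?_ ?_ hδ hΨ
    (penalizedCost P ℱ W T a z F δ Ψ) (fun u => by rw [← hcost]; rfl) hfin
  · exact ⟨key.1, fun h => key.2 (h.imp_left fun h' => hIcc.mono h')⟩
  · intro u v
    filter_upwards [hgap ((1 / 2 : ℝ) • (u + v)), hgap u, hgap v, hcont, htime]
      with q h1 h2 h3 h4 h5
    rw [h1, h2, h3, controlResponse_half_smul_add ham haC h4 u v h5]
    ring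
  · intro v u hv
    filter_upwards [ae_all_iff.2 fun n => hgap (v n), hgap u, hcont, htime] with q h1 h2 h3 h4
    simp only [h1, h2]
    exact (tendsto_controlResponse ham haC h3 hv h4).const_sub _
  · intro u v huv
    have h : ∀ᵐ q ∂(P.prod μ),
        controlResponse a' W' u q.2 q.1 = controlResponse a' W' v q.2 q.1 := by
      filter_upwards [huv, hgap u, hgap v] with q h1 h2 h3
      rw [h2, h3] at h1
      exact sub_right_injective h1
    -- one path for which the responses agree at almost all times suffices
    obtain ⟨ω, h1, h2⟩ := ((Measure.ae_ae_of_ae_prod h).and hW'.isBrownian.cont).exists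
    exact eq_of_controlResponse_eq ham haC h2 hT h1
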